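/- Let $n\ge 3$. There is a constant $\delta>0$, depending only on $n$, such that the following holds for every integer $k$ with $1\le k\le n/2$ and every non-empty open set $\Omega\subset\mathbb R^n$. For a positive function $u\in C^2(\Omega)$ let $$A^u=-\frac{2}{n-2}u^{-\frac{n+2}{n-2}}\nabla^2u+\frac{2n}{(n-2)^2}u^{-\frac{2n}{n-2}}\,du\otimes du-\frac{2}{(n-2)^2}u^{-\frac{2n}{n-2}}|du|^2 I$$ be the $(1,1)$-Schouten tensor of $u^{\frac{4}{n-2}}$ times the Euclidean metric, and let $\lambda(A^u)=(\lambda_1,\dots,\lambda_n)$ be its eigenvalues. Let $\sigma_k(\lambda)=\sum_{i_1<\dots<i_k}\lambda_{i_1}\cdots\lambda_{i_k}$, let $\Gamma_k$ be the connected component of $\{\lambda\in\mathbb R^n:\sigma_k(\lambda)>0\}$ that contains the positive cone $\{\lambda:\lambda_1,\dots,\lambda_n>0\}$, and let $\bar\Gamma_k$ be its closure. If $u\in C^2(\Omega)$ satisfies $$\sigma_k(\lambda(A^u))\le 1,\qquad \lambda(A^u)\in\bar\Gamma_k,\qquad u>0\qquad\text{in }\Omega,$$ and $\int_\Omega u^{\frac{2n}{n-2}}\,dx<\delta$,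 then $$\operatorname{dist}(x,\partial\Omega)^{\frac{n-2}{2}}\,u(x)\le 4^{\frac{n-2}{2}}\qquad\text{for all }x\in\Omega.$$ Here $\operatorname{dist}(x,\emptyset)=+\infty$, so for $\Omega=\mathbb R^n$ the assertion is that no such $u$ exists. -/

import Mathlib

open scoped ENNReal

noncomputable section

/-- The `k`-th elementary symmetric function `σ_k(λ)` on `ℝⁿ`. -/
def sigmaK {n : ℕ} (k : ℕ) (l : Fin n → ℝ) : ℝ :=
  ∑ s ∈ (Finset.univ : Finset (Fin n)).powersetCard k, ∏ i ∈ s, l i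

/-- `Γ_k`: the connected component of `{λ ∈ ℝⁿ : σ_k(λ) > 0}` that contains the positive cone,
given as the component of the point `(1, …, 1)` of that cone. -/
def GammaCone (n k : ℕ) : Set (Fin n → ℝ) :=
  connectedComponentIn {l : Fin n → ℝ | 0 < sigmaK k l} (fun _ => 1)

/-- The cone `Γ_k` really contains the whole positive cone. -/
theorem positiveCone_subset_GammaCone {n k : ℕ} (hk : k ≤ n) :
    {l : Fin n → ℝ | ∀ i, 0 < l i} ⊆ GammaCone n k := by
  apply IsPreconnected.subset_connectedComponentIn
  · apply Convex.isPreconnected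
    intro x hx y hy a b ha hb hab i
    have h1 := hx i
    have h2 := hy i
    simp only [Pi.add_apply, Pi.smul_apply, smul_eq_mul]
    rcases ha.eq_or_lt with h | h
    · have : b = 1 := by linarith
      subst this
      subst h
      simpa using h2
    · have := mul_pos h h1
      have := mul_nonneg hb h2.le
      linarith
  · intro i
    exact one_pos
  · intro l hl
    refine Finset.sum_pos (fun s _ => Finset.prod_pos fun i _ => hl i) ?_
    rw [Finset.powersetCard_nonempty]
    simpa using hk

/-- The partial derivative `∂_i u (x)`. -/
def partialD {n : ℕ} (u : EuclideanSpace ℝ (Fin n) → ℝ) (x : EuclideanSpace ℝ (Fin n))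
    (i : Fin n) : ℝ :=
  fderiv ℝ u x (EuclideanSpace.single i 1)

/-- The second partial derivative `∂_i ∂_j u (x)`. -/
def hessD {n : ℕ} (u : EuclideanSpace ℝ (Fin n) → ℝ) (x : EuclideanSpace ℝ (Fin n))
    (i j : Fin n) : ℝ :=
  fderiv ℝ (fderiv ℝ u) x (EuclideanSpace.single i 1) (EuclideanSpace.single j 1)

/-- The matrix `A^u(x)` of the `(1,1)`-Schouten tensor of `u^{4/(n-2)}` times the Euclidean metric:
`-2/(n-2) u^{-(n+2)/(n-2)} ∇²u + 2n/(n-2)² u^{-2n/(n-2)} du ⊗ du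
  - 2/(n-2)² u^{-2n/(n-2)} |du|² I`. -/
def schoutenMatrix {n : ℕ} (u : EuclideanSpace ℝ (Fin n) → ℝ) (x : EuclideanSpace ℝ (Fin n)) :
    Matrix (Fin n) (Fin n) ℝ :=
  Matrix.of fun i j =>
    -(2 / ((n : ℝ) - 2)) * u x ^ (-(((n : ℝ) + 2) / ((n : ℝ) - 2))) * hessD u x i j
    + 2 * (n : ℝ) / ((n : ℝ) - 2) ^ 2 * u x ^ (-(2 * (n : ℝ) / ((n : ℝ) - 2)))
        * (partialD u x i * partialD u x j)
    - 2 / ((n : ℝ) - 2) ^ 2 * u x ^ (-(2 * (n : ℝ) / ((n : ℝ) - 2)))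
        * (∑ l, partialD u x l ^ 2) * (if i = j then 1 else 0)

/-- `A^u(x)` is symmetric at every point of an open set on which `u` is of class `C²`. -/
theorem schoutenMatrix_isHermitian {n : ℕ} {u : EuclideanSpace ℝ (Fin n) → ℝ}
    {Ω : Set (EuclideanSpace ℝ (Fin n))} (hΩ : IsOpen Ω) (hu : ContDiffOn ℝ 2 u Ω)
    {x : EuclideanSpace ℝ (Fin n)} (hx : x ∈ Ω) : (schoutenMatrix u x).IsHermitian := by
  have hs : IsSymmSndFDerivAt ℝ u x :=
    (hu.contDiffAt (hΩ.mem_nhds hx)).isSymmSndFDerivAt (by simp)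
  ext i j
  have h : hessD u x j i = hessD u x i j := hs _ _
  simp [schoutenMatrix, Matrix.conjTranspose_apply, h, mul_comm (partialD u x j), eq_comm (a := j)]

/-- `λ(A)`: the vector of eigenvalues, with multiplicity, of a real symmetric matrix
(and `0` for a matrix that is not symmetric). -/
def eigenvalueVector {n : ℕ} (A : Matrix (Fin n) (Fin n) ℝ) : Fin n → ℝ :=
  open Classical in if h : A.IsHermitian then h.eigenvalues else 0

end

/-!
With `w = u ^ (-2 / (n - 2))` the Schouten tensor becomes `A = w ∇²w - ½ |∇w|² I`, the energy is
`∫ w ^ (-n)`, and the claim reads `dist(x, ∂Ω) ≤ 4 w(x)`.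

*Algebra.* The nonnegativity of `σ_j`, `j ≤ k`, and of the Newton tensors `T_j(A)`, `j < k`, follows
from `λ(A) ∈ closure Γ_k` (`esymmOn_nonneg_of_mem_closure_GammaCone`). Up to positive factors, the
numbers `σ_k, …, σ_0` are the coefficients of a derivative of `∏ (X + λ_i)`, which is real-rooted by
Rolle's theorem. If they are nonnegative and `σ_k > 0`, all roots are negative and all coefficients
positive. Hence positivity of all the quantities involved is a relatively clopen condition in
`{σ_k > 0}`.

*Divergence structure.* Up to lower-order terms `T_j(A)` is divergence free. This yields an identity
for the divergence of `ψ w T_j(A) ∇w` in which no third derivative of `w` is left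
(`sum_newtonTensorDeriv`), and which holds weakly for `w` of class `C²` by mollification
(`integral_newtonFlux`).

*Caccioppoli inequality.* Test functions `ψ = ζ ^ N w ^ (-γ) |∇w| ^ (2b)` with large `γ` make
`∫ ζ ^ N w ^ (-γ) |∇w| ^ (2b + 2) σ_j` controlled by `∫ ζ ^ N w ^ (-γ) |∇w| ^ (2b) σ_{j+1}`
(`energy_descent`). From `j = 0` one arrives at `j = k`, where `σ_k ≤ 1` is used;
the error terms without gradient factor are reduced to `j = 0` by the identity with `b = 0`
(`energy_lower_order`). Since `w ≥ 1/2`, the outcome is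
`∫ ζ ^ (2k + 2) w ^ (-(m + 2k)) |∇w| ^ (2k) ≤ C Λ ^ N ∫ ζ ² w ^ (-m)`, where `Λ` bounds `m + 2k` and
the gradient of `ζ` (`caccioppoli`). The constant is polynomial in `Λ`.

*Moser's iteration.* Together with the Sobolev inequality for `L¹` gradients this bounds
`∫ w ^ (-m n / (n - 1))` on a ball by a power of `∫ w ^ (-m)` on a larger ball (`moser_step`). If
`∫ w ^ (-n)` over the unit ball is small, iteration gives decay of `∫ w ^ (-m)` that is incompatible
with `w(0) = 1` (`exists_energy_threshold`).

*Point picking.* If `closedBall x₀ d ⊆ Ω` with `d > 4 w(x₀)`, a maximum point `x₁` of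
`(d - |x - x₀|) / w` satisfies `w ≥ w(x₁) / 2` on the ball of radius `2 w(x₁)` around `x₁`
(`exists_half_le_of_lt`). The rescaling `w(x₁ + w(x₁) y) / w(x₁)` preserves `A` and the energy, and
contradicts the previous step.
-/

/-! ### Elementary symmetric functions on the cone `Γ_k` -/

section

open Finset

/-- The elementary symmetric function of degree `j` in the variables `l i`, `i ∈ S`. -/
noncomputable def esymmOn {ι : Type*} (S : Finset ι) (j : ℕ) (l : ι → ℝ) : ℝ :=
  ∑ s ∈ S.powersetCard j, ∏ i ∈ s, l i

section ElementarySymmetric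

variable {ι : Type*}

theorem continuous_esymmOn (S : Finset ι) (j : ℕ) : Continuous (esymmOn S j) := by
  unfold esymmOn; fun_prop

@[simp] theorem esymmOn_zero (S : Finset ι) (l : ι → ℝ) : esymmOn S 0 l = 1 := by
  simp [esymmOn]

theorem esymmOn_eq_zero_of_card_lt {S : Finset ι} {j : ℕ} (h : S.card < j) (l : ι → ℝ) :
    esymmOn S j l = 0 := by
  simp [esymmOn, Finset.powersetCard_eq_empty.2 h]

theorem esymmOn_pos {S : Finset ι} {j : ℕ} (h : j ≤ S.card) {l : ι → ℝ}
    (hl : ∀ i ∈ S, 0 < l i) : 0 < esymmOn S j l :=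
  Finset.sum_pos (fun _ hs => Finset.prod_pos fun i hi =>
    hl i ((Finset.mem_powersetCard.1 hs).1 hi)) (Finset.powersetCard_nonempty.2 h)

/-- Expansion with respect to one of the variables. -/
theorem esymmOn_succ_eq [DecidableEq ι] {S : Finset ι} {i : ι} (hi : i ∈ S) (j : ℕ) (l : ι → ℝ) :
    esymmOn S (j + 1) l = esymmOn (S.erase i) (j + 1) l + l i * esymmOn (S.erase i) j l := by
  conv_lhs => rw [esymmOn, ← Finset.insert_erase hi]
  rw [Finset.powersetCard_succ_insert (Finset.notMem_erase i S), Finset.sum_union]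
  · congr 1
    rw [Finset.sum_image, esymmOn, Finset.mul_sum]
    · refine Finset.sum_congr rfl fun s hs => ?_
      rw [Finset.prod_insert]
      intro h
      exact Finset.notMem_erase i S ((Finset.mem_powersetCard.1 hs).1 h)
    · intro s hs t ht hst
      have hs' : i ∉ s := fun h => Finset.notMem_erase i S ((Finset.mem_powersetCard.1 hs).1 h)
      have ht' : i ∉ t := fun h => Finset.notMem_erase i S ((Finset.mem_powersetCard.1 ht).1 h)
      rw [← Finset.erase_insert hs', ← Finset.erase_insert ht']
      exact congrArg (fun r => r.erase i) hst
  · rw [Finset.disjoint_left]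
    intro s hs hs'
    obtain ⟨t, _, rfl⟩ := Finset.mem_image.1 hs'
    exact Finset.notMem_erase i S ((Finset.mem_powersetCard.1 hs).1 (Finset.mem_insert_self i t))

/-- Euler's relation for the homogeneous polynomial `esymmOn S (j + 1)`. -/
theorem sum_mul_esymmOn_erase [DecidableEq ι] (S : Finset ι) (j : ℕ) (l : ι → ℝ) :
    ∑ i ∈ S, l i * esymmOn (S.erase i) j l = (j + 1) * esymmOn S (j + 1) l := by
  have h1 : ∀ i ∈ S, l i * esymmOn (S.erase i) j l =
      ∑ s ∈ S.powersetCard (j + 1), if i ∈ s then ∏ a ∈ s, l a else 0 := by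
    intro i hi
    have := esymmOn_succ_eq hi j l
    have h2 : esymmOn (S.erase i) (j + 1) l =
        ∑ s ∈ S.powersetCard (j + 1), if i ∈ s then 0 else ∏ a ∈ s, l a := by
      have e : (S.erase i).powersetCard j.succ = {s ∈ S.powersetCard j.succ | i ∉ s} := by
        ext s
        simp only [Finset.mem_powersetCard, Finset.mem_filter, Finset.subset_erase]
        tauto
      rw [esymmOn, e, Finset.sum_filter]
      refine Finset.sum_congr rfl fun s _ => ?_
      split_ifs <;> rfl
    have h3 : esymmOn S (j + 1) l = (∑ s ∈ S.powersetCard (j + 1),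
        if i ∈ s then 0 else ∏ a ∈ s, l a) +
        ∑ s ∈ S.powersetCard (j + 1), if i ∈ s then ∏ a ∈ s, l a else 0 := by
      rw [← Finset.sum_add_distrib, esymmOn]
      refine Finset.sum_congr rfl fun s _ => ?_
      split_ifs <;> simp
    linarith
  rw [Finset.sum_congr rfl h1, Finset.sum_comm, esymmOn, Finset.mul_sum]
  refine Finset.sum_congr rfl fun s hs => ?_
  obtain ⟨hs1, hs2⟩ := Finset.mem_powersetCard.1 hs
  rw [← Finset.sum_filter, Finset.filter_mem_eq_inter, Finset.inter_eq_right.2 hs1,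
    Finset.sum_const, hs2]
  simp

end ElementarySymmetric

section RealRooted

open Polynomial

/-- Rolle's theorem: the derivative of a real-rooted polynomial is real-rooted. -/
theorem Polynomial.Splits.derivative_real {f : ℝ[X]} (hf : f.Splits) : f.derivative.Splits := by
  rcases Nat.eq_zero_or_pos f.natDegree with h | h
  · rw [Polynomial.eq_C_of_natDegree_eq_zero h]
    simp
  · rw [splits_iff_card_roots] at hf ⊢
    have h1 := card_roots_le_derivative f
    have h2 := Polynomial.card_roots' f.derivative
    have h3 := Polynomial.natDegree_derivative_lt h.ne'
    omega

theorem Polynomial.Splits.iterate_derivative_real {f : ℝ[X]} (hf : f.Splits) (m : ℕ) :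
    (derivative^[m] f).Splits := by
  induction m with
  | zero => exact hf
  | succ m ih => rw [Function.iterate_succ_apply']; exact ih.derivative_real

/-- A monic polynomial with negative roots has positive coefficients. -/
theorem Multiset.coeff_prod_X_sub_C_pos (s : Multiset ℝ) (hs : ∀ a ∈ s, a < 0) :
    (∀ t, 0 ≤ ((s.map fun a => X - C a).prod).coeff t) ∧
      ∀ t ≤ s.card, 0 < ((s.map fun a => X - C a).prod).coeff t := by
  induction s using Multiset.induction with
  | empty => simp [coeff_one]; intro t; split_ifs <;> norm_num
  | cons a s ih =>
    obtain ⟨h1, h2⟩ := ih fun b hb => hs b (Multiset.mem_cons_of_mem hb)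
    have ha := hs a (Multiset.mem_cons_self a s)
    rw [Multiset.map_cons, Multiset.prod_cons, Multiset.card_cons]
    have hc : ∀ t, ((X - C a) * (s.map fun a => X - C a).prod).coeff (t + 1) =
        ((s.map fun a => X - C a).prod).coeff t
          + (-a) * ((s.map fun a => X - C a).prod).coeff (t + 1) := by
      intro t; rw [sub_mul, coeff_sub, coeff_X_mul, coeff_C_mul]; ring
    have h0 : ((X - C a) * (s.map fun a => X - C a).prod).coeff 0 =
        (-a) * ((s.map fun a => X - C a).prod).coeff 0 := by
      simp [sub_mul]
    constructor
    · rintro (_ | t)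
      · rw [h0]; exact mul_nonneg (by linarith) (h1 0)
      · rw [hc]; exact add_nonneg (h1 t) (mul_nonneg (by linarith) (h1 _))
    · rintro (_ | t) ht
      · rw [h0]; exact mul_pos (by linarith) (h2 0 (Nat.zero_le _))
      · rw [hc]
        exact add_pos_of_pos_of_nonneg (h2 t (by omega)) (mul_nonneg (by linarith) (h1 _))

/-- If `σ_0, …, σ_{k-1}` are nonnegative and `σ_k` is positive, then all of them are positive.
Up to positive factors they are the coefficients of the `(|S| - k)`-th derivative of the real-rooted
polynomial `∏ (X + l i)`, whose roots are then all negative. -/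
theorem esymmOn_pos_of_nonneg {ι : Type*} {S : Finset ι} {k : ℕ} {l : ι → ℝ}
    (h0 : ∀ j < k, 0 ≤ esymmOn S j l) (hk : 0 < esymmOn S k l) :
    ∀ j ≤ k, 0 < esymmOn S j l := by
  have hkS : k ≤ S.card := by
    by_contra h
    rw [esymmOn_eq_zero_of_card_lt (not_le.1 h)] at hk
    exact lt_irrefl _ hk
  set P : ℝ[X] := ∏ i ∈ S, (X + C (l i)) with hP
  have hPs : P.Splits := Polynomial.Splits.prod fun i _ => Polynomial.Splits.X_add_C _
  set Q : ℝ[X] := derivative^[S.card - k] P with hQ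
  have hQs : Q.Splits := hPs.iterate_derivative_real _
  have hPd : P.natDegree = S.card := by
    rw [hP, natDegree_prod_of_monic _ _ fun i _ => monic_X_add_C _]; simp
  have hcoeff : ∀ t ≤ k, Q.coeff t =
      ((t + (S.card - k)).descFactorial (S.card - k) : ℝ) * esymmOn S (k - t) l := by
    intro t ht
    rw [hQ, coeff_iterate_derivative, hP, Finset.prod_X_add_C_coeff _ _ (by omega), nsmul_eq_mul,
      esymmOn]
    have e : S.card - (t + (S.card - k)) = k - t := by omega
    rw [e]
  have hdf : ∀ t, (0 : ℝ) < ((t + (S.card - k)).descFactorial (S.card - k) : ℝ) := by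
    intro t
    exact_mod_cast Nat.descFactorial_pos.2 (Nat.le_add_left _ _)
  have hlarge : ∀ t, k < t → Q.coeff t = 0 := by
    intro t ht
    rw [hQ, coeff_iterate_derivative, coeff_eq_zero_of_natDegree_lt (by omega), smul_zero]
  have hQ0 : 0 < Q.coeff 0 := by
    rw [hcoeff 0 (Nat.zero_le _)]; exact mul_pos (hdf 0) (by simpa using hk)
  have hQnn : ∀ t, 0 ≤ Q.coeff t := by
    intro t
    rcases lt_or_ge k t with h | h
    · rw [hlarge t h]
    · rcases Nat.eq_zero_or_pos t with rfl | ht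
      · exact hQ0.le
      · rw [hcoeff t h]; exact mul_nonneg (hdf t).le (h0 _ (by omega))
  have hroots : ∀ r ∈ Q.roots, r < 0 := by
    intro r hr
    by_contra hr0
    rw [not_lt] at hr0
    have h1 : Q.eval r = 0 := (mem_roots'.1 hr).2
    rw [eval_eq_sum_range] at h1
    have h2 : Q.coeff 0 * r ^ 0 ≤ ∑ i ∈ range (Q.natDegree + 1), Q.coeff i * r ^ i :=
      Finset.single_le_sum (f := fun i => Q.coeff i * r ^ i)
        (fun i _ => mul_nonneg (hQnn i) (pow_nonneg hr0 i)) (by simp)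
    rw [h1, pow_zero, mul_one] at h2
    linarith
  have hQk : 0 < Q.coeff k := by
    rw [hcoeff k le_rfl]; exact mul_pos (hdf k) (by simp)
  have hQd : Q.natDegree = k := by
    apply le_antisymm
    · exact natDegree_le_iff_coeff_eq_zero.2 hlarge
    · exact le_natDegree_of_ne_zero hQk.ne'
  have hcard : Q.roots.card = k := by rw [← hQd, ← splits_iff_card_roots]; exact hQs
  have hpos : ∀ t ≤ k, 0 < Q.coeff t := by
    intro t ht
    rw [hQs.eq_prod_roots, coeff_C_mul]
    refine mul_pos ?_ ((Multiset.coeff_prod_X_sub_C_pos _ hroots).2 t (by omega))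
    rw [leadingCoeff, hQd]; exact hQk
  intro j hj
  have h := hpos (k - j) (Nat.sub_le _ _)
  rw [hcoeff _ (Nat.sub_le _ _), Nat.sub_sub_self hj] at h
  exact pos_of_mul_pos_right h (hdf _).le

end RealRooted

section GardingCone

variable {n : ℕ}

theorem sigmaK_eq_esymmOn (k : ℕ) (l : Fin n → ℝ) : sigmaK k l = esymmOn Finset.univ k l := rfl

/-- On `Γ_k` the functions `σ_j`, `j ≤ k`, and their partial derivatives `σ_{j;i}`, `j < k`, are
positive: the set where this holds is relatively clopen in `{σ_k > 0}`. -/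
theorem esymmOn_pos_of_mem_GammaCone {k : ℕ} (hkn : k ≤ n) {l : Fin n → ℝ}
    (hl : l ∈ GammaCone n k) :
    (∀ j ≤ k, 0 < esymmOn Finset.univ j l) ∧
      ∀ j < k, ∀ i, 0 < esymmOn (Finset.univ.erase i) j l := by
  classical
  -- `U` is the open condition and `W` its closed counterpart; they coincide in `{σ_k > 0}`.
  set U : Set (Fin n → ℝ) := {l | (∀ j ∈ Finset.range (k + 1), 0 < esymmOn Finset.univ j l) ∧
    ∀ j ∈ Finset.range k, ∀ i ∈ (Finset.univ : Finset (Fin n)),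
      0 < esymmOn (Finset.univ.erase i) j l} with hU
  set W : Set (Fin n → ℝ) := {l | (∀ j ≤ k, 0 ≤ esymmOn Finset.univ j l) ∧
    ∀ j < k, ∀ i, 0 ≤ esymmOn (Finset.univ.erase i) j l} with hW
  have hUo : IsOpen U := by
    have e : U = (⋂ j ∈ Finset.range (k + 1), {l | 0 < esymmOn Finset.univ j l}) ∩
        ⋂ j ∈ Finset.range k, ⋂ i ∈ (Finset.univ : Finset (Fin n)),
          {l | 0 < esymmOn (Finset.univ.erase i) j l} := by
      ext l; simp [hU]
    rw [e]
    refine IsOpen.inter (isOpen_biInter_finset fun j _ => ?_)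
      (isOpen_biInter_finset fun j _ => isOpen_biInter_finset fun i _ => ?_)
    · exact isOpen_lt continuous_const (continuous_esymmOn _ _)
    · exact isOpen_lt continuous_const (continuous_esymmOn _ _)
  have hWc : IsClosed W := by
    have e : W = (⋂ j, ⋂ (_ : j ≤ k), {l | 0 ≤ esymmOn Finset.univ j l}) ∩
        ⋂ j, ⋂ (_ : j < k), ⋂ i, {l : Fin n → ℝ | 0 ≤ esymmOn (Finset.univ.erase i) j l} := by
      ext l; simp [hW]
    rw [e]
    refine IsClosed.inter (isClosed_iInter fun j => isClosed_iInter fun _ => ?_)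
      (isClosed_iInter fun j => isClosed_iInter fun _ => isClosed_iInter fun i => ?_)
    · exact isClosed_le continuous_const (continuous_esymmOn _ _)
    · exact isClosed_le continuous_const (continuous_esymmOn _ _)
  have hUW : U ⊆ W := fun l hl =>
    ⟨fun j hj => (hl.1 j (Finset.mem_range.2 (by omega))).le,
      fun j hj i => (hl.2 j (Finset.mem_range.2 hj) i (Finset.mem_univ i)).le⟩
  have hWU : W ∩ {l | 0 < sigmaK k l} ⊆ U := by
    rintro l ⟨⟨h1, h2⟩, h3⟩
    refine ⟨fun j hj => esymmOn_pos_of_nonneg (fun j hj => h1 j hj.le) h3 j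
      (by have := Finset.mem_range.1 hj; omega), fun j hj i _ => ?_⟩
    rw [Finset.mem_range] at hj
    obtain ⟨m, rfl⟩ : ∃ m, k = m + 1 := ⟨k - 1, by omega⟩
    -- If `σ_{m;i}` vanished, then `σ_{m+1;i} = σ_{m+1} > 0` would force it to be positive.
    have hpos : 0 < esymmOn (Finset.univ.erase i) m l := by
      refine (h2 m (by omega) i).lt_of_ne' fun h0 => ?_
      have h4 := esymmOn_succ_eq (Finset.mem_univ i) m l
      rw [h0, mul_zero, add_zero] at h4
      have h5 : 0 < esymmOn (Finset.univ.erase i) (m + 1) l := by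
        rw [← h4]; exact h3
      have := esymmOn_pos_of_nonneg (fun j hj => h2 j hj i) h5 m (by omega)
      exact this.ne' h0
    exact esymmOn_pos_of_nonneg (fun j hj => h2 j (by omega) i) hpos j (by omega)
  have hone : (fun _ => 1 : Fin n → ℝ) ∈ {l : Fin n → ℝ | 0 < sigmaK k l} := by
    show 0 < esymmOn Finset.univ k _
    exact esymmOn_pos (by simpa using hkn) fun i _ => one_pos
  have hsub : GammaCone n k ⊆ U := by
    refine isPreconnected_connectedComponentIn.subset_of_closure_inter_subset hUo
      ⟨fun _ => 1, mem_connectedComponentIn hone, ?_⟩ ?_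
    · refine ⟨fun j hj => esymmOn_pos ?_ fun i _ => one_pos,
        fun j hj i _ => esymmOn_pos ?_ fun i _ => one_pos⟩
      · simp at hj ⊢; omega
      · simp at hj ⊢; omega
    · rintro l ⟨hl1, hl2⟩
      exact hWU ⟨closure_minimal hUW hWc hl1, connectedComponentIn_subset _ _ hl2⟩
  have h := hsub hl
  exact ⟨fun j hj => h.1 j (Finset.mem_range.2 (by omega)),
    fun j hj i => h.2 j (Finset.mem_range.2 hj) i (Finset.mem_univ i)⟩

theorem esymmOn_nonneg_of_mem_closure_GammaCone {k : ℕ} (hkn : k ≤ n) {l : Fin n → ℝ}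
    (hl : l ∈ closure (GammaCone n k)) :
    (∀ j ≤ k, 0 ≤ esymmOn Finset.univ j l) ∧
      ∀ j < k, ∀ i, 0 ≤ esymmOn (Finset.univ.erase i) j l := by
  refine ⟨fun j hj => ?_, fun j hj i => ?_⟩
  · exact closure_minimal (fun x hx => ((esymmOn_pos_of_mem_GammaCone hkn hx).1 j hj).le)
      (isClosed_le continuous_const (continuous_esymmOn _ _)) hl
  · exact closure_minimal (fun x hx => ((esymmOn_pos_of_mem_GammaCone hkn hx).2 j hj i).le)
      (isClosed_le continuous_const (continuous_esymmOn _ _)) hl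

end GardingCone

end

/-! ### Newton tensors -/

section

open Matrix

/-- The Newton tensors `T_j(A) = ∑_i (-1)^i σ_{j-i}(A) A^i`, by the Faddeev–LeVerrier recursion
`T_{j+1} = σ_{j+1} I - T_j A`, `(j + 1) σ_{j+1} = tr (T_j A)`. -/
noncomputable def newtonTensor {n : ℕ} (A : Matrix (Fin n) (Fin n) ℝ) :
    ℕ → Matrix (Fin n) (Fin n) ℝ
  | 0 => 1
  | j + 1 => (trace (newtonTensor A j * A) / (j + 1)) • (1 : Matrix (Fin n) (Fin n) ℝ)
      - newtonTensor A j * A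

/-- The elementary symmetric function `σ_j` of the eigenvalues of `A`, as a polynomial in the
entries: `σ_{j+1}(A) = tr (T_j(A) A) / (j + 1)`. -/
noncomputable def matrixSigma {n : ℕ} (A : Matrix (Fin n) (Fin n) ℝ) : ℕ → ℝ
  | 0 => 1
  | j + 1 => trace (newtonTensor A j * A) / (j + 1)

section NewtonTensor

variable {n : ℕ} (A B : Matrix (Fin n) (Fin n) ℝ)

@[simp] theorem newtonTensor_zero : newtonTensor A 0 = 1 := rfl

@[simp] theorem matrixSigma_zero : matrixSigma A 0 = 1 := rfl

theorem newtonTensor_succ (j : ℕ) :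
    newtonTensor A (j + 1) = matrixSigma A (j + 1) • 1 - newtonTensor A j * A := rfl

theorem trace_newtonTensor_mul (j : ℕ) :
    trace (newtonTensor A j * A) = (j + 1) * matrixSigma A (j + 1) := by
  have : (j : ℝ) + 1 ≠ 0 := by positivity
  rw [matrixSigma]; field_simp

theorem commute_newtonTensor (j : ℕ) : Commute A (newtonTensor A j) := by
  induction j with
  | zero => exact Commute.one_right A
  | succ j ih =>
    rw [newtonTensor_succ]
    exact ((Commute.one_right A).smul_right _).sub_right (ih.mul_right (Commute.refl A))

theorem trace_newtonTensor (j : ℕ) :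
    trace (newtonTensor A j) = (n - j) * matrixSigma A j := by
  cases j with
  | zero => simp
  | succ j =>
    rw [newtonTensor_succ, trace_sub, trace_smul, trace_one, trace_newtonTensor_mul]
    simp; ring

theorem isSymm_newtonTensor {A : Matrix (Fin n) (Fin n) ℝ} (hA : A.IsSymm) (j : ℕ) :
    (newtonTensor A j).IsSymm := by
  induction j with
  | zero => exact isSymm_one
  | succ j ih =>
    rw [IsSymm, newtonTensor_succ, transpose_sub, transpose_smul, transpose_one, transpose_mul,
      ih.eq, hA.eq, (commute_newtonTensor A j).eq]

theorem continuous_newtonTensor (j : ℕ) :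
    Continuous fun A : Matrix (Fin n) (Fin n) ℝ => newtonTensor A j := by
  induction j with
  | zero => exact continuous_const
  | succ j ih =>
    simp only [newtonTensor]
    have h : Continuous fun A : Matrix (Fin n) (Fin n) ℝ => newtonTensor A j * A :=
      ih.matrix_mul continuous_id
    exact ((h.matrix_trace.div_const _).smul continuous_const).sub h

theorem continuous_matrixSigma (j : ℕ) :
    Continuous fun A : Matrix (Fin n) (Fin n) ℝ => matrixSigma A j := by
  cases j with
  | zero => exact continuous_const
  | succ j =>
    exact ((continuous_newtonTensor j).matrix_mul continuous_id).matrix_trace.div_const _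

/-- Newton tensors are equivariant, and their traces invariant, under conjugation. -/
theorem newtonTensor_conj {U V : Matrix (Fin n) (Fin n) ℝ} (hVU : V * U = 1) (hUV : U * V = 1)
    (j : ℕ) : newtonTensor (U * A * V) j = U * newtonTensor A j * V ∧
      matrixSigma (U * A * V) j = matrixSigma A j := by
  have key : ∀ M : Matrix (Fin n) (Fin n) ℝ, U * M * V * (U * A * V) = U * (M * A) * V := by
    intro M
    calc U * M * V * (U * A * V) = U * M * (V * U) * A * V := by noncomm_ring
      _ = _ := by rw [hVU]; noncomm_ring
  have tr : ∀ M : Matrix (Fin n) (Fin n) ℝ, trace (U * M * V) = trace M := by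
    intro M
    rw [trace_mul_comm, ← Matrix.mul_assoc, hVU, Matrix.one_mul]
  have main : ∀ j, newtonTensor (U * A * V) j = U * newtonTensor A j * V := by
    intro j
    induction j with
    | zero => simp [hUV]
    | succ j ih =>
      simp only [newtonTensor]
      rw [ih, key, tr, Matrix.mul_sub, Matrix.sub_mul, Matrix.mul_smul, Matrix.smul_mul,
        Matrix.mul_one, hUV]
  refine ⟨main j, ?_⟩
  cases j with
  | zero => rfl
  | succ j => rw [matrixSigma, main, key, tr, matrixSigma]

theorem newtonTensor_diagonal (l : Fin n → ℝ) (j : ℕ) :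
    newtonTensor (diagonal l) j =
      diagonal (fun i => esymmOn (Finset.univ.erase i) j l) ∧
    matrixSigma (diagonal l) j = esymmOn Finset.univ j l := by
  have step : ∀ j, newtonTensor (diagonal l) j =
      diagonal (fun i => esymmOn (Finset.univ.erase i) j l) →
      matrixSigma (diagonal l) (j + 1) = esymmOn Finset.univ (j + 1) l := by
    intro j hj
    have h := sum_mul_esymmOn_erase Finset.univ j l
    have : (j : ℝ) + 1 ≠ 0 := by positivity
    rw [matrixSigma, hj, diagonal_mul_diagonal, trace_diagonal, div_eq_iff this, mul_comm,
      ← h]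
    exact Finset.sum_congr rfl fun i _ => mul_comm _ _
  have main : ∀ j, newtonTensor (diagonal l) j =
      diagonal (fun i => esymmOn (Finset.univ.erase i) j l) := by
    intro j
    induction j with
    | zero => simp
    | succ j ih =>
      rw [newtonTensor_succ, step j ih, ih, diagonal_mul_diagonal, smul_one_eq_diagonal,
        diagonal_sub]
      congr 1
      ext i
      rw [esymmOn_succ_eq (Finset.mem_univ i) j l]
      ring
  refine ⟨main j, ?_⟩
  cases j with
  | zero => simp
  | succ j => exact step j (main j)

/-- Diagonalization turns `σ_j` and `T_j` into elementary symmetric functions of the eigenvalues and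
their partial derivatives. -/
theorem matrixSigma_eq_esymmOn_eigenvalues {A : Matrix (Fin n) (Fin n) ℝ} (hA : A.IsHermitian)
    (j : ℕ) : matrixSigma A j = esymmOn Finset.univ j (eigenvalueVector A) ∧
      ((∀ i, 0 ≤ esymmOn (Finset.univ.erase i) j (eigenvalueVector A)) →
        (newtonTensor A j).PosSemidef) := by
  rw [eigenvalueVector, dif_pos hA]
  set U : Matrix (Fin n) (Fin n) ℝ := hA.eigenvectorUnitary.1
  have hUU : star U * U = 1 := Unitary.coe_star_mul_self hA.eigenvectorUnitary
  have hUU' : U * star U = 1 := Unitary.coe_mul_star_self hA.eigenvectorUnitary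
  have hspec : A = U * diagonal hA.eigenvalues * star U := by
    conv_lhs => rw [hA.spectral_theorem]
    rw [Unitary.conjStarAlgAut_apply]
    rfl
  have h := newtonTensor_conj (diagonal hA.eigenvalues) hUU hUU' j
  rw [← hspec] at h
  refine ⟨h.2.trans (newtonTensor_diagonal _ j).2, fun hpos => ?_⟩
  rw [h.1, (newtonTensor_diagonal _ j).1, star_eq_conjTranspose]
  exact (PosSemidef.diagonal (fun i => hpos i)).mul_mul_conjTranspose_same U

open scoped MatrixOrder Matrix.Norms.L2Operator in
/-- The Cauchy–Schwarz inequality for a nonnegative form, with the trace as the bound. -/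
theorem Matrix.PosSemidef.abs_dotProduct_mulVec_le {T : Matrix (Fin n) (Fin n) ℝ}
    (hT : T.PosSemidef) (a b : Fin n → ℝ) :
    |a ⬝ᵥ T *ᵥ b| ≤ trace T * (√(a ⬝ᵥ a) * √(b ⬝ᵥ b)) := by
  obtain ⟨S, hS⟩ := CStarAlgebra.nonneg_iff_eq_star_mul_self.mp hT.nonneg
  rw [star_eq_conjTranspose] at hS
  subst hS
  have h1 : a ⬝ᵥ (Sᴴ * S) *ᵥ b = (S *ᵥ a) ⬝ᵥ (S *ᵥ b) := by
    rw [← mulVec_mulVec, dotProduct_mulVec, conjTranspose_eq_transpose_of_trivial,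
      vecMul_transpose]
  have h2 : ∀ c : Fin n → ℝ, (S *ᵥ c) ⬝ᵥ (S *ᵥ c) ≤ trace (Sᴴ * S) * (c ⬝ᵥ c) := by
    intro c
    have e : trace (Sᴴ * S) = ∑ i, ∑ j, S i j ^ 2 := by
      rw [Finset.sum_comm]
      simp [trace, mul_apply, sq]
    rw [e, Finset.sum_mul]
    refine Finset.sum_le_sum fun i _ => ?_
    have := Finset.sum_mul_sq_le_sq_mul_sq Finset.univ (S i) c
    simpa [mulVec, dotProduct, sq] using this
  have h3 : ∀ a b : Fin n → ℝ, |a ⬝ᵥ b| ≤ √(a ⬝ᵥ a) * √(b ⬝ᵥ b) := by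
    intro a b
    have ha : 0 ≤ a ⬝ᵥ a := Finset.sum_nonneg fun i _ => mul_self_nonneg (a i)
    rw [← Real.sqrt_mul ha]
    apply Real.abs_le_sqrt
    have := Finset.sum_mul_sq_le_sq_mul_sq Finset.univ a b
    simpa [dotProduct, sq] using this
  have h0 : 0 ≤ trace (Sᴴ * S) := hT.trace_nonneg
  rw [h1]
  calc |(S *ᵥ a) ⬝ᵥ (S *ᵥ b)| ≤ _ := h3 _ _
    _ ≤ √(trace (Sᴴ * S) * (a ⬝ᵥ a)) * √(trace (Sᴴ * S) * (b ⬝ᵥ b)) := by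
      gcongr <;> exact h2 _
    _ = trace (Sᴴ * S) * (√(a ⬝ᵥ a) * √(b ⬝ᵥ b)) := by
      rw [Real.sqrt_mul h0, Real.sqrt_mul h0, mul_mul_mul_comm, Real.mul_self_sqrt h0]

/-- The derivative at `A` in the direction `B` of the Newton tensor. -/
noncomputable def newtonTensorDeriv : ℕ → Matrix (Fin n) (Fin n) ℝ
  | 0 => 0
  | j + 1 => (trace (newtonTensorDeriv j * A + newtonTensor A j * B) / (j + 1)) • 1
      - (newtonTensorDeriv j * A + newtonTensor A j * B)

/-- The matrices representing the linear forms `B ↦ tr (T_j'(B) A^m)`. They are carried along for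
all `m` because the derivative of the recursion for `T_j` involves the next power of `A`. -/
noncomputable def newtonDual : ℕ → ℕ → Matrix (Fin n) (Fin n) ℝ
  | 0, _ => 0
  | j + 1, m => trace (A ^ m) • newtonTensor A j - A ^ m * newtonTensor A j - newtonDual j (m + 1)

theorem newtonDual_succ_add (j m : ℕ) :
    newtonDual A (j + 1) m + A * newtonDual A j m =
      trace (A ^ m * newtonTensor A j) • 1 - A ^ m * newtonTensor A j := by
  induction j generalizing m with
  | zero => simp [newtonDual]
  | succ j ih =>
    have h1 := ih (m + 1)
    have hT : newtonTensor A (j + 1) = matrixSigma A (j + 1) • 1 - A * newtonTensor A j := by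
      rw [newtonTensor_succ, (commute_newtonTensor A j).eq]
    have htr : trace (A ^ m * newtonTensor A (j + 1)) =
        matrixSigma A (j + 1) * trace (A ^ m) - trace (A ^ (m + 1) * newtonTensor A j) := by
      rw [hT, Matrix.mul_sub, trace_sub, Matrix.mul_smul, trace_smul, Matrix.mul_one, pow_succ,
        Matrix.mul_assoc, smul_eq_mul]
    have h2 : newtonDual A (j + 1 + 1) m =
      trace (A ^ m) • newtonTensor A (j + 1) - A ^ m * newtonTensor A (j + 1)
        - newtonDual A (j + 1) (m + 1) := rfl
    have h3 : newtonDual A (j + 1) m =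
      trace (A ^ m) • newtonTensor A j - A ^ m * newtonTensor A j - newtonDual A j (m + 1) := rfl
    have h4 : newtonDual A (j + 1) (m + 1) =
        trace (A ^ (m + 1) * newtonTensor A j) • 1 - A ^ (m + 1) * newtonTensor A j
          - A * newtonDual A j (m + 1) := by rw [← h1]; abel
    rw [htr, h2, h4, h3, Matrix.mul_sub, Matrix.mul_sub, Matrix.mul_smul, ← Matrix.mul_assoc A,
      ← pow_succ' A m]
    have h5 : trace (A ^ m) • newtonTensor A (j + 1) =
        (trace (A ^ m) * matrixSigma A (j + 1)) • (1 : Matrix (Fin n) (Fin n) ℝ)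
          - trace (A ^ m) • (A * newtonTensor A j) := by
      rw [hT, smul_sub, smul_smul]
    rw [h5, sub_smul, mul_comm (trace (A ^ m))]
    abel

/-- For `m = 1` the representing matrix is a multiple of `T_j`. -/
theorem newtonDual_one (j : ℕ) : newtonDual A j 1 = (j : ℝ) • newtonTensor A j := by
  induction j with
  | zero => simp [newtonDual]
  | succ j ih =>
    have h := newtonDual_succ_add A j 1
    have hc := (commute_newtonTensor A j).eq
    rw [ih, pow_one, hc, trace_newtonTensor_mul, Matrix.mul_smul, hc] at h
    rw [eq_sub_of_add_eq h, newtonTensor_succ, smul_sub, smul_smul]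
    push_cast
    rw [add_smul (j : ℝ) 1 (newtonTensor A j * A), one_smul]
    abel

theorem trace_newtonTensorDeriv_mul_pow (j m : ℕ) :
    trace (newtonTensorDeriv A B j * A ^ m) = trace (newtonDual A j m * B) := by
  induction j generalizing m with
  | zero => simp [newtonTensorDeriv, newtonDual]
  | succ j ih =>
    have h1 := ih 1
    rw [newtonDual_one, pow_one, Matrix.smul_mul, trace_smul, smul_eq_mul] at h1
    have h0 : (j : ℝ) + 1 ≠ 0 := by positivity
    have h2 : trace (newtonTensorDeriv A B j * A + newtonTensor A j * B) / (j + 1) =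
        trace (newtonTensor A j * B) := by
      rw [trace_add, h1]; field_simp
    have h3 : trace (newtonTensor A j * B * A ^ m) = trace (A ^ m * newtonTensor A j * B) := by
      rw [trace_mul_comm, Matrix.mul_assoc]
    rw [newtonTensorDeriv, h2, newtonDual, Matrix.sub_mul, Matrix.add_mul, trace_sub, trace_add,
      Matrix.sub_mul, Matrix.sub_mul, trace_sub, trace_sub, Matrix.mul_assoc _ A, ← pow_succ',
      ih (m + 1), h3, Matrix.smul_mul, trace_smul, Matrix.smul_mul, trace_smul, Matrix.one_mul]
    simp only [smul_eq_mul]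
    ring

/-- `d σ_{j+1} = tr (T_j dA)`. -/
theorem trace_newtonTensorDeriv_add (j : ℕ) :
    trace (newtonTensorDeriv A B j * A + newtonTensor A j * B) / (j + 1) =
      trace (newtonTensor A j * B) := by
  have h1 := trace_newtonTensorDeriv_mul_pow A B j 1
  rw [newtonDual_one, pow_one, Matrix.smul_mul, trace_smul, smul_eq_mul] at h1
  have h0 : (j : ℝ) + 1 ≠ 0 := by positivity
  rw [trace_add, h1]; field_simp

end NewtonTensor

end

/-! ### The Schouten tensor and the divergence of its Newton tensors -/

section

open Matrix MeasureTheory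

/-- The gradient of `w` at `x`, as a vector of partial derivatives. -/
noncomputable def gradVec {n : ℕ} (w : EuclideanSpace ℝ (Fin n) → ℝ)
    (x : EuclideanSpace ℝ (Fin n)) : Fin n → ℝ := fun i => partialD w x i

/-- The matrix of second partial derivatives of `w` at `x`. -/
noncomputable def hessMat {n : ℕ} (w : EuclideanSpace ℝ (Fin n) → ℝ)
    (x : EuclideanSpace ℝ (Fin n)) : Matrix (Fin n) (Fin n) ℝ := of fun i j => hessD w x i j

/-- The matrix `t H - ½ |g|² I`. With `t = w`, `g = ∇w` and `H = ∇²w` it is the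
`(1,1)`-Schouten tensor of the conformally flat metric `w⁻² |dx|²`. -/
noncomputable def conformalMat {n : ℕ} (t : ℝ) (g : Fin n → ℝ) (H : Matrix (Fin n) (Fin n) ℝ) :
    Matrix (Fin n) (Fin n) ℝ := t • H - (1 / 2 * (g ⬝ᵥ g)) • (1 : Matrix (Fin n) (Fin n) ℝ)

/-- The `(1,1)`-Schouten tensor `w ∇²w - ½ |∇w|² I` of the metric `w⁻² |dx|²`. -/
noncomputable def schouten {n : ℕ} (w : EuclideanSpace ℝ (Fin n) → ℝ)
    (x : EuclideanSpace ℝ (Fin n)) : Matrix (Fin n) (Fin n) ℝ :=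
  conformalMat (w x) (gradVec w x) (hessMat w x)

section DivergenceAlgebra

variable {n : ℕ}

theorem isSymm_conformalMat {t : ℝ} {g : Fin n → ℝ} {H : Matrix (Fin n) (Fin n) ℝ}
    (hH : H.IsSymm) : (conformalMat t g H).IsSymm := by
  rw [IsSymm, conformalMat, transpose_sub, transpose_smul, transpose_smul, transpose_one, hH.eq]

/-- The divergence of the Newton tensors of the Schouten tensor. The matrix
`g i • H + t • D i - (H g)_i • 1` is the derivative of `t H - ½ |g|² I` in the direction `i` when
`g`, `H` and `D` are the first, second and third derivatives of `t`. It differs from a symmetric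
3-tensor only by lower-order terms, and these produce the right-hand side. -/
theorem sum_newtonTensorDeriv (t : ℝ) (g : Fin n → ℝ) (H : Matrix (Fin n) (Fin n) ℝ)
    (hH : H.IsSymm) (D : Fin n → Matrix (Fin n) (Fin n) ℝ) (hD : ∀ i a b, D i a b = D a i b)
    (hD' : ∀ i, (D i).IsSymm) (j : ℕ) (l : Fin n) :
    t * ∑ i, newtonTensorDeriv (conformalMat t g H)
        (g i • H + t • D i - ((H *ᵥ g) i) • (1 : Matrix (Fin n) (Fin n) ℝ)) j i l =
      n * (newtonTensor (conformalMat t g H) j *ᵥ g) l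
        - (n - j) * matrixSigma (conformalMat t g H) j * g l := by
  set A := conformalMat t g H with hA
  set B : Fin n → Matrix (Fin n) (Fin n) ℝ :=
    fun i => g i • H + t • D i - ((H *ᵥ g) i) • (1 : Matrix (Fin n) (Fin n) ℝ) with hB
  have hAs : A.IsSymm := isSymm_conformalMat hH
  have hAg : ∀ i, t * (H *ᵥ g) i = (A *ᵥ g) i + 1 / 2 * (g ⬝ᵥ g) * g i := by
    intro i
    rw [hA, conformalMat, sub_mulVec, smul_mulVec, smul_mulVec, one_mulVec]
    simp
  have hAe : ∀ a b, t * H a b = A a b + 1 / 2 * (g ⬝ᵥ g) * (1 : Matrix (Fin n) (Fin n) ℝ) a b := by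
    intro a b
    simp [hA, conformalMat]
  change t * ∑ i, newtonTensorDeriv A (B i) j i l = _
  induction j generalizing l with
  | zero => simp [newtonTensorDeriv]
  | succ j ih =>
    set T := newtonTensor A j with hT
    have hTs : T.IsSymm := isSymm_newtonTensor hAs j
    have hTA : A * T = T * A := (commute_newtonTensor A j).eq
    have e1 : ∀ i, newtonTensorDeriv A (B i) (j + 1) i l =
        trace (T * B i) * (1 : Matrix (Fin n) (Fin n) ℝ) i l
          - (newtonTensorDeriv A (B i) j * A) i l - (T * B i) i l := by
      intro i
      rw [newtonTensorDeriv, trace_newtonTensorDeriv_add]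
      simp only [Matrix.sub_apply, Matrix.add_apply, Matrix.smul_apply, smul_eq_mul]
      ring
    have e2 : ∑ i, trace (T * B i) * (1 : Matrix (Fin n) (Fin n) ℝ) i l =
        ∑ i, ∑ m, T i m * B l m i := by
      simp [one_apply, trace, mul_apply]
    have e3 : ∑ i, (newtonTensorDeriv A (B i) j * A) i l =
        ∑ m, (∑ i, newtonTensorDeriv A (B i) j i m) * A m l := by
      simp only [mul_apply, Finset.sum_mul]
      exact Finset.sum_comm
    have e4 : ∑ i, (T * B i) i l = ∑ i, ∑ m, T i m * B i m l := by
      simp [mul_apply]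
    have e5 : t * ∑ m, (∑ i, newtonTensorDeriv A (B i) j i m) * A m l =
        n * (A *ᵥ (T *ᵥ g)) l - (n - j) * matrixSigma A j * (A *ᵥ g) l := by
      rw [Finset.mul_sum]
      simp only [← mul_assoc, ih]
      generalize (n - j : ℝ) * matrixSigma A j = c
      simp only [mulVec, dotProduct, sub_mul, Finset.sum_sub_distrib, Finset.mul_sum,
        Finset.sum_mul]
      congr 1
      · refine Finset.sum_congr rfl fun m _ => Finset.sum_congr rfl fun i _ => ?_
        rw [hAs.apply l m]; ring
      · refine Finset.sum_congr rfl fun m _ => ?_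
        rw [hAs.apply l m]; ring
    have e6 : ∀ i m, t * (B l m i - B i m l) = g l * A m i
        - (A *ᵥ g) l * (1 : Matrix (Fin n) (Fin n) ℝ) m i
        - g i * A m l + (A *ᵥ g) i * (1 : Matrix (Fin n) (Fin n) ℝ) m l := by
      intro i m
      have hd : D l m i = D i m l := by
        rw [hD l m i, (hD' m).apply i l, hD m i l]
      simp only [hB, Matrix.sub_apply, Matrix.add_apply, Matrix.smul_apply, smul_eq_mul, hd]
      linear_combination g l * hAe m i - g i * hAe m l
        - (1 : Matrix (Fin n) (Fin n) ℝ) m i * hAg l + (1 : Matrix (Fin n) (Fin n) ℝ) m l * hAg i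
    have e7 : t * (∑ i, ∑ m, T i m * B l m i - ∑ i, ∑ m, T i m * B i m l) =
        g l * trace (T * A) - (A *ᵥ g) l * trace T := by
      have f1 : ∑ i, ∑ m, T i m * (g i * A m l) = (A *ᵥ (T *ᵥ g)) l := by
        rw [Finset.sum_comm]
        simp only [mulVec, dotProduct, Finset.mul_sum]
        refine Finset.sum_congr rfl fun m _ => Finset.sum_congr rfl fun i _ => ?_
        rw [hAs.apply l m, hTs.apply m i]; ring
      have f2 : ∑ i, ∑ m, T i m * ((A *ᵥ g) i * (1 : Matrix (Fin n) (Fin n) ℝ) m l) =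
          (T *ᵥ (A *ᵥ g)) l := by
        simp only [one_apply, mul_ite, mul_one, mul_zero, Finset.sum_ite_eq', Finset.mem_univ,
          if_true]
        conv_rhs => rw [mulVec, dotProduct]
        refine Finset.sum_congr rfl fun i _ => ?_
        rw [hTs.apply l i]
      have f3 : ∑ i, ∑ m, T i m * (g l * A m i) = g l * trace (T * A) := by
        simp only [trace, diag, mul_apply, Finset.mul_sum]
        refine Finset.sum_congr rfl fun m _ => Finset.sum_congr rfl fun i _ => ?_
        ring
      have f4 : ∑ i, ∑ m, T i m * ((A *ᵥ g) l * (1 : Matrix (Fin n) (Fin n) ℝ) m i) =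
          (A *ᵥ g) l * trace T := by
        simp only [one_apply, mul_ite, mul_one, mul_zero, Finset.sum_ite_eq', Finset.mem_univ,
          if_true, trace, diag, Finset.mul_sum]
        exact Finset.sum_congr rfl fun i _ => mul_comm _ _
      have f5 : A *ᵥ (T *ᵥ g) = T *ᵥ (A *ᵥ g) := by
        rw [mulVec_mulVec, mulVec_mulVec, hTA]
      have f6 : t * (∑ i, ∑ m, T i m * B l m i - ∑ i, ∑ m, T i m * B i m l) =
          ∑ i, ∑ m, (T i m * (g l * A m i)
            - T i m * ((A *ᵥ g) l * (1 : Matrix (Fin n) (Fin n) ℝ) m i)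
            - T i m * (g i * A m l)
            + T i m * ((A *ᵥ g) i * (1 : Matrix (Fin n) (Fin n) ℝ) m l)) := by
        simp only [← Finset.sum_sub_distrib, Finset.mul_sum]
        refine Finset.sum_congr rfl fun i _ => Finset.sum_congr rfl fun m _ => ?_
        linear_combination T i m * e6 i m
      rw [f6]
      simp only [Finset.sum_add_distrib, Finset.sum_sub_distrib]
      rw [f1, f2, f3, f4, f5]
      ring
    have e8 : (newtonTensor A (j + 1) *ᵥ g) l =
        matrixSigma A (j + 1) * g l - (A *ᵥ (T *ᵥ g)) l := by
      rw [newtonTensor_succ, sub_mulVec, smul_mulVec, one_mulVec, mulVec_mulVec, hTA]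
      simp [hT]
    have hs : trace (T * A) = (j + 1) * matrixSigma A (j + 1) := trace_newtonTensor_mul A j
    have hs' : trace T = (n - j) * matrixSigma A j := trace_newtonTensor A j
    rw [Finset.sum_congr rfl fun i _ => e1 i, Finset.sum_sub_distrib, Finset.sum_sub_distrib, e2,
      e3, e4]
    have : t * (∑ i, ∑ m, T i m * B l m i - ∑ m, (∑ i, newtonTensorDeriv A (B i) j i m) * A m l
        - ∑ i, ∑ m, T i m * B i m l) =
        t * (∑ i, ∑ m, T i m * B l m i - ∑ i, ∑ m, T i m * B i m l)
          - t * ∑ m, (∑ i, newtonTensorDeriv A (B i) j i m) * A m l := by ring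
    rw [this, e5, e7, e8, hs, hs']
    push_cast
    ring

end DivergenceAlgebra

end

/-! ### The weak divergence identity for functions of class `C³` -/

section

open Matrix MeasureTheory

section PartialDerivatives

variable {n : ℕ} {w : EuclideanSpace ℝ (Fin n) → ℝ}

theorem contDiff_partialD {m m' : WithTop ℕ∞} (hw : ContDiff ℝ m' w) (hm : m + 1 ≤ m') (i : Fin n) :
    ContDiff ℝ m fun y => partialD w y i :=
  (hw.fderiv_right hm).clm_apply contDiff_const

theorem partialD_partialD (hw : ContDiff ℝ 2 w) (x : EuclideanSpace ℝ (Fin n)) (i j : Fin n) :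
    partialD (fun y => partialD w y j) x i = hessD w x i j := by
  have hd : DifferentiableAt ℝ (fderiv ℝ w) x :=
    (hw.fderiv_right (m := 1) (by norm_num)).differentiable (by norm_num) x
  unfold partialD hessD
  rw [fderiv_clm_apply hd (by fun_prop)]
  simp

theorem hessD_comm (hw : ContDiff ℝ 2 w) (x : EuclideanSpace ℝ (Fin n)) (i j : Fin n) :
    hessD w x i j = hessD w x j i :=
  (hw.contDiffAt (x := x)).isSymmSndFDerivAt (by simp) _ _

theorem contDiff_hessD {m m' : WithTop ℕ∞} (hw : ContDiff ℝ m' w) (hm : m + 2 ≤ m') (i j : Fin n) :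
    ContDiff ℝ m fun y => hessD w y i j := by
  have h2 : (2 : WithTop ℕ∞) ≤ m' := le_trans le_add_self hm
  have : (fun y => hessD w y i j) = fun y => partialD (fun z => partialD w z j) y i := by
    ext y; rw [partialD_partialD (hw.of_le h2)]
  rw [this]
  refine contDiff_partialD (m' := m + 1) (contDiff_partialD hw ?_ j) le_rfl i
  rwa [add_assoc, one_add_one_eq_two]

theorem isSymm_hessMat (hw : ContDiff ℝ 2 w) (x : EuclideanSpace ℝ (Fin n)) :
    (hessMat w x).IsSymm := by
  ext i j; exact hessD_comm hw x j i

/-- Total symmetry of third derivatives, in the first two indices. -/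
theorem partialD_hessD_comm (hw : ContDiff ℝ 3 w) (x : EuclideanSpace ℝ (Fin n)) (i a b : Fin n) :
    partialD (fun y => hessD w y a b) x i = partialD (fun y => hessD w y i b) x a := by
  have h2 : ContDiff ℝ 2 w := hw.of_le (by norm_num)
  have hb : ContDiff ℝ 2 fun y => partialD w y b := contDiff_partialD hw (by norm_num) b
  have e : ∀ c, (fun y => hessD w y c b) = fun y => partialD (fun z => partialD w z b) y c := by
    intro c; ext y; rw [partialD_partialD h2]
  rw [e, e, partialD_partialD hb, partialD_partialD hb, hessD_comm hb]

theorem hasLineDerivAt_partialD {f : EuclideanSpace ℝ (Fin n) → ℝ}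
    {x : EuclideanSpace ℝ (Fin n)} (hf : DifferentiableAt ℝ f x) (i : Fin n) :
    HasDerivAt (fun t : ℝ => f (x + t • EuclideanSpace.single i 1)) (partialD f x i) 0 :=
  hf.hasFDerivAt.hasLineDerivAt _

theorem HasDerivAt.newtonTensor {A : ℝ → Matrix (Fin n) (Fin n) ℝ}
    {B : Matrix (Fin n) (Fin n) ℝ} {s : ℝ}
    (hA : ∀ a b, HasDerivAt (fun t => A t a b) (B a b) s) (j : ℕ) (a b : Fin n) :
    HasDerivAt (fun t => _root_.newtonTensor (A t) j a b) (newtonTensorDeriv (A s) B j a b) s := by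
  induction j generalizing a b with
  | zero => simpa [newtonTensorDeriv] using hasDerivAt_const s ((1 : Matrix (Fin n) (Fin n) ℝ) a b)
  | succ j ih =>
    have hm : ∀ a b, HasDerivAt (fun t => (_root_.newtonTensor (A t) j * A t) a b)
        ((newtonTensorDeriv (A s) B j * A s + _root_.newtonTensor (A s) j * B) a b) s := by
      intro a b
      simp only [Matrix.add_apply, mul_apply, ← Finset.sum_add_distrib]
      exact HasDerivAt.fun_sum fun c _ => (ih a c).mul (hA c b)
    have ht : HasDerivAt (fun t => trace (_root_.newtonTensor (A t) j * A t))
        (trace (newtonTensorDeriv (A s) B j * A s + _root_.newtonTensor (A s) j * B)) s := by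
      simp only [trace, diag]
      exact HasDerivAt.fun_sum fun c _ => hm c c
    simp only [_root_.newtonTensor, newtonTensorDeriv, Matrix.sub_apply, Matrix.smul_apply,
      smul_eq_mul]
    exact ((ht.div_const _).mul_const _).sub (hm a b)

theorem ContDiff.newtonTensor {E : Type*} [NormedAddCommGroup E] [NormedSpace ℝ E]
    {m : WithTop ℕ∞} {A : E → Matrix (Fin n) (Fin n) ℝ}
    (hA : ∀ a b, ContDiff ℝ m fun x => A x a b) (j : ℕ) (a b : Fin n) :
    ContDiff ℝ m fun x => _root_.newtonTensor (A x) j a b := by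
  induction j generalizing a b with
  | zero => exact contDiff_const
  | succ j ih =>
    have hm : ∀ a b, ContDiff ℝ m fun x => (_root_.newtonTensor (A x) j * A x) a b := by
      intro a b
      simp only [mul_apply]
      exact ContDiff.sum fun c _ => (ih a c).mul (hA c b)
    have ht : ContDiff ℝ m fun x => trace (_root_.newtonTensor (A x) j * A x) := by
      simp only [trace, diag]
      exact ContDiff.sum fun c _ => hm c c
    simp only [_root_.newtonTensor, Matrix.sub_apply, Matrix.smul_apply, smul_eq_mul]
    exact ((ht.div_const _).mul contDiff_const).sub (hm a b)

theorem contDiff_schouten {m m' : WithTop ℕ∞} (hw : ContDiff ℝ m' w) (hm : m + 2 ≤ m')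
    (a b : Fin n) : ContDiff ℝ m fun x => schouten w x a b := by
  have h0 : ContDiff ℝ m w := hw.of_le (le_trans le_self_add hm)
  have h1 : ∀ i, ContDiff ℝ m fun x => partialD w x i := fun i =>
    contDiff_partialD hw (le_trans (by gcongr; exact one_le_two) hm) i
  simp only [schouten, conformalMat, hessMat, gradVec, Matrix.sub_apply, Matrix.smul_apply,
    smul_eq_mul, dotProduct, of_apply]
  exact (h0.mul (contDiff_hessD hw hm a b)).sub ((contDiff_const.mul
    (ContDiff.sum fun i _ => (h1 i).mul (h1 i))).mul contDiff_const)

/-- The integral of a divergence vanishes. -/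
theorem integral_partialD_eq_zero {F : EuclideanSpace ℝ (Fin n) → ℝ} (hF : ContDiff ℝ 1 F)
    (hc : HasCompactSupport F) (i : Fin n) : ∫ x, partialD F x i = 0 := by
  have h1 : Integrable (fun x => partialD F x i) :=
    (contDiff_partialD (m := 0) hF (by norm_num) i).continuous.integrable_of_hasCompactSupport
      (hc.fderiv_apply (𝕜 := ℝ) _)
  have h2 : Integrable F := hF.continuous.integrable_of_hasCompactSupport hc
  have := integral_mul_fderiv_eq_neg_fderiv_mul_of_integrable (𝕜 := ℝ) (f := F)
    (g := fun _ => (1 : ℝ)) (v := EuclideanSpace.single i 1) (μ := volume)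
    (by simpa [partialD] using h1) (by simp) (by simpa using h2)
    (fun x _ => hF.differentiable (by norm_num) x) (fun x _ => by fun_prop)
  simp only [fderiv_fun_const, mul_one] at this
  simpa [partialD] using this

end PartialDerivatives

section WeakIdentity

variable {n : ℕ}

/-- The divergence of the vector field `ψ w T_j(A) ∇w`, `A` being the Schouten tensor of
`w⁻² |dx|²`, as a function of the derivatives of `ψ` up to order one and of `w` up to order two. -/
noncomputable def newtonFlux (j : ℕ) (p : ℝ) (q : Fin n → ℝ) (t : ℝ) (g : Fin n → ℝ)
    (H : Matrix (Fin n) (Fin n) ℝ) : ℝ :=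
  p * ((n + 1) * (g ⬝ᵥ newtonTensor (conformalMat t g H) j *ᵥ g)
      + (j + 1) * matrixSigma (conformalMat t g H) (j + 1)
      - 1 / 2 * (n - j) * matrixSigma (conformalMat t g H) j * (g ⬝ᵥ g))
    + t * (q ⬝ᵥ newtonTensor (conformalMat t g H) j *ᵥ g)

theorem partialD_schouten {w : EuclideanSpace ℝ (Fin n) → ℝ} (hw : ContDiff ℝ 3 w)
    (x : EuclideanSpace ℝ (Fin n)) (i a b : Fin n) :
    partialD (fun y => schouten w y a b) x i =
      (gradVec w x i • hessMat w x + w x • (of fun a b => partialD (fun y => hessD w y a b) x i)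
        - ((hessMat w x *ᵥ gradVec w x) i) • (1 : Matrix (Fin n) (Fin n) ℝ)) a b := by
  have hw2 : ContDiff ℝ 2 w := hw.of_le (by norm_num)
  have h0 := hasLineDerivAt_partialD (hw.differentiable (by norm_num) x) i
  have h1 : ∀ c, HasDerivAt (fun t : ℝ => partialD w (x + t • EuclideanSpace.single i 1) c)
      (hessD w x i c) 0 := fun c => by
    rw [← partialD_partialD hw2]
    exact hasLineDerivAt_partialD
      ((contDiff_partialD (m := 1) hw2 (by norm_num) c).differentiable (by norm_num) x) i
  have h2 := hasLineDerivAt_partialD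
      ((contDiff_hessD (m := 1) hw (by norm_num) a b).differentiable (by norm_num) x) i
  have h3 := hasLineDerivAt_partialD
      ((contDiff_schouten (m := 1) hw (by norm_num) a b).differentiable (by norm_num) x) i
  refine h3.unique ?_
  have h4 := (h0.mul h2).sub (((HasDerivAt.fun_sum (u := Finset.univ) fun c _ =>
    (h1 c).mul (h1 c)).const_mul (1 / 2)).mul_const ((1 : Matrix (Fin n) (Fin n) ℝ) a b))
  refine (h4.congr_deriv ?_).congr_of_eventuallyEq (.of_forall fun t => ?_)
  · simp only [zero_smul, add_zero, Matrix.sub_apply, Matrix.add_apply, Matrix.smul_apply,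
      smul_eq_mul, gradVec, hessMat, of_apply, mulVec, dotProduct]
    have : ∑ c, (hessD w x i c * partialD w x c + partialD w x c * hessD w x i c) =
        2 * ∑ c, hessD w x i c * partialD w x c := by
      rw [Finset.mul_sum]; exact Finset.sum_congr rfl fun c _ => by ring
    rw [this]; ring
  · simp [schouten, conformalMat, hessMat, gradVec, dotProduct]

/-- The weak divergence identity for functions of class `C³`, where `newtonFlux` is an honest
divergence. -/
theorem integral_newtonFlux_of_contDiff_three {w ψ : EuclideanSpace ℝ (Fin n) → ℝ}
    (hw : ContDiff ℝ 3 w) (hψ : ContDiff ℝ 1 ψ) (hc : HasCompactSupport ψ) (j : ℕ) :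
    ∫ x, newtonFlux j (ψ x) (gradVec ψ x) (w x) (gradVec w x) (hessMat w x) = 0 := by
  have hw2 : ContDiff ℝ 2 w := hw.of_le (by norm_num)
  have hw1 : ContDiff ℝ 1 w := hw.of_le (by norm_num)
  have hT : ∀ a b, ContDiff ℝ 1 fun x => newtonTensor (schouten w x) j a b :=
    ContDiff.newtonTensor (fun a b => contDiff_schouten hw (by norm_num) a b) j
  have hg : ∀ a, ContDiff ℝ 1 fun x => partialD w x a :=
    fun a => contDiff_partialD hw2 (by norm_num) a
  set F : Fin n → EuclideanSpace ℝ (Fin n) → ℝ := fun i x =>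
    ψ x * (w x * ∑ l, newtonTensor (schouten w x) j i l * partialD w x l) with hFdef
  have hF : ∀ i, ContDiff ℝ 1 (F i) := fun i =>
    hψ.mul (hw1.mul (ContDiff.sum fun l _ => (hT i l).mul (hg l)))
  have hFc : ∀ i, HasCompactSupport (F i) := fun i => hc.mul_right
  have key : ∀ x, newtonFlux j (ψ x) (gradVec ψ x) (w x) (gradVec w x) (hessMat w x) =
      ∑ i, partialD (F i) x i := by
    intro x
    set T := newtonTensor (schouten w x) j with hTx
    set D : Fin n → Matrix (Fin n) (Fin n) ℝ :=
      fun i => of fun a b => partialD (fun y => hessD w y a b) x i with hD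
    set B : Fin n → Matrix (Fin n) (Fin n) ℝ := fun i => gradVec w x i • hessMat w x + w x • D i
        - ((hessMat w x *ᵥ gradVec w x) i) • (1 : Matrix (Fin n) (Fin n) ℝ) with hB
    have hdiv : ∀ l, w x * ∑ i, newtonTensorDeriv (schouten w x) (B i) j i l =
        n * (T *ᵥ gradVec w x) l - (n - j) * matrixSigma (schouten w x) j * gradVec w x l :=
      sum_newtonTensorDeriv (w x) (gradVec w x) (hessMat w x) (isSymm_hessMat hw2 x) D
      (fun i a b => partialD_hessD_comm hw x i a b)
      (fun i => by
        ext a b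
        simp only [hD, transpose_apply, of_apply]
        congr 1; ext y; exact hessD_comm hw2 y b a) j
    have hFi : ∀ i, partialD (F i) x i =
        partialD ψ x i * (w x * ∑ l, T i l * partialD w x l)
        + ψ x * (partialD w x i * ∑ l, T i l * partialD w x l
          + w x * ∑ l, (newtonTensorDeriv (schouten w x) (B i) j i l * partialD w x l
            + T i l * hessD w x i l)) := by
      intro i
      have d0 := hasLineDerivAt_partialD (hψ.differentiable (by norm_num) x) i
      have d1 := hasLineDerivAt_partialD (hw1.differentiable (by norm_num) x) i
      have d2 : ∀ c, HasDerivAt (fun t : ℝ => partialD w (x + t • EuclideanSpace.single i 1) c)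
          (hessD w x i c) 0 := fun c => by
        rw [← partialD_partialD hw2]
        exact hasLineDerivAt_partialD ((hg c).differentiable (by norm_num) x) i
      have d3 : ∀ a b, HasDerivAt
          (fun t : ℝ => schouten w (x + t • EuclideanSpace.single i 1) a b) (B i a b) 0 := by
        intro a b
        have := hasLineDerivAt_partialD
          ((contDiff_schouten (m := 1) hw (by norm_num) a b).differentiable (by norm_num) x) i
        rwa [partialD_schouten hw] at this
      have d4 := fun l => HasDerivAt.newtonTensor d3 j i l
      have d5 := d0.mul (d1.mul (HasDerivAt.fun_sum (u := Finset.univ)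
        fun l _ => (d4 l).mul (d2 l)))
      have d6 := hasLineDerivAt_partialD ((hF i).differentiable (by norm_num) x) i
      refine d6.unique (d5.congr_deriv ?_)
      simp [hTx]
    have s1 : ∑ i, partialD ψ x i * (w x * ∑ l, T i l * partialD w x l) =
        w x * (gradVec ψ x ⬝ᵥ T *ᵥ gradVec w x) := by
      simp only [dotProduct, mulVec, gradVec, Finset.mul_sum]
      exact Finset.sum_congr rfl fun i _ => Finset.sum_congr rfl fun l _ => by ring
    have s2 : ∑ i, partialD w x i * ∑ l, T i l * partialD w x l =
        gradVec w x ⬝ᵥ T *ᵥ gradVec w x := by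
      simp only [dotProduct, mulVec, gradVec]
    have s3 : ∑ i, w x * ∑ l, newtonTensorDeriv (schouten w x) (B i) j i l * partialD w x l =
        n * (gradVec w x ⬝ᵥ T *ᵥ gradVec w x)
          - (n - j) * matrixSigma (schouten w x) j * (gradVec w x ⬝ᵥ gradVec w x) := by
      have e : ∑ i, w x * ∑ l, newtonTensorDeriv (schouten w x) (B i) j i l * partialD w x l =
          ∑ l, (w x * ∑ i, newtonTensorDeriv (schouten w x) (B i) j i l) * partialD w x l := by
        simp only [Finset.mul_sum, Finset.sum_mul]
        rw [Finset.sum_comm]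
        exact Finset.sum_congr rfl fun i _ => Finset.sum_congr rfl fun l _ => by ring
      rw [e, Finset.sum_congr rfl fun l _ => congrArg (· * partialD w x l) (hdiv l)]
      simp only [dotProduct, Finset.mul_sum]
      rw [← Finset.sum_sub_distrib]
      refine Finset.sum_congr rfl fun l _ => ?_
      simp only [gradVec]; ring
    have s4 : ∑ i, w x * ∑ l, T i l * hessD w x i l =
        (j + 1) * matrixSigma (schouten w x) (j + 1)
        + 1 / 2 * (gradVec w x ⬝ᵥ gradVec w x) * ((n - j) * matrixSigma (schouten w x) j) := by
      rw [← trace_newtonTensor_mul, ← trace_newtonTensor, ← hTx]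
      have e : w x • hessMat w x = schouten w x
          + (1 / 2 * (gradVec w x ⬝ᵥ gradVec w x)) • (1 : Matrix (Fin n) (Fin n) ℝ) := by
        rw [schouten, conformalMat]; abel
      have e2 : trace (T * (w x • hessMat w x)) = ∑ i, w x * ∑ l, T i l * hessD w x i l := by
        simp only [trace, diag, mul_apply, Matrix.smul_apply, smul_eq_mul, Finset.mul_sum]
        refine Finset.sum_congr rfl fun i _ => Finset.sum_congr rfl fun l _ => ?_
        simp only [hessMat, of_apply]
        rw [hessD_comm hw2 x l i]; ring
      rw [← e2, e, Matrix.mul_add, trace_add, Matrix.mul_smul, trace_smul, Matrix.mul_one,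
        smul_eq_mul]
    rw [Finset.sum_congr rfl fun i _ => hFi i]
    simp only [Finset.sum_add_distrib, mul_add, ← Finset.mul_sum (a := ψ x)]
    rw [s1, s2, s3, s4, newtonFlux]
    change ψ x * ((n + 1) * (gradVec w x ⬝ᵥ T *ᵥ gradVec w x)
      + (j + 1) * matrixSigma (schouten w x) (j + 1)
      - 1 / 2 * (n - j) * matrixSigma (schouten w x) j * (gradVec w x ⬝ᵥ gradVec w x))
      + w x * (gradVec ψ x ⬝ᵥ T *ᵥ gradVec w x) = _
    ring
  simp only [key]
  rw [integral_finsetSum]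
  · exact Finset.sum_eq_zero fun i _ => integral_partialD_eq_zero (hF i) (hFc i) i
  · intro i _
    exact (contDiff_partialD (m := 0) (hF i)
      (by norm_num) i).continuous.integrable_of_hasCompactSupport ((hFc i).fderiv_apply (𝕜 := ℝ) _)

end WeakIdentity

end

/-! ### Mollification and the weak divergence identity for functions of class `C²` -/

section

open Matrix MeasureTheory Filter Topology

section Mollification

variable {n : ℕ}

/-- Mollification commutes with partial derivatives. -/
theorem partialD_normed_convolution (φ : ContDiffBump (0 : EuclideanSpace ℝ (Fin n)))
    {f : EuclideanSpace ℝ (Fin n) → ℝ} (hf : ContDiff ℝ 1 f) (hc : HasCompactSupport f)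
    (x : EuclideanSpace ℝ (Fin n)) (i : Fin n) :
    partialD (convolution (φ.normed volume) f (ContinuousLinearMap.lsmul ℝ ℝ) volume) x i =
      convolution (φ.normed volume) (fun y => partialD f y i) (ContinuousLinearMap.lsmul ℝ ℝ)
        volume x := by
  have hl : LocallyIntegrable (φ.normed (volume : Measure (EuclideanSpace ℝ (Fin n)))) volume :=
    φ.continuous_normed.locallyIntegrable
  have h := hc.hasFDerivAt_convolution_right (ContinuousLinearMap.lsmul ℝ ℝ) hl hf x
  rw [partialD, h.fderiv]
  exact convolution_precompR_apply (ContinuousLinearMap.lsmul ℝ ℝ) hl (hc.fderiv (𝕜 := ℝ))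
    (hf.continuous_fderiv (by norm_num)) x _

theorem abs_normed_convolution_le (φ : ContDiffBump (0 : EuclideanSpace ℝ (Fin n)))
    {f : EuclideanSpace ℝ (Fin n) → ℝ} (hf : Continuous f) {M : ℝ} (hM : ∀ x, |f x| ≤ M)
    (x : EuclideanSpace ℝ (Fin n)) :
    |convolution (φ.normed volume) f (ContinuousLinearMap.lsmul ℝ ℝ) volume x| ≤ 3 * M := by
  have h := φ.dist_normed_convolution_le (μ := volume) (g := f) (x₀ := x) (ε := 2 * M)
    hf.aestronglyMeasurable (fun y _ => by
      rw [Real.dist_eq]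
      calc |f y - f x| ≤ |f y| + |f x| := abs_sub _ _
        _ ≤ 2 * M := by linarith [hM x, hM y])
  rw [Real.dist_eq] at h
  have h2 := abs_sub_abs_le_abs_sub
    (convolution (φ.normed volume) f (ContinuousLinearMap.lsmul ℝ ℝ) volume x) (f x)
  linarith [hM x]

theorem HasCompactSupport.exists_abs_le {f : EuclideanSpace ℝ (Fin n) → ℝ}
    (hc : HasCompactSupport f) (hf : Continuous f) : ∃ M, ∀ x, |f x| ≤ M := by
  obtain ⟨M, hM⟩ := hc.exists_bound_of_continuous hf
  exact ⟨M, hM⟩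

/-- A function of class `C²` that is constant near infinity is the limit, together with its first
and second derivatives and boundedly, of smooth functions. -/
theorem exists_smooth_approximation {w : EuclideanSpace ℝ (Fin n) → ℝ} (hw : ContDiff ℝ 2 w)
    (hc : HasCompactSupport fun x => w x - 1) :
    ∃ (v : ℕ → EuclideanSpace ℝ (Fin n) → ℝ) (M : ℝ), (∀ m, ContDiff ℝ 3 (v m)) ∧
      (∀ m x, |v m x| ≤ M ∧ (∀ i, |gradVec (v m) x i| ≤ M) ∧ ∀ i j, |hessMat (v m) x i j| ≤ M) ∧
      ∀ x, Tendsto (fun m => v m x) atTop (𝓝 (w x)) ∧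
        (∀ i, Tendsto (fun m => gradVec (v m) x i) atTop (𝓝 (gradVec w x i))) ∧
        ∀ i j, Tendsto (fun m => hessMat (v m) x i j) atTop (𝓝 (hessMat w x i j)) := by
  set f : EuclideanSpace ℝ (Fin n) → ℝ := fun x => w x - 1 with hf
  have hf2 : ContDiff ℝ 2 f := hw.sub contDiff_const
  have hf1 : ContDiff ℝ 1 f := hf2.of_le (by norm_num)
  have hpf : ∀ x i, partialD f x i = partialD w x i := by
    intro x i; simp [partialD, hf, fderiv_sub_const]
  have hD : ∀ i, ContDiff ℝ 1 fun x => partialD f x i := fun i =>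
    contDiff_partialD hf2 (by norm_num) i
  have hDc : ∀ i, HasCompactSupport fun x => partialD f x i := fun i => hc.fderiv_apply (𝕜 := ℝ) _
  have hHe : ∀ i j, (fun x => partialD (fun y => partialD f y j) x i) = fun x => hessD w x i j := by
    intro i j; ext x
    simp only [hpf]
    exact partialD_partialD hw x i j
  have hHc : ∀ i j, HasCompactSupport fun x => hessD w x i j := fun i j => by
    rw [← hHe]; exact (hDc j).fderiv_apply (𝕜 := ℝ) _
  have hHcont : ∀ i j, Continuous fun x => hessD w x i j := fun i j =>
    (contDiff_hessD (m := 0) hw (by norm_num) i j).continuous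
  let φ : ℕ → ContDiffBump (0 : EuclideanSpace ℝ (Fin n)) := fun m =>
    ⟨1 / ((m : ℝ) + 1) / 2, 1 / ((m : ℝ) + 1), by positivity, by
      have : (0 : ℝ) < 1 / ((m : ℝ) + 1) := by positivity
      linarith⟩
  have hφ : Tendsto (fun m => (φ m).rOut) atTop (𝓝 0) := tendsto_one_div_add_atTop_nhds_zero_nat
  let c : ℕ → (EuclideanSpace ℝ (Fin n) → ℝ) → EuclideanSpace ℝ (Fin n) → ℝ := fun m g =>
    convolution ((φ m).normed volume) g (ContinuousLinearMap.lsmul ℝ ℝ) volume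
  have hcs : ∀ m, ContDiff ℝ 3 (c m f) := fun m =>
    (φ m).hasCompactSupport_normed.contDiff_convolution_left (n := 3) _ (φ m).contDiff_normed
      hf1.continuous.locallyIntegrable
  have hlim : ∀ {g : EuclideanSpace ℝ (Fin n) → ℝ}, Continuous g → ∀ x,
      Tendsto (fun m => c m g x) atTop (𝓝 (g x)) := fun hg x =>
    ContDiffBump.convolution_tendsto_right_of_continuous hφ hg x
  have hgrad : ∀ m x i, gradVec (fun y => 1 + c m f y) x i = c m (fun y => partialD f y i) x := by
    intro m x i
    refine Eq.trans ?_ (partialD_normed_convolution (φ m) hf1 hc x i)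
    rw [gradVec, partialD, fderiv_const_add]
    rfl
  have hhess : ∀ m x i j, hessMat (fun y => 1 + c m f y) x i j =
      c m (fun y => hessD w y i j) x := by
    intro m x i j
    have h3 : ContDiff ℝ 2 fun y => 1 + c m f y :=
      contDiff_const.add ((hcs m).of_le (by norm_num))
    rw [hessMat, of_apply, ← partialD_partialD h3]
    have : (fun y => partialD (fun y => 1 + c m f y) y j) = c m fun y => partialD f y j := by
      ext y; exact hgrad m y j
    rw [this, ← hHe]
    exact partialD_normed_convolution (φ m) (hD j) (hDc j) x i
  obtain ⟨M0, hM0⟩ := hc.exists_abs_le hf1.continuous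
  choose M1 hM1 using fun i => (hDc i).exists_abs_le (hD i).continuous
  choose M2 hM2 using fun i j => (hHc i j).exists_abs_le (hHcont i j)
  have hM0' : 0 ≤ M0 := (abs_nonneg _).trans (hM0 0)
  have hM1' : ∀ i, 0 ≤ M1 i := fun i => (abs_nonneg _).trans (hM1 i 0)
  have hM2' : ∀ i j, 0 ≤ M2 i j := fun i j => (abs_nonneg _).trans (hM2 i j 0)
  refine ⟨fun m y => 1 + c m f y, 1 + 3 * (M0 + ∑ i, M1 i + ∑ i, ∑ j, M2 i j), fun m =>
    contDiff_const.add (hcs m), fun m x => ?_, fun x => ?_⟩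
  · have s1 : 0 ≤ ∑ i, M1 i := Finset.sum_nonneg fun i _ => hM1' i
    have s2 : 0 ≤ ∑ i, ∑ j, M2 i j := Finset.sum_nonneg fun i _ => Finset.sum_nonneg fun j _ =>
      hM2' i j
    refine ⟨?_, fun i => ?_, fun i j => ?_⟩
    · have := abs_normed_convolution_le (φ m) hf1.continuous hM0 x
      have h2 := abs_add_le 1 (c m f x)
      rw [abs_one] at h2
      linarith
    · rw [hgrad]
      have := abs_normed_convolution_le (φ m) (hD i).continuous (hM1 i) x
      have h2 : M1 i ≤ ∑ i, M1 i :=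
        Finset.single_le_sum (fun i _ => hM1' i) (Finset.mem_univ i)
      linarith
    · rw [hhess]
      have := abs_normed_convolution_le (φ m) (hHcont i j) (hM2 i j) x
      have h2 : M2 i j ≤ ∑ j, M2 i j :=
        Finset.single_le_sum (fun j _ => hM2' i j) (Finset.mem_univ j)
      have h3 : ∑ j, M2 i j ≤ ∑ i, ∑ j, M2 i j :=
        Finset.single_le_sum (f := fun i => ∑ j, M2 i j)
          (fun i _ => Finset.sum_nonneg fun j _ => hM2' i j) (Finset.mem_univ i)
      linarith
  · refine ⟨?_, fun i => ?_, fun i j => ?_⟩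
    · have := (hlim hf1.continuous x).const_add 1
      simpa [hf] using this
    · simp only [hgrad]
      have := hlim (hD i).continuous x
      rwa [hpf] at this
    · simp only [hhess]
      exact hlim (hHcont i j) x

theorem continuous_newtonFlux (j : ℕ) :
    Continuous fun z : (ℝ × (Fin n → ℝ)) × ℝ × (Fin n → ℝ) × (Fin n → Fin n → ℝ) =>
      newtonFlux j z.1.1 z.1.2 z.2.1 z.2.2.1 (of z.2.2.2) := by
  have hA : Continuous fun z : (ℝ × (Fin n → ℝ)) × ℝ × (Fin n → ℝ) × (Fin n → Fin n → ℝ) =>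
      conformalMat z.2.1 z.2.2.1 (of z.2.2.2) := by
    have h : Continuous fun z : (ℝ × (Fin n → ℝ)) × ℝ × (Fin n → ℝ) × (Fin n → Fin n → ℝ) =>
        (of z.2.2.2 : Matrix (Fin n) (Fin n) ℝ) :=
      continuous_snd.comp (continuous_snd.comp continuous_snd)
    have hg : Continuous fun z : (ℝ × (Fin n → ℝ)) × ℝ × (Fin n → ℝ) × (Fin n → Fin n → ℝ) =>
        z.2.2.1 ⬝ᵥ z.2.2.1 := Continuous.dotProduct (by fun_prop) (by fun_prop)
    unfold conformalMat
    exact ((continuous_fst.comp continuous_snd).smul h).sub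
      ((continuous_const.mul hg).smul continuous_const)
  have hT := (continuous_newtonTensor (n := n) j).comp hA
  have hs := (continuous_matrixSigma (n := n) j).comp hA
  have hs' := (continuous_matrixSigma (n := n) (j + 1)).comp hA
  have hTg : Continuous fun z : (ℝ × (Fin n → ℝ)) × ℝ × (Fin n → ℝ) × (Fin n → Fin n → ℝ) =>
      newtonTensor (conformalMat z.2.1 z.2.2.1 (of z.2.2.2)) j *ᵥ z.2.2.1 :=
    Continuous.matrix_mulVec hT (by fun_prop)
  have hg : Continuous fun z : (ℝ × (Fin n → ℝ)) × ℝ × (Fin n → ℝ) × (Fin n → Fin n → ℝ) =>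
      z.2.2.1 ⬝ᵥ z.2.2.1 := Continuous.dotProduct (by fun_prop) (by fun_prop)
  unfold newtonFlux
  refine (continuous_fst.comp continuous_fst).mul ?_ |>.add
    ((continuous_fst.comp continuous_snd).mul ?_)
  · exact ((continuous_const.mul (Continuous.dotProduct (by fun_prop) hTg)).add
      (continuous_const.mul hs')).sub ((continuous_const.mul hs).mul hg)
  · exact Continuous.dotProduct (by fun_prop) hTg

theorem continuous_newtonFlux_comp {w ψ : EuclideanSpace ℝ (Fin n) → ℝ} (hw : ContDiff ℝ 2 w)
    (hψ : ContDiff ℝ 1 ψ) (j : ℕ) :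
    Continuous fun x => newtonFlux j (ψ x) (gradVec ψ x) (w x) (gradVec w x) (hessMat w x) := by
  have h1 : Continuous fun x => ((ψ x, gradVec ψ x), w x, gradVec w x, fun i j => hessD w x i j) :=
    (hψ.continuous.prodMk (continuous_pi fun i =>
      (contDiff_partialD (m := 0) hψ (by norm_num) i).continuous)).prodMk (hw.continuous.prodMk
      ((continuous_pi fun i => (contDiff_partialD (m := 0) hw (by norm_num) i).continuous).prodMk
        (continuous_pi fun i => continuous_pi fun j =>
          (contDiff_hessD (m := 0) hw (by norm_num) i j).continuous)))
  exact (continuous_newtonFlux j).comp h1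

theorem newtonFlux_eq_zero_of_notMem_tsupport {w ψ : EuclideanSpace ℝ (Fin n) → ℝ} (j : ℕ)
    {x : EuclideanSpace ℝ (Fin n)} (hx : x ∉ tsupport ψ) :
    newtonFlux j (ψ x) (gradVec ψ x) (w x) (gradVec w x) (hessMat w x) = 0 := by
  have h1 : ψ x = 0 := image_eq_zero_of_notMem_tsupport hx
  have h2 : gradVec ψ x = 0 := by
    ext i
    have : fderiv ℝ ψ x = 0 :=
      image_eq_zero_of_notMem_tsupport fun h => hx (tsupport_fderiv_subset ℝ h)
    simp [gradVec, partialD, this]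
  simp [newtonFlux, h1, h2]

theorem integrable_newtonFlux {w ψ : EuclideanSpace ℝ (Fin n) → ℝ} (hw : ContDiff ℝ 2 w)
    (hψ : ContDiff ℝ 1 ψ) (hc : HasCompactSupport ψ) (j : ℕ) :
    Integrable fun x => newtonFlux j (ψ x) (gradVec ψ x) (w x) (gradVec w x) (hessMat w x) :=
  (continuous_newtonFlux_comp hw hψ j).integrable_of_hasCompactSupport
    (HasCompactSupport.intro hc fun _ hx => newtonFlux_eq_zero_of_notMem_tsupport j hx)

/-- The weak form of the divergence identity for the Newton tensors of the Schouten tensor. It needs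
no more regularity than `C²`: the third derivatives in the classical identity cancel. -/
theorem integral_newtonFlux {w ψ : EuclideanSpace ℝ (Fin n) → ℝ} (hw : ContDiff ℝ 2 w)
    (hwc : HasCompactSupport fun x => w x - 1) (hψ : ContDiff ℝ 1 ψ) (hc : HasCompactSupport ψ)
    (j : ℕ) :
    ∫ x, newtonFlux j (ψ x) (gradVec ψ x) (w x) (gradVec w x) (hessMat w x) = 0 := by
  obtain ⟨v, M, hv, hM, hlim⟩ := exists_smooth_approximation hw hwc
  have hgψ : ∀ i, Continuous fun x => gradVec ψ x i := fun i =>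
    (contDiff_partialD (m := 0) hψ (by norm_num) i).continuous
  have hgψc : ∀ i, HasCompactSupport fun x => gradVec ψ x i := fun i => hc.fderiv_apply (𝕜 := ℝ) _
  obtain ⟨P, hP⟩ := hc.exists_abs_le hψ.continuous
  choose Q hQ using fun i => (hgψc i).exists_abs_le (hgψ i)
  have hK : IsCompact ((Set.Icc (-P) P ×ˢ Set.univ.pi fun i => Set.Icc (-(Q i)) (Q i)) ×ˢ
      (Set.Icc (-M) M ×ˢ (Set.univ.pi fun _ : Fin n => Set.Icc (-M) M) ×ˢ
        Set.univ.pi fun _ : Fin n => Set.univ.pi fun _ : Fin n => Set.Icc (-M) M)) :=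
    (isCompact_Icc.prod (isCompact_univ_pi fun i => isCompact_Icc)).prod
      (isCompact_Icc.prod ((isCompact_univ_pi fun i => isCompact_Icc).prod
        (isCompact_univ_pi fun i => isCompact_univ_pi fun i => isCompact_Icc)))
  obtain ⟨C, hC⟩ := hK.exists_bound_of_continuousOn (continuous_newtonFlux (n := n) j).continuousOn
  have ht := tendsto_integral_of_dominated_convergence
    (F := fun m x => newtonFlux j (ψ x) (gradVec ψ x) (v m x) (gradVec (v m) x) (hessMat (v m) x))
    (f := fun x => newtonFlux j (ψ x) (gradVec ψ x) (w x) (gradVec w x) (hessMat w x))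
    (μ := volume) ((tsupport ψ).indicator fun _ => C)
    (fun m => (continuous_newtonFlux_comp ((hv m).of_le (by norm_num)) hψ j).aestronglyMeasurable)
    ((integrable_indicator_iff (isClosed_tsupport ψ).measurableSet).2
      (integrableOn_const hc.measure_ne_top))
    (fun m => .of_forall fun x => ?_) (.of_forall fun x => ?_)
  · have h0 : ∀ m, ∫ x, newtonFlux j (ψ x) (gradVec ψ x) (v m x) (gradVec (v m) x)
        (hessMat (v m) x) = 0 := fun m => integral_newtonFlux_of_contDiff_three (hv m) hψ hc j
    simp only [h0] at ht
    exact (tendsto_nhds_unique ht tendsto_const_nhds)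
  · by_cases hx : x ∈ tsupport ψ
    · rw [Set.indicator_of_mem hx]
      obtain ⟨h1, h2, h3⟩ := hM m x
      exact hC ((ψ x, gradVec ψ x), v m x, gradVec (v m) x, fun i j => hessD (v m) x i j)
        ⟨⟨abs_le.1 (hP x), fun i _ => abs_le.1 (hQ i x)⟩, abs_le.1 h1, fun i _ => abs_le.1 (h2 i),
          fun i _ j _ => abs_le.1 (h3 i j)⟩
    · rw [Set.indicator_of_notMem hx, newtonFlux_eq_zero_of_notMem_tsupport j hx, norm_zero]
  · obtain ⟨h1, h2, h3⟩ := hlim x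
    have hz : Tendsto (fun m => ((ψ x, gradVec ψ x), v m x, gradVec (v m) x,
        fun i j => hessD (v m) x i j)) atTop
        (𝓝 ((ψ x, gradVec ψ x), w x, gradVec w x, fun i j => hessD w x i j)) :=
      tendsto_const_nhds.prodMk_nhds (h1.prodMk_nhds ((tendsto_pi_nhds.2 h2).prodMk_nhds
        (tendsto_pi_nhds.2 fun i => tendsto_pi_nhds.2 fun j => h3 i j)))
    exact ((continuous_newtonFlux j).tendsto _).comp hz

end Mollification

end

/-! ### Test functions and weighted energies -/

section

open Matrix MeasureTheory Filter Topology

section TestFunctions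

variable {n : ℕ} {w ζ : EuclideanSpace ℝ (Fin n) → ℝ}

/-- The squared length `|∇w|²` of the gradient. -/
noncomputable def gradSq {n : ℕ} (w : EuclideanSpace ℝ (Fin n) → ℝ)
    (x : EuclideanSpace ℝ (Fin n)) : ℝ := gradVec w x ⬝ᵥ gradVec w x

/-- The densities `ζ^N w^s |∇w|^{2b} σ_j(A)` of the weighted energies in the Caccioppoli
inequality. -/
noncomputable def energyDensity (w ζ : EuclideanSpace ℝ (Fin n) → ℝ) (N : ℕ) (s : ℝ) (b j : ℕ)
    (x : EuclideanSpace ℝ (Fin n)) : ℝ :=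
  ζ x ^ N * w x ^ s * gradSq w x ^ b * matrixSigma (schouten w x) j

theorem gradSq_nonneg (w : EuclideanSpace ℝ (Fin n) → ℝ) (x : EuclideanSpace ℝ (Fin n)) :
    0 ≤ gradSq w x := by
  unfold gradSq dotProduct
  exact Finset.sum_nonneg fun i _ => mul_self_nonneg (gradVec w x i)

theorem contDiff_gradSq (hw : ContDiff ℝ 2 w) : ContDiff ℝ 1 (gradSq w) := by
  unfold gradSq gradVec dotProduct
  exact ContDiff.sum fun i _ => (contDiff_partialD (m := 1) hw (by norm_num) i).mul
    (contDiff_partialD (m := 1) hw (by norm_num) i)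

theorem continuous_schouten (hw : ContDiff ℝ 2 w) : Continuous (schouten w) :=
  continuous_pi fun a => continuous_pi fun b =>
    (contDiff_schouten (m := 0) hw (by norm_num) a b).continuous

theorem continuous_energyDensity (hw : ContDiff ℝ 2 w) (hpos : ∀ x, 0 < w x) (hζ : ContDiff ℝ 1 ζ)
    (N : ℕ) (s : ℝ) (b j : ℕ) : Continuous (energyDensity w ζ N s b j) := by
  have h1 : Continuous fun x => w x ^ s :=
    hw.continuous.rpow_const fun x => Or.inl (hpos x).ne'
  exact (((hζ.continuous.pow N).mul h1).mul ((contDiff_gradSq hw).continuous.pow b)).mul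
    ((continuous_matrixSigma j).comp (continuous_schouten hw))

theorem integrable_energyDensity (hw : ContDiff ℝ 2 w) (hpos : ∀ x, 0 < w x)
    (hζ : ContDiff ℝ 1 ζ) (hc : HasCompactSupport ζ) {N : ℕ} (hN : N ≠ 0) (s : ℝ) (b j : ℕ) :
    Integrable (energyDensity w ζ N s b j) := by
  refine (continuous_energyDensity hw hpos hζ N s b j).integrable_of_hasCompactSupport ?_
  refine hc.mono fun x hx => ?_
  rw [Function.mem_support] at hx ⊢
  contrapose! hx
  simp [energyDensity, hx, hN]

theorem hasDerivAt_gradSq (hw : ContDiff ℝ 2 w) (x : EuclideanSpace ℝ (Fin n)) (i : Fin n) :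
    HasDerivAt (fun t : ℝ => gradSq w (x + t • EuclideanSpace.single i 1))
      (2 * (hessMat w x *ᵥ gradVec w x) i) 0 := by
  have h1 : ∀ c, HasDerivAt (fun t : ℝ => partialD w (x + t • EuclideanSpace.single i 1) c)
      (hessD w x i c) 0 := fun c => by
    rw [← partialD_partialD hw]
    exact hasLineDerivAt_partialD
      ((contDiff_partialD (m := 1) hw (by norm_num) c).differentiable (by norm_num) x) i
  refine (HasDerivAt.fun_sum (u := Finset.univ) fun c _ => (h1 c).mul (h1 c)).congr_deriv ?_
  simp only [zero_smul, add_zero, hessMat, gradVec, mulVec, dotProduct, of_apply, Finset.mul_sum]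
  exact Finset.sum_congr rfl fun c _ => by ring

/-- The test function `ζ^N w^s |∇w|^{2b}`. -/
noncomputable def testFun (w ζ : EuclideanSpace ℝ (Fin n) → ℝ) (N : ℕ) (s : ℝ) (b : ℕ)
    (x : EuclideanSpace ℝ (Fin n)) : ℝ := ζ x ^ N * (w x ^ s * gradSq w x ^ b)

theorem contDiff_testFun (hw : ContDiff ℝ 2 w) (hpos : ∀ x, 0 < w x) (hζ : ContDiff ℝ 1 ζ)
    (N : ℕ) (s : ℝ) (b : ℕ) : ContDiff ℝ 1 (testFun w ζ N s b) := by
  have h1 : ContDiff ℝ 1 fun x => w x ^ s :=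
    (hw.of_le (by norm_num)).rpow_const_of_ne fun x => (hpos x).ne'
  exact (hζ.pow N).mul (h1.mul ((contDiff_gradSq hw).pow b))

theorem gradVec_testFun (hw : ContDiff ℝ 2 w) (hpos : ∀ x, 0 < w x) (hζ : ContDiff ℝ 1 ζ)
    (N : ℕ) (s : ℝ) (b : ℕ) (x : EuclideanSpace ℝ (Fin n)) :
    w x • gradVec (testFun w ζ N s b) x =
      (N * ζ x ^ (N - 1) * (w x * w x ^ s * gradSq w x ^ b)) • gradVec ζ x
      + (ζ x ^ N * (s * w x ^ s * gradSq w x ^ b)) • gradVec w x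
      + (ζ x ^ N * w x ^ s * (2 * b * gradSq w x ^ (b - 1))) •
        (w x • (hessMat w x *ᵥ gradVec w x)) := by
  ext i
  have d0 := hasLineDerivAt_partialD (hζ.differentiable (by norm_num) x) i
  have d1 := hasLineDerivAt_partialD (hw.differentiable (by norm_num) x) i
  have d2 := hasDerivAt_gradSq hw x i
  have d3 := hasLineDerivAt_partialD
    ((contDiff_testFun hw hpos hζ N s b).differentiable (by norm_num) x) i
  have d4 := (d0.pow N).mul ((d1.rpow_const (p := s) (Or.inl (by simpa using (hpos x).ne'))).mul
    (d2.pow b))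
  have d5 := d3.unique d4
  have hs : w x * w x ^ (s - 1) = w x ^ s := by
    rw [mul_comm, ← Real.rpow_add_one (hpos x).ne']; simp
  simp only [zero_smul, add_zero, Pi.pow_apply, Pi.mul_apply] at d5
  simp only [Pi.smul_apply, Pi.add_apply, smul_eq_mul, gradVec] at d5 ⊢
  rw [d5]
  linear_combination (ζ x ^ N * partialD w x i * s * gradSq w x ^ b) * hs

/-- The weak divergence identity with the test function `ζ^N w^s |∇w|^{2b}`. The derivative of
`|∇w|^{2b}` produces `T_j(∇w, A ∇w) = σ_{j+1} |∇w|² - T_{j+1}(∇w, ∇w)`. -/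
theorem newtonFlux_testFun (hw : ContDiff ℝ 2 w) (hpos : ∀ x, 0 < w x) (hζ : ContDiff ℝ 1 ζ)
    (N : ℕ) (s : ℝ) (b j : ℕ) (x : EuclideanSpace ℝ (Fin n)) :
    newtonFlux j (testFun w ζ N s b x) (gradVec (testFun w ζ N s b) x) (w x) (gradVec w x)
      (hessMat w x) =
    ζ x ^ N * w x ^ s * ((n + 1 + s + b) * (gradSq w x ^ b *
          (gradVec w x ⬝ᵥ newtonTensor (schouten w x) j *ᵥ gradVec w x))
        + (j + 1 + 2 * b) * (gradSq w x ^ b * matrixSigma (schouten w x) (j + 1))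
        - 1 / 2 * (n - j) * (gradSq w x ^ (b + 1) * matrixSigma (schouten w x) j)
        - 2 * b * (gradSq w x ^ (b - 1) *
          (gradVec w x ⬝ᵥ newtonTensor (schouten w x) (j + 1) *ᵥ gradVec w x)))
      + N * ζ x ^ (N - 1) * (w x * w x ^ s * gradSq w x ^ b) *
        (gradVec ζ x ⬝ᵥ newtonTensor (schouten w x) j *ᵥ gradVec w x) := by
  have hAs : (schouten w x).IsSymm := isSymm_conformalMat (isSymm_hessMat hw x)
  set A := schouten w x with hA
  set g := gradVec w x with hg
  set T := newtonTensor A j with hT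
  have hwH : w x • (hessMat w x *ᵥ g) = A *ᵥ g + (1 / 2 * gradSq w x) • g := by
    rw [hA, schouten, conformalMat, sub_mulVec, smul_mulVec, smul_mulVec, one_mulVec, ← hg,
      gradSq, ← hg]
    abel
  have hAT : (A *ᵥ g) ⬝ᵥ T *ᵥ g =
      matrixSigma A (j + 1) * gradSq w x - g ⬝ᵥ newtonTensor A (j + 1) *ᵥ g := by
    rw [newtonTensor_succ, sub_mulVec, smul_mulVec, one_mulVec, dotProduct_sub, dotProduct_smul,
      ← (commute_newtonTensor A j).eq, ← mulVec_mulVec, dotProduct_mulVec g A, ← mulVec_transpose,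
      hAs.eq, gradSq, smul_eq_mul, ← hT, ← hg]
    ring
  have hgrad := gradVec_testFun hw hpos hζ N s b x
  rw [← hg, hwH] at hgrad
  have hq : w x * (gradVec (testFun w ζ N s b) x ⬝ᵥ T *ᵥ g) =
      (N * ζ x ^ (N - 1) * (w x * w x ^ s * gradSq w x ^ b)) * (gradVec ζ x ⬝ᵥ T *ᵥ g)
      + (ζ x ^ N * (s * w x ^ s * gradSq w x ^ b)) * (g ⬝ᵥ T *ᵥ g)
      + (ζ x ^ N * w x ^ s * (2 * b * gradSq w x ^ (b - 1))) *
        ((matrixSigma A (j + 1) * gradSq w x - g ⬝ᵥ newtonTensor A (j + 1) *ᵥ g)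
          + 1 / 2 * gradSq w x * (g ⬝ᵥ T *ᵥ g)) := by
    rw [← smul_eq_mul, ← smul_dotProduct, hgrad, add_dotProduct, add_dotProduct, smul_dotProduct,
      smul_dotProduct, smul_dotProduct, add_dotProduct, smul_dotProduct, hAT]
    simp only [smul_eq_mul]
  have hb : (b : ℝ) * (gradSq w x ^ (b - 1) * gradSq w x) = b * gradSq w x ^ b := by
    cases b with
    | zero => simp
    | succ b => rw [Nat.add_sub_cancel, pow_succ]
  have hdef : newtonFlux j (testFun w ζ N s b x) (gradVec (testFun w ζ N s b) x) (w x) g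
      (hessMat w x) = testFun w ζ N s b x * ((n + 1) * (g ⬝ᵥ T *ᵥ g)
      + (j + 1) * matrixSigma A (j + 1) - 1 / 2 * (n - j) * matrixSigma A j * gradSq w x)
    + w x * (gradVec (testFun w ζ N s b) x ⬝ᵥ T *ᵥ g) := rfl
  rw [hdef, hq, testFun]
  linear_combination (ζ x ^ N * w x ^ s * (2 * matrixSigma A (j + 1) + g ⬝ᵥ T *ᵥ g)) * hb

theorem hasCompactSupport_testFun (hc : HasCompactSupport ζ) {N : ℕ} (hN : N ≠ 0) (s : ℝ) (b : ℕ) :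
    HasCompactSupport (testFun w ζ N s b) := by
  refine hc.mono fun x hx => ?_
  rw [Function.mem_support] at hx ⊢
  contrapose! hx
  simp [testFun, hx, hN]

/-- A pointwise upper bound for the divergence has nonnegative integral. -/
theorem integral_nonneg_of_newtonFlux_le (hw : ContDiff ℝ 2 w)
    (hwc : HasCompactSupport fun x => w x - 1)
    (hpos : ∀ x, 0 < w x) (hζ : ContDiff ℝ 1 ζ) (hc : HasCompactSupport ζ) {N : ℕ} (hN : N ≠ 0)
    (s : ℝ) (b j : ℕ) {G : EuclideanSpace ℝ (Fin n) → ℝ} (hG : Integrable G)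
    (hle : ∀ x, newtonFlux j (testFun w ζ N s b x) (gradVec (testFun w ζ N s b) x) (w x)
      (gradVec w x) (hessMat w x) ≤ G x) : 0 ≤ ∫ x, G x := by
  have h1 := contDiff_testFun hw hpos hζ N s b
  have h2 := hasCompactSupport_testFun (w := w) hc hN s b
  rw [← integral_newtonFlux hw hwc h1 h2 j]
  exact integral_mono (integrable_newtonFlux hw h1 h2 j) hG hle

end TestFunctions

section Young

/-- A form of Young's inequality with explicit constants. -/
theorem pow_mul_pow_le {x y ε : ℝ} (hx : 0 ≤ x) (hy : 0 ≤ y) (hε : 0 < ε) (hε1 : ε ≤ 1) (a : ℕ)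
    {c : ℕ} (hc : c ≠ 0) : x ^ a * y ^ c ≤ ε * x ^ (a + c) + (1 / ε) ^ a * y ^ (a + c) := by
  rcases le_total y (ε * x) with h | h
  · have h1 : y ^ c ≤ ε * x ^ c := by
      calc y ^ c ≤ (ε * x) ^ c := by gcongr
        _ = ε ^ c * x ^ c := mul_pow _ _ _
        _ ≤ ε * x ^ c := by
          gcongr
          exact pow_le_of_le_one hε.le hε1 hc
    calc x ^ a * y ^ c ≤ x ^ a * (ε * x ^ c) := by gcongr
      _ = ε * x ^ (a + c) := by rw [pow_add]; ring
      _ ≤ _ := le_add_of_nonneg_right (by positivity)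
  · have h1 : x ≤ 1 / ε * y := by
      rw [div_mul_eq_mul_div, one_mul, le_div_iff₀ hε]; linarith
    calc x ^ a * y ^ c ≤ (1 / ε * y) ^ a * y ^ c := by gcongr
      _ = (1 / ε) ^ a * y ^ (a + c) := by rw [mul_pow, pow_add]; ring
      _ ≤ _ := le_add_of_nonneg_left (by positivity)

end Young

end

/-! ### Descent in the degree of the curvature -/

section

open Matrix MeasureTheory Filter Topology

section Caccioppoli

variable {n : ℕ} {w ζ : EuclideanSpace ℝ (Fin n) → ℝ}

/-- The consequences of `λ(A) ∈ closure Γ_k` on the set `S` used in the integral estimates: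
nonnegativity of `σ_j(A)`, `j ≤ k`, and of the Newton tensors `T_j(A)`, `j < k`. -/
structure IsAdmissibleOn (k : ℕ) (S : Set (EuclideanSpace ℝ (Fin n)))
    (w : EuclideanSpace ℝ (Fin n) → ℝ) : Prop where
  sigma_nonneg : ∀ x ∈ S, ∀ j ≤ k, 0 ≤ matrixSigma (schouten w x) j
  posSemidef : ∀ x ∈ S, ∀ j < k, (newtonTensor (schouten w x) j).PosSemidef

/-- `ζ` is a `C¹` cutoff function with values in `[0, 1]`, compact support, vanishing off `S` and
with gradient bounded by `L`. -/
structure IsCutoff (S : Set (EuclideanSpace ℝ (Fin n))) (L : ℝ)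
    (ζ : EuclideanSpace ℝ (Fin n) → ℝ) : Prop where
  contDiff : ContDiff ℝ 1 ζ
  hasCompactSupport : HasCompactSupport ζ
  nonneg : ∀ x, 0 ≤ ζ x
  le_one : ∀ x, ζ x ≤ 1
  eq_zero : ∀ x ∉ S, ζ x = 0
  gradSq_le : ∀ x, gradSq ζ x ≤ L ^ 2

theorem IsAdmissibleOn.quadratic_nonneg {k : ℕ} {S : Set (EuclideanSpace ℝ (Fin n))}
    (h : IsAdmissibleOn k S w) {x : EuclideanSpace ℝ (Fin n)} (hx : x ∈ S) {j : ℕ} (hj : j < k)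
    (g : Fin n → ℝ) : 0 ≤ g ⬝ᵥ newtonTensor (schouten w x) j *ᵥ g := by
  simpa using (h.posSemidef x hx j hj).dotProduct_mulVec_nonneg g

theorem IsAdmissibleOn.abs_bilinear_le {k : ℕ} {S : Set (EuclideanSpace ℝ (Fin n))}
    (h : IsAdmissibleOn k S w) {x : EuclideanSpace ℝ (Fin n)} (hx : x ∈ S) {j : ℕ} (hj : j < k)
    (a b : Fin n → ℝ) : |a ⬝ᵥ newtonTensor (schouten w x) j *ᵥ b| ≤
      (n - j) * matrixSigma (schouten w x) j * (√(a ⬝ᵥ a) * √(b ⬝ᵥ b)) := by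
  rw [← trace_newtonTensor]
  exact (h.posSemidef x hx j hj).abs_dotProduct_mulVec_le a b

theorem IsCutoff.sqrt_gradSq_le {S : Set (EuclideanSpace ℝ (Fin n))} {L : ℝ}
    (h : IsCutoff S L ζ) (hL : 0 ≤ L) (x : EuclideanSpace ℝ (Fin n)) : √(gradSq ζ x) ≤ L :=
  Real.sqrt_le_iff.2 ⟨hL, h.gradSq_le x⟩

theorem energyDensity_nonneg {k : ℕ} {S : Set (EuclideanSpace ℝ (Fin n))} {L : ℝ}
    (h : IsAdmissibleOn k S w) (hpos : ∀ x, 0 < w x) (hζ : IsCutoff S L ζ) {N : ℕ} (hN : N ≠ 0)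
    (s : ℝ) (b : ℕ) {j : ℕ} (hj : j ≤ k) (x : EuclideanSpace ℝ (Fin n)) :
    0 ≤ energyDensity w ζ N s b j x := by
  by_cases hx : x ∈ S
  · have h1 := h.sigma_nonneg x hx j hj
    have h2 := hζ.nonneg x
    have h3 := gradSq_nonneg w x
    have h4 := hpos x
    unfold energyDensity
    positivity
  · simp [energyDensity, hζ.eq_zero x hx, hN]

/-- One step of the descent from `σ_{j+1}` to `σ_j`: with a weight `w^{-γ}`, `γ` large, every main
term in the divergence identity has a favourable sign. -/
theorem energy_descent {j b : ℕ} {S : Set (EuclideanSpace ℝ (Fin n))} {L : ℝ} (hL : 1 ≤ L)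
    (hn : j + 1 + b ≤ n) (h : IsAdmissibleOn (j + 1 + b) S w) (hw : ContDiff ℝ 2 w)
    (hwc : HasCompactSupport fun x => w x - 1) (hpos : ∀ x, 0 < w x) (hζ : IsCutoff S L ζ)
    {γ : ℝ} (hγ : n + 1 + b ≤ γ) :
    ∫ x, energyDensity w ζ (2 * (j + 1 + b) + 2) (-γ) (b + 1) j x ≤
      8 * (j + 1 + b : ℕ) * (∫ x, energyDensity w ζ (2 * (j + 1 + b) + 2) (-γ) b (j + 1) x)
      + 4 * (4 * ((2 * (j + 1 + b) + 2 : ℕ) * L)) ^ (2 * (j + 1 + b)) *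
        ∫ x, energyDensity w ζ (2 * j + 2) (-γ + 2 * (b + 1)) 0 j x := by
  set N := 2 * (j + 1 + b) + 2 with hN
  have hpt : ∀ x, newtonFlux j (testFun w ζ N (-γ) b x) (gradVec (testFun w ζ N (-γ) b) x) (w x)
      (gradVec w x) (hessMat w x) ≤
      (j + 1 + 2 * b) * energyDensity w ζ N (-γ) b (j + 1) x
      - 1 / 4 * (n - j) * energyDensity w ζ N (-γ) (b + 1) j x
      + (n - j) * ((1 / (1 / 4)) ^ (2 * b + 1) * (N * L) ^ (2 * b + 2) *
        energyDensity w ζ (2 * j + 2) (-γ + 2 * (b + 1)) 0 j x) := by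
    intro x
    rw [newtonFlux_testFun hw hpos hζ.contDiff]
    by_cases hx : x ∈ S
    · have hwx := hpos x
      have hζx := hζ.nonneg x
      have hq := gradSq_nonneg w x
      have hσ := h.sigma_nonneg x hx j (by omega)
      have hws : 0 ≤ w x ^ (-γ) := (Real.rpow_pos_of_pos hwx _).le
      have hnj : (0 : ℝ) ≤ n - j := by
        have : (j : ℝ) ≤ n := by exact_mod_cast (by omega : j ≤ n)
        linarith
      set p := √(gradSq w x) with hp
      have hpp : p ^ 2 = gradSq w x := Real.sq_sqrt hq
      have hp0 : 0 ≤ p := Real.sqrt_nonneg _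
      -- The two quadratic forms have a favourable sign, the first because `γ ≥ n + 1 + b`.
      have t1 : (n + 1 + -γ + b) * (gradSq w x ^ b *
          (gradVec w x ⬝ᵥ newtonTensor (schouten w x) j *ᵥ gradVec w x)) ≤ 0 :=
        mul_nonpos_of_nonpos_of_nonneg (by linarith)
          (mul_nonneg (pow_nonneg hq _) (h.quadratic_nonneg hx (by omega) _))
      have t2 : 0 ≤ 2 * b * (gradSq w x ^ (b - 1) *
          (gradVec w x ⬝ᵥ newtonTensor (schouten w x) (j + 1) *ᵥ gradVec w x)) := by
        rcases Nat.eq_zero_or_pos b with rfl | hb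
        · simp
        · exact mul_nonneg (by positivity)
            (mul_nonneg (pow_nonneg hq _) (h.quadratic_nonneg hx (by omega) _))
      have t3 : gradVec ζ x ⬝ᵥ newtonTensor (schouten w x) j *ᵥ gradVec w x ≤
          (n - j) * matrixSigma (schouten w x) j * (L * p) := by
        refine (le_abs_self _).trans ((h.abs_bilinear_le hx (by omega) _ _).trans ?_)
        gcongr
        · exact hζ.sqrt_gradSq_le (by linarith) x
        · exact le_rfl
      -- With weight `1/4`, half of the gradient term on the left survives the absorption.
      have t4 := pow_mul_pow_le (x := ζ x * p) (y := N * L * w x) (ε := 1 / 4) (by positivity)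
        (by positivity) (by norm_num) (by norm_num) (2 * b + 1) one_ne_zero
      have e1 : energyDensity w ζ N (-γ) (b + 1) j x =
          ζ x ^ (2 * j + 2) * w x ^ (-γ) * matrixSigma (schouten w x) j *
            (ζ x * p) ^ (2 * b + 1 + 1) := by
        rw [energyDensity, hN, ← hpp]; ring
      have e2 : energyDensity w ζ (2 * j + 2) (-γ + 2 * (b + 1)) 0 j x =
          ζ x ^ (2 * j + 2) * w x ^ (-γ) * matrixSigma (schouten w x) j * w x ^ (2 * b + 2) := by
        have : w x ^ (-γ + 2 * (b + 1)) = w x ^ (-γ) * w x ^ (2 * b + 2) := by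
          rw [← Real.rpow_add_natCast hwx.ne']; push_cast; ring_nf
        rw [energyDensity, this]; ring
      have e3 : energyDensity w ζ N (-γ) b (j + 1) x = ζ x ^ N * w x ^ (-γ) *
          (gradSq w x ^ b * matrixSigma (schouten w x) (j + 1)) := by
        rw [energyDensity]; ring
      have e4 : energyDensity w ζ N (-γ) (b + 1) j x = ζ x ^ N * w x ^ (-γ) *
          (gradSq w x ^ (b + 1) * matrixSigma (schouten w x) j) := by
        rw [energyDensity]; ring
      have t5 : N * ζ x ^ (N - 1) * (w x * w x ^ (-γ) * gradSq w x ^ b) *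
          (gradVec ζ x ⬝ᵥ newtonTensor (schouten w x) j *ᵥ gradVec w x) ≤
          (n - j) * (1 / 4 * energyDensity w ζ N (-γ) (b + 1) j x
            + (1 / (1 / 4)) ^ (2 * b + 1) * (N * L) ^ (2 * b + 2) *
              energyDensity w ζ (2 * j + 2) (-γ + 2 * (b + 1)) 0 j x) := by
        calc _ ≤ N * ζ x ^ (N - 1) * (w x * w x ^ (-γ) * gradSq w x ^ b) *
              ((n - j) * matrixSigma (schouten w x) j * (L * p)) := by gcongr
          _ = (n - j) * (ζ x ^ (2 * j + 2) * w x ^ (-γ) * matrixSigma (schouten w x) j *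
              ((ζ x * p) ^ (2 * b + 1) * (N * L * w x) ^ 1)) := by
            have : N - 1 = 2 * j + 2 + (2 * b + 1) := by omega
            rw [this, ← hpp]; ring
          _ ≤ (n - j) * (ζ x ^ (2 * j + 2) * w x ^ (-γ) * matrixSigma (schouten w x) j *
              (1 / 4 * (ζ x * p) ^ (2 * b + 1 + 1)
                + (1 / (1 / 4)) ^ (2 * b + 1) * (N * L * w x) ^ (2 * b + 1 + 1))) := by gcongr
          _ = _ := by rw [e1, e2]; ring
      have t6 : ζ x ^ N * w x ^ (-γ) * ((n + 1 + -γ + b) * (gradSq w x ^ b *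
          (gradVec w x ⬝ᵥ newtonTensor (schouten w x) j *ᵥ gradVec w x))
        + (j + 1 + 2 * b) * (gradSq w x ^ b * matrixSigma (schouten w x) (j + 1))
        - 1 / 2 * (n - j) * (gradSq w x ^ (b + 1) * matrixSigma (schouten w x) j)
        - 2 * b * (gradSq w x ^ (b - 1) *
          (gradVec w x ⬝ᵥ newtonTensor (schouten w x) (j + 1) *ᵥ gradVec w x))) ≤
          (j + 1 + 2 * b) * energyDensity w ζ N (-γ) b (j + 1) x
          - 1 / 2 * (n - j) * energyDensity w ζ N (-γ) (b + 1) j x := by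
        rw [e3, e4]
        have : 0 ≤ ζ x ^ N * w x ^ (-γ) := by positivity
        nlinarith [mul_nonneg this t2, mul_nonneg this (neg_nonneg.2 t1)]
      linarith
    · have hz := hζ.eq_zero x hx
      have hN1 : N - 1 ≠ 0 := by omega
      have hN0 : N ≠ 0 := by omega
      simp [energyDensity, hz, hN1, hN0]
  have hi1 : Integrable (energyDensity w ζ N (-γ) b (j + 1)) :=
    integrable_energyDensity hw hpos hζ.contDiff hζ.hasCompactSupport (by omega) _ _ _
  have hi2 : Integrable (energyDensity w ζ N (-γ) (b + 1) j) :=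
    integrable_energyDensity hw hpos hζ.contDiff hζ.hasCompactSupport (by omega) _ _ _
  have hi3 : Integrable (energyDensity w ζ (2 * j + 2) (-γ + 2 * (b + 1)) 0 j) :=
    integrable_energyDensity hw hpos hζ.contDiff hζ.hasCompactSupport (by omega) _ _ _
  have hi4 : Integrable fun x => (j + 1 + 2 * b) * energyDensity w ζ N (-γ) b (j + 1) x
      - 1 / 4 * (n - j) * energyDensity w ζ N (-γ) (b + 1) j x :=
    (hi1.const_mul _).sub (hi2.const_mul _)
  have hi5 := (hi3.const_mul ((1 / (1 / 4)) ^ (2 * b + 1) * (N * L) ^ (2 * b + 2))).const_mul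
    (n - j : ℝ)
  have hle := integral_nonneg_of_newtonFlux_le hw hwc hpos hζ.contDiff hζ.hasCompactSupport
    (by omega : N ≠ 0) (-γ) b j (hi4.add hi5) hpt
  simp only [Pi.add_apply] at hle
  rw [integral_add hi4 hi5,
    integral_sub (hi1.const_mul _) (hi2.const_mul _), integral_const_mul, integral_const_mul,
    integral_const_mul, integral_const_mul] at hle
  have p1 : 0 ≤ ∫ x, energyDensity w ζ N (-γ) b (j + 1) x :=
    integral_nonneg fun x => energyDensity_nonneg h hpos hζ (by omega) _ _ (by omega) x
  have p3 : 0 ≤ ∫ x, energyDensity w ζ (2 * j + 2) (-γ + 2 * (b + 1)) 0 j x :=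
    integral_nonneg fun x => energyDensity_nonneg h hpos hζ (by omega) _ _ (by omega) x
  set X1 := ∫ x, energyDensity w ζ N (-γ) b (j + 1) x
  set X0 := ∫ x, energyDensity w ζ N (-γ) (b + 1) j x
  set R := ∫ x, energyDensity w ζ (2 * j + 2) (-γ + 2 * (b + 1)) 0 j x
  have hnj : (1 : ℝ) ≤ n - j := by
    have : (j : ℝ) + 1 ≤ n := by exact_mod_cast (by omega : j + 1 ≤ n)
    linarith
  have hNL : (1 : ℝ) ≤ N * L := by
    have : (1 : ℝ) ≤ N := by exact_mod_cast (by omega : 1 ≤ N)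
    nlinarith
  have c1 : ((1 / (1 / 4) : ℝ)) ^ (2 * b + 1) * (N * L) ^ (2 * b + 2) ≤
      (4 * (N * L)) ^ (2 * (j + 1 + b)) := by
    rw [mul_pow (4 : ℝ)]
    have e : (1 / (1 / 4) : ℝ) = 4 := by norm_num
    rw [e]
    gcongr
    · norm_num
    · omega
    · omega
  set C1 := ((1 / (1 / 4) : ℝ)) ^ (2 * b + 1) * (N * L) ^ (2 * b + 2) with hC1
  have e1 : 1 / 4 * (n - j) * X0 ≤ (n - j) * (2 * (j + 1 + b : ℕ) * X1 + C1 * R) := by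
    have : (j + 1 + 2 * b : ℝ) * X1 ≤ (n - j) * (2 * (j + 1 + b : ℕ) * X1) := by
      have : (j + 1 + 2 * b : ℝ) * X1 ≤ 2 * (j + 1 + b : ℕ) * X1 := by
        gcongr; push_cast; linarith [(Nat.cast_nonneg j : (0 : ℝ) ≤ j)]
      have h3 : 0 ≤ 2 * ((j + 1 + b : ℕ) : ℝ) * X1 := by positivity
      nlinarith
    linarith
  have e2 : 1 / 4 * X0 ≤ 2 * (j + 1 + b : ℕ) * X1 + C1 * R :=
    le_of_mul_le_mul_left (by linarith) (by linarith : (0 : ℝ) < n - j)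
  have e3 : C1 * R ≤ (4 * (N * L)) ^ (2 * (j + 1 + b)) * R := by gcongr
  linarith

end Caccioppoli

end

/-! ### Energies of lower order and their absorption -/

section

open Matrix MeasureTheory Filter Topology

section LowerOrder

variable {n : ℕ} {w ζ : EuclideanSpace ℝ (Fin n) → ℝ}

theorem lower_order_scalar {x y : ℝ} (a b : ℝ) (ha : 0 ≤ a) (hb : 0 ≤ b) :
    2 * x ^ 2 + (2 * a + 4) * (x * y) ≤ (2 * a + 6 + 2 * b) * (x ^ 2 + y ^ 2) := by
  have h1 : x * y ≤ x ^ 2 + y ^ 2 := by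
    linarith [two_mul_le_add_sq x y, sq_nonneg x, sq_nonneg y]
  have h2 := mul_le_mul_of_nonneg_left h1 (by positivity : 0 ≤ 2 * a + 4)
  have h3 : 0 ≤ b * (x ^ 2 + y ^ 2) := by positivity
  have h4 : (2 * a + 6 + 2 * b) * (x ^ 2 + y ^ 2) =
      2 * x ^ 2 + (2 * a + 4) * (x ^ 2 + y ^ 2) + 2 * y ^ 2 + 2 * (b * (x ^ 2 + y ^ 2)) := by ring
  rw [h4]
  linarith [sq_nonneg y]

/-- The negative of the flux with the test function `ζ ^ (2j + 4) w ^ s`, without gradient factor.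
The term with `σ_{j+1}` has a sign; the others carry `σ_j` and are split by Young's inequality. -/
theorem newtonFlux_lower_order_le {j b : ℕ} (hb : b ≠ 0) {S : Set (EuclideanSpace ℝ (Fin n))}
    {L : ℝ} (hn : j + 1 + b ≤ n) (h : IsAdmissibleOn (j + 1 + b) S w) (hw : ContDiff ℝ 2 w)
    (hpos : ∀ x, 0 < w x) (hζ : IsCutoff S L ζ) {γ Λ K ε s : ℝ} (hL0 : 0 ≤ L) (hL : L ≤ Λ)
    (h1 : 1 ≤ Λ) (hs : s = -γ + 2 * b) (hγ : |n + 1 + s| ≤ Λ)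
    (hK : K = n * (2 * j + 6 + 2 * b)) (hε0 : 0 < ε) (hε1 : ε ≤ 1)
    (x : EuclideanSpace ℝ (Fin n)) :
    newtonFlux j (testFun w ζ (2 * (j + 1) + 2) s 0 x)
      (gradVec (testFun w ζ (2 * (j + 1) + 2) s 0) x) (w x) (gradVec w x) (hessMat w x) * (-1) ≤
      K * Λ * ε * energyDensity w ζ (2 * (j + 1 + b) + 2) (-γ) (b + 1) j x
      + K * Λ * ((1 / ε) ^ 2 + 1) * energyDensity w ζ (2 * j + 2) (-γ + 2 * (b + 1)) 0 j x
      - (j + 1) * energyDensity w ζ (2 * (j + 1) + 2) s 0 (j + 1) x := by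
  have hn0 : (0 : ℝ) ≤ n := Nat.cast_nonneg n
  have hΛ : 0 < Λ := by linarith
  have hK0 : 0 ≤ K := by rw [hK]; positivity
  rw [newtonFlux_testFun hw hpos hζ.contDiff]
  by_cases hx : x ∈ S
  · have hwx := hpos x
    have hζx := hζ.nonneg x
    have hq := gradSq_nonneg w x
    have hσ := h.sigma_nonneg x hx j (by omega)
    have hws : 0 ≤ w x ^ s := (Real.rpow_pos_of_pos hwx _).le
    have hwγ : 0 ≤ w x ^ (-γ) := (Real.rpow_pos_of_pos hwx _).le
    have hjn : (j : ℝ) ≤ n := by exact_mod_cast (by omega : j ≤ n)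
    have hnj : (0 : ℝ) ≤ n - j := by linarith
    have hnj' : (n - j : ℝ) ≤ n := by linarith [(Nat.cast_nonneg j : (0 : ℝ) ≤ j)]
    set p := √(gradSq w x) with hp
    have hpp : p ^ 2 = gradSq w x := Real.sq_sqrt hq
    have hp0 : 0 ≤ p := Real.sqrt_nonneg _
    have hgg : √(gradVec w x ⬝ᵥ gradVec w x) * √(gradVec w x ⬝ᵥ gradVec w x) = p ^ 2 := by
      rw [sq]; rfl
    set Q := gradVec w x ⬝ᵥ newtonTensor (schouten w x) j *ᵥ gradVec w x with hQ
    set V := gradVec ζ x ⬝ᵥ newtonTensor (schouten w x) j *ᵥ gradVec w x with hV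
    set σ := matrixSigma (schouten w x) j with hσd
    have t1 : -((n + 1 + s) * Q) ≤ Λ * (n * σ * p ^ 2) := by
      have a1 : |Q| ≤ n * σ * p ^ 2 := by
        have := h.abs_bilinear_le hx (j := j) (by omega) (gradVec w x) (gradVec w x)
        rw [hgg] at this
        refine this.trans ?_
        gcongr
      calc -((n + 1 + s) * Q) ≤ |(n + 1 + s) * Q| := neg_le_abs _
        _ = |n + 1 + s| * |Q| := abs_mul _ _
        _ ≤ Λ * (n * σ * p ^ 2) := by gcongr
    have t3 : -V ≤ n * σ * (Λ * p) := by
      refine (neg_le_abs _).trans ((h.abs_bilinear_le hx (by omega) _ _).trans ?_)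
      gcongr
      · exact (hζ.sqrt_gradSq_le hL0 x).trans hL
      · exact le_rfl
    have t4 := pow_mul_pow_le (x := ζ x * p) (y := w x) (ε := ε) (by positivity)
      hwx.le hε0 hε1 2 (c := 2 * b) (by omega)
    set c := ζ x ^ (2 * j + 2) * w x ^ (-γ) * σ with hc
    have hc0 : 0 ≤ c := by positivity
    have hsb : w x ^ s = w x ^ (-γ) * w x ^ (2 * b) := by
      rw [← Real.rpow_add_natCast hwx.ne', hs]; push_cast; ring_nf
    have e1 : energyDensity w ζ (2 * (j + 1 + b) + 2) (-γ) (b + 1) j x =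
        c * (ζ x * p) ^ (2 + 2 * b) := by
      rw [energyDensity, ← hpp]; ring
    have e2 : energyDensity w ζ (2 * j + 2) (-γ + 2 * (b + 1)) 0 j x =
        c * w x ^ (2 + 2 * b) := by
      have : w x ^ (-γ + 2 * (b + 1)) = w x ^ (-γ) * w x ^ (2 + 2 * b) := by
        rw [← Real.rpow_add_natCast hwx.ne']; push_cast; ring_nf
      rw [energyDensity, this]; ring
    have e3 : energyDensity w ζ (2 * (j + 1) + 2) s 0 (j + 1) x = ζ x ^ (2 * j + 4) * w x ^ s *
        matrixSigma (schouten w x) (j + 1) := by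
      rw [energyDensity]; ring
    rw [e1, e2, e3]
    have hz : 0 ≤ ζ x ^ (2 * j + 4) * w x ^ s := by positivity
    have hz' : 0 ≤ (2 * j + 4) * ζ x ^ (2 * j + 3) * (w x * w x ^ s) := by positivity
    have u1 : -(ζ x ^ (2 * j + 4) * w x ^ s * ((n + 1 + s) * Q)) ≤
        ζ x ^ (2 * j + 4) * w x ^ s * (Λ * (n * σ * p ^ 2)) := by
      rw [← mul_neg]; gcongr
    have u2 : -((2 * j + 4) * ζ x ^ (2 * j + 3) * (w x * w x ^ s) * V) ≤
        (2 * j + 4) * ζ x ^ (2 * j + 3) * (w x * w x ^ s) * (n * σ * (Λ * p)) := by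
      rw [← mul_neg]; gcongr
    have u3 : ζ x ^ (2 * j + 4) * w x ^ s * (1 / 2 * (n - j) * (p ^ 2 * σ)) ≤
        ζ x ^ (2 * j + 4) * w x ^ s * (Λ * (n * σ * p ^ 2)) := by
      have : 1 / 2 * (n - j) * (p ^ 2 * σ) ≤ Λ * (n * σ * p ^ 2) := by
        calc 1 / 2 * (n - j) * (p ^ 2 * σ) ≤ Λ * n * (p ^ 2 * σ) := by
              gcongr; linarith
          _ = _ := by ring
      gcongr
    have u5 : ζ x ^ (2 * j + 4) * w x ^ s * (Λ * (n * σ * p ^ 2)) +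
        ζ x ^ (2 * j + 4) * w x ^ s * (Λ * (n * σ * p ^ 2)) +
        (2 * j + 4) * ζ x ^ (2 * j + 3) * (w x * w x ^ s) * (n * σ * (Λ * p)) ≤
        K * Λ * (c * ((ζ x * p) ^ 2 * w x ^ (2 * b))) + K * Λ * (c * w x ^ (2 + 2 * b)) := by
      have a1 : ζ x ^ (2 * j + 4) * w x ^ s * (Λ * (n * σ * p ^ 2)) +
        ζ x ^ (2 * j + 4) * w x ^ s * (Λ * (n * σ * p ^ 2)) +
        (2 * j + 4) * ζ x ^ (2 * j + 3) * (w x * w x ^ s) * (n * σ * (Λ * p)) =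
        n * Λ * c * w x ^ (2 * b) * (2 * (ζ x * p) ^ 2 + (2 * j + 4) * (ζ x * p * w x)) := by
        rw [hsb, hc]; ring
      have a2 : K * Λ * (c * ((ζ x * p) ^ 2 * w x ^ (2 * b))) + K * Λ * (c * w x ^ (2 + 2 * b)) =
          n * Λ * c * w x ^ (2 * b) * ((2 * j + 6 + 2 * b) * ((ζ x * p) ^ 2 + w x ^ 2)) := by
        rw [hK]; ring
      rw [a1, a2]
      exact mul_le_mul_of_nonneg_left (lower_order_scalar _ _ (Nat.cast_nonneg j)
        (Nat.cast_nonneg b)) (by positivity)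
    have u6 : K * Λ * (c * ((ζ x * p) ^ 2 * w x ^ (2 * b))) ≤
        K * Λ * (c * (ε * (ζ x * p) ^ (2 + 2 * b) + (1 / ε) ^ 2 * w x ^ (2 + 2 * b))) := by
      gcongr
    have hN1 : 2 * (j + 1) + 2 = 2 * j + 4 := by ring
    have hN2 : 2 * (j + 1) + 2 - 1 = 2 * j + 3 := by omega
    rw [hN2, hN1]
    simp only [pow_zero, CharP.cast_eq_zero, zero_add, pow_one, one_mul, mul_zero, add_zero,
      zero_mul, sub_zero, mul_one]
    rw [← hpp]
    push_cast
    linarith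
  · have hz := hζ.eq_zero x hx
    simp [energyDensity, hz]

/-- The energies without gradient factor are controlled by those of lower order in the curvature, up
to a small multiple of an energy with gradient factor. -/
theorem energy_lower_order {j b : ℕ} (hb : b ≠ 0) {S : Set (EuclideanSpace ℝ (Fin n))} {L : ℝ}
    (hn : j + 1 + b ≤ n) (h : IsAdmissibleOn (j + 1 + b) S w) (hw : ContDiff ℝ 2 w)
    (hwc : HasCompactSupport fun x => w x - 1) (hpos : ∀ x, 0 < w x) (hζ : IsCutoff S L ζ)
    {γ Λ : ℝ} (hL0 : 0 ≤ L) (hL : L ≤ Λ) (h1 : 1 ≤ Λ) (hγ : |n + 1 + (-γ + 2 * b)| ≤ Λ) :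
    ∫ x, energyDensity w ζ (2 * (j + 1) + 2) (-γ + 2 * b) 0 (j + 1) x ≤
      (∫ x, energyDensity w ζ (2 * (j + 1 + b) + 2) (-γ) (b + 1) j x) / Λ
      + 2 * (n * (2 * (j + 1 + b) + 4) : ℕ) ^ 3 * Λ ^ 5 *
        ∫ x, energyDensity w ζ (2 * j + 2) (-γ + 2 * (b + 1)) 0 j x := by
  set K : ℝ := ((n * (2 * (j + 1 + b) + 4) : ℕ) : ℝ) with hK
  have hK1 : 1 ≤ K := by
    rw [hK]; exact_mod_cast Nat.mul_pos (by omega) (by omega)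
  -- This `ε` turns the coefficient `K * Λ * ε` into `1 / Λ`.
  set ε : ℝ := 1 / (K * Λ ^ 2) with hε
  have hΛ : 0 < Λ := by linarith
  have hε0 : 0 < ε := by positivity
  have hε1 : ε ≤ 1 := by
    rw [hε, div_le_one (by positivity)]
    nlinarith [one_le_pow₀ (n := 2) h1]
  have hn0 : (0 : ℝ) ≤ n := Nat.cast_nonneg n
  set s : ℝ := -γ + 2 * b with hs
  have hpt : ∀ x, newtonFlux j (testFun w ζ (2 * (j + 1) + 2) s 0 x)
      (gradVec (testFun w ζ (2 * (j + 1) + 2) s 0) x) (w x) (gradVec w x) (hessMat w x) * (-1) ≤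
      K * Λ * ε * energyDensity w ζ (2 * (j + 1 + b) + 2) (-γ) (b + 1) j x
      + K * Λ * ((1 / ε) ^ 2 + 1) * energyDensity w ζ (2 * j + 2) (-γ + 2 * (b + 1)) 0 j x
      - (j + 1) * energyDensity w ζ (2 * (j + 1) + 2) s 0 (j + 1) x := fun x =>
    newtonFlux_lower_order_le hb hn h hw hpos hζ hL0 hL h1 hs hγ
      (by rw [hK]; push_cast; ring) hε0 hε1 x
  have hi1 : Integrable (energyDensity w ζ (2 * (j + 1 + b) + 2) (-γ) (b + 1) j) :=
    integrable_energyDensity hw hpos hζ.contDiff hζ.hasCompactSupport (by omega) _ _ _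
  have hi2 : Integrable (energyDensity w ζ (2 * j + 2) (-γ + 2 * (b + 1)) 0 j) :=
    integrable_energyDensity hw hpos hζ.contDiff hζ.hasCompactSupport (by omega) _ _ _
  have hi3 : Integrable (energyDensity w ζ (2 * (j + 1) + 2) s 0 (j + 1)) :=
    integrable_energyDensity hw hpos hζ.contDiff hζ.hasCompactSupport (by omega) _ _ _
  have hle : 0 ≤ K * Λ * ε * (∫ x, energyDensity w ζ (2 * (j + 1 + b) + 2) (-γ) (b + 1) j x)
      + K * Λ * ((1 / ε) ^ 2 + 1) *
        (∫ x, energyDensity w ζ (2 * j + 2) (-γ + 2 * (b + 1)) 0 j x)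
      - (j + 1) * ∫ x, energyDensity w ζ (2 * (j + 1) + 2) s 0 (j + 1) x := by
    have hi4 : Integrable fun x =>
        K * Λ * ε * energyDensity w ζ (2 * (j + 1 + b) + 2) (-γ) (b + 1) j x
        + K * Λ * ((1 / ε) ^ 2 + 1) * energyDensity w ζ (2 * j + 2) (-γ + 2 * (b + 1)) 0 j x :=
      (hi1.const_mul _).add (hi2.const_mul _)
    have hi5 := hi3.const_mul (j + 1 : ℝ)
    have c1 := contDiff_testFun hw hpos hζ.contDiff (2 * (j + 1) + 2) s 0
    have c2 := hasCompactSupport_testFun (w := w) hζ.hasCompactSupport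
      (by omega : 2 * (j + 1) + 2 ≠ 0) s 0
    have h0 := integral_newtonFlux hw hwc c1 c2 j
    have hmono := integral_mono ((integrable_newtonFlux hw c1 c2 j).mul_const (-1))
      (hi4.sub hi5) hpt
    rw [integral_mul_const, h0, zero_mul] at hmono
    simp only [Pi.sub_apply] at hmono
    rwa [integral_sub hi4 hi5, integral_add (hi1.const_mul _) (hi2.const_mul _),
      integral_const_mul, integral_const_mul, integral_const_mul] at hmono
  have p2 : 0 ≤ ∫ x, energyDensity w ζ (2 * j + 2) (-γ + 2 * (b + 1)) 0 j x :=
    integral_nonneg fun x => energyDensity_nonneg h hpos hζ (by omega) _ _ (by omega) x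
  have p3 : 0 ≤ ∫ x, energyDensity w ζ (2 * (j + 1) + 2) s 0 (j + 1) x :=
    integral_nonneg fun x => energyDensity_nonneg h hpos hζ (by omega) _ _ (by omega) x
  set X0 := ∫ x, energyDensity w ζ (2 * (j + 1 + b) + 2) (-γ) (b + 1) j x
  set R0 := ∫ x, energyDensity w ζ (2 * j + 2) (-γ + 2 * (b + 1)) 0 j x
  set R1 := ∫ x, energyDensity w ζ (2 * (j + 1) + 2) s 0 (j + 1) x
  have f1 : K * Λ * ε = 1 / Λ := by rw [hε]; field_simp
  have f2 : K * Λ * ((1 / ε) ^ 2 + 1) ≤ 2 * K ^ 3 * Λ ^ 5 := by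
    have : 1 / ε = K * Λ ^ 2 := by rw [hε]; field_simp
    rw [this]
    have h3 : 1 ≤ (K * Λ ^ 2) ^ 2 := one_le_pow₀ (one_le_mul_of_one_le_of_one_le hK1
      (one_le_pow₀ h1))
    calc K * Λ * ((K * Λ ^ 2) ^ 2 + 1) ≤ K * Λ * ((K * Λ ^ 2) ^ 2 + (K * Λ ^ 2) ^ 2) := by gcongr
      _ = _ := by ring
  have f3 : R1 ≤ (j + 1) * R1 := by nlinarith [(Nat.cast_nonneg j : (0 : ℝ) ≤ j)]
  rw [f1] at hle
  have f4 := mul_le_mul_of_nonneg_right f2 p2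
  have f5 : 1 / Λ * X0 = X0 / Λ := by ring
  linarith

end LowerOrder

section Absorption

/-- Iteration of `energy_lower_order`, for sequences: `X j` stands for the energies with gradient
factor and `R j` for those without. The coefficient of the energies `X i` can be made as small as
desired, at a polynomial cost in front of `R 0`. -/
theorem exists_lower_order_bound (C : ℝ) (hC : 1 ≤ C) (k : ℕ) : ∀ j < k, ∃ D : ℝ, 1 ≤ D ∧ ∃ N : ℕ,
    ∀ (X R : ℕ → ℝ) (Λ₀ : ℝ), 1 ≤ Λ₀ → (∀ j, 0 ≤ R j) → (∀ j, 0 ≤ X j) →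
      (∀ Λ, Λ₀ ≤ Λ → ∀ j, j + 1 < k → R (j + 1) ≤ X j / Λ + C * Λ ^ 5 * R j) →
      ∀ Λ, Λ₀ ≤ Λ → R j ≤ (∑ i ∈ Finset.range k, X i) / Λ + D * Λ ^ N * R 0 := by
  intro j
  induction j with
  | zero =>
    intro _
    refine ⟨1, le_rfl, 0, fun X R Λ₀ h0 hR hX _ Λ hΛ => ?_⟩
    have : 0 ≤ (∑ i ∈ Finset.range k, X i) / Λ :=
      div_nonneg (Finset.sum_nonneg fun i _ => hX i) (by linarith)
    simpa using this
  | succ j ih =>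
    intro hj
    obtain ⟨D, hD, N, ih⟩ := ih (by omega)
    refine ⟨32 * C * D * (64 * C) ^ N, ?_, 5 + 6 * N, fun X R Λ₀ h0 hR hX h Λ hΛ => ?_⟩
    · have h1 : 1 ≤ (64 * C) ^ N := one_le_pow₀ (by linarith)
      have h2 : 1 ≤ 32 * C * D := by nlinarith
      nlinarith
    · have hΛ1 : 1 ≤ Λ := h0.trans hΛ
      have hΛ0 : 0 < Λ := by linarith
      have hC0 : 0 < C := by linarith
      -- The parameters are chosen to make each of the two contributions equal to `S / (2 * Λ)`.
      have a1 := h (2 * Λ) (by linarith) j hj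
      have hΛ' : Λ₀ ≤ 64 * C * Λ ^ 6 := by
        have : Λ ≤ Λ ^ 6 := le_self_pow₀ hΛ1 (by norm_num)
        have h6 : 0 ≤ Λ ^ 6 := by positivity
        nlinarith
      have a2 := ih X R Λ₀ h0 hR hX h _ hΛ'
      set S := ∑ i ∈ Finset.range k, X i with hS
      have hXS : X j ≤ S := Finset.single_le_sum (fun i _ => hX i) (Finset.mem_range.2 (by omega))
      calc R (j + 1) ≤ X j / (2 * Λ) + C * (2 * Λ) ^ 5 * R j := a1
        _ ≤ S / (2 * Λ) + C * (2 * Λ) ^ 5 *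
            (S / (64 * C * Λ ^ 6) + D * (64 * C * Λ ^ 6) ^ N * R 0) := by gcongr
        _ = S / Λ + 32 * C * D * (64 * C) ^ N * Λ ^ (5 + 6 * N) * R 0 := by
          rw [mul_pow (64 * C), ← pow_mul, pow_add]
          field_simp
          ring

/-- The absorption argument behind the Caccioppoli inequality: `energy_lower_order` and
`energy_descent`, which are the two hypotheses on the sequences, together bound `X 0` by `X k` and
`R 0` with a constant that is polynomial in `Λ₀`. -/
theorem exists_absorption_bound (C : ℝ) (hC : 1 ≤ C) (k : ℕ) (hk : 1 ≤ k) :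
    ∃ D : ℝ, 1 ≤ D ∧ ∃ N : ℕ,
    ∀ (X R : ℕ → ℝ) (Λ₀ : ℝ), 1 ≤ Λ₀ → (∀ j, 0 ≤ R j) → (∀ j, 0 ≤ X j) →
      (∀ Λ, Λ₀ ≤ Λ → ∀ j, j + 1 < k → R (j + 1) ≤ X j / Λ + C * Λ ^ 5 * R j) →
      (∀ j < k, X j ≤ C * (X (j + 1) + Λ₀ ^ (2 * k) * R j)) →
      X 0 ≤ D * Λ₀ ^ N * (X k + R 0) := by
  choose! D hD N hDN using exists_lower_order_bound C hC k
  set D' := ∑ j ∈ Finset.range k, D j with hD'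
  set N' := ∑ j ∈ Finset.range k, N j with hN'
  set c := (k : ℝ) * (2 * C) ^ k with hc
  have hk1 : (1 : ℝ) ≤ k := by exact_mod_cast hk
  have hC2 : 1 ≤ (2 * C) ^ k := one_le_pow₀ (by linarith)
  have hc1 : 1 ≤ c := by rw [hc]; nlinarith
  have hD'1 : 1 ≤ D' := (hD 0 (by omega)).trans
    (Finset.single_le_sum (f := D) (fun i hi => (zero_le_one.trans (hD i (Finset.mem_range.1 hi))))
      (Finset.mem_range.2 (by omega)))
  refine ⟨2 * c * k * D' * (2 * k * c) ^ N', ?_, 2 * k + 2 * k * N', ?_⟩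
  · have h1 : 1 ≤ (2 * k * c) ^ N' := one_le_pow₀ (by nlinarith)
    have h2 : 1 ≤ 2 * c * k := by nlinarith
    have h3 : 1 ≤ 2 * c * k * D' := by nlinarith
    nlinarith
  · intro X R Λ₀ h0 hR hX hlow hdesc
    set S := ∑ i ∈ Finset.range k, X i with hS
    set Q := ∑ i ∈ Finset.range k, R i with hQ
    have hQ0 : 0 ≤ Q := Finset.sum_nonneg fun i _ => hR i
    have hS0 : 0 ≤ S := Finset.sum_nonneg fun i _ => hX i
    have hΛk : 1 ≤ Λ₀ ^ (2 * k) := one_le_pow₀ h0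
    set M := X k + Λ₀ ^ (2 * k) * Q with hM
    have hM0 : 0 ≤ M := add_nonneg (hX k) (by positivity)
    have hXi : ∀ i ≤ k, X (k - i) ≤ (2 * C) ^ i * M := by
      intro i
      induction i with
      | zero => intro _; simp only [Nat.sub_zero, pow_zero, one_mul, hM]
                exact le_add_of_nonneg_right (by positivity)
      | succ i ih =>
        intro hi
        have a := hdesc (k - (i + 1)) (by omega)
        have e : k - (i + 1) + 1 = k - i := by omega
        rw [e] at a
        have b : Λ₀ ^ (2 * k) * R (k - (i + 1)) ≤ M := by
          have : R (k - (i + 1)) ≤ Q :=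
            Finset.single_le_sum (fun i _ => hR i) (Finset.mem_range.2 (by omega))
          have : Λ₀ ^ (2 * k) * R (k - (i + 1)) ≤ Λ₀ ^ (2 * k) * Q := by gcongr
          linarith [hX k]
        have h1 : 1 ≤ (2 * C) ^ i := one_le_pow₀ (by linarith)
        calc X (k - (i + 1)) ≤ C * ((2 * C) ^ i * M + M) := a.trans (by gcongr; exact ih (by omega))
          _ ≤ C * ((2 * C) ^ i * M + (2 * C) ^ i * M) := by
            gcongr; exact le_mul_of_one_le_left hM0 h1
          _ = (2 * C) ^ (i + 1) * M := by ring
    have hSM : S ≤ c * M := by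
      have : ∀ i ∈ Finset.range k, X i ≤ (2 * C) ^ k * M := by
        intro i hi
        have hi' := Finset.mem_range.1 hi
        have a := hXi (k - i) (by omega)
        rw [Nat.sub_sub_self hi'.le] at a
        refine a.trans ?_
        gcongr
        · linarith
        · omega
      calc S ≤ ∑ i ∈ Finset.range k, (2 * C) ^ k * M := Finset.sum_le_sum this
        _ = c * M := by rw [Finset.sum_const, Finset.card_range, nsmul_eq_mul, hc]; ring
    -- With this `Λ` the energies `X i` on the right add up to `S / 2` and can be absorbed.
    set Λ := 2 * k * c * Λ₀ ^ (2 * k) with hΛ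
    have hΛ₀ : Λ₀ ≤ Λ := by
      have h1 : Λ₀ ≤ Λ₀ ^ (2 * k) := le_self_pow₀ h0 (by omega)
      have h2 : 1 ≤ 2 * k * c := by nlinarith
      rw [hΛ]; nlinarith
    have hΛ1 : 1 ≤ Λ := h0.trans hΛ₀
    have hRi : ∀ i ∈ Finset.range k, R i ≤ S / Λ + D' * Λ ^ N' * R 0 := by
      intro i hi
      refine (hDN i (Finset.mem_range.1 hi) X R Λ₀ h0 hR hX hlow Λ hΛ₀).trans ?_
      have hDi : D i ≤ D' := Finset.single_le_sum (f := D)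
        (fun i hi => (zero_le_one.trans (hD i (Finset.mem_range.1 hi)))) hi
      have hNi : N i ≤ N' := Finset.single_le_sum (fun i _ => Nat.zero_le (N i)) hi
      have := hR 0
      gcongr
    have hQle : Q ≤ k * (S / Λ + D' * Λ ^ N' * R 0) := by
      calc Q ≤ ∑ i ∈ Finset.range k, (S / Λ + D' * Λ ^ N' * R 0) := Finset.sum_le_sum hRi
        _ = _ := by rw [Finset.sum_const, Finset.card_range, nsmul_eq_mul]
    have hΛpos : 0 < Λ₀ ^ (2 * k) := by positivity
    have hfin : S ≤ 2 * c * X k + 2 * c * k * D' * Λ₀ ^ (2 * k) * Λ ^ N' * R 0 := by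
      have a1 : c * (Λ₀ ^ (2 * k) * Q) ≤
          c * (Λ₀ ^ (2 * k) * (k * (S / Λ + D' * Λ ^ N' * R 0))) := by gcongr
      have a2 : c * (Λ₀ ^ (2 * k) * (k * (S / Λ + D' * Λ ^ N' * R 0))) =
          S / 2 + c * k * D' * Λ₀ ^ (2 * k) * Λ ^ N' * R 0 := by
        have : c * Λ₀ ^ (2 * k) * k * (S / Λ) = S / 2 := by
          rw [hΛ]
          have : (k : ℝ) ≠ 0 := by positivity
          field_simp
        linear_combination this
      have a3 : c * M = c * X k + c * (Λ₀ ^ (2 * k) * Q) := by rw [hM]; ring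
      linarith
    have hX0 : X 0 ≤ S := Finset.single_le_sum (fun i _ => hX i) (Finset.mem_range.2 (by omega))
    have hΛN : Λ ^ N' = (2 * k * c) ^ N' * Λ₀ ^ (2 * k * N') := by
      rw [hΛ, mul_pow, ← pow_mul]
    have hR0 := hR 0
    have hXk := hX k
    have b1 : 2 * c ≤ 2 * c * k * D' * (2 * k * c) ^ N' * Λ₀ ^ (2 * k + 2 * k * N') := by
      have h1 : 1 ≤ (2 * k * c) ^ N' := one_le_pow₀ (by nlinarith)
      have h2 : 1 ≤ Λ₀ ^ (2 * k + 2 * k * N') := one_le_pow₀ h0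
      have h3 : 1 ≤ k * D' := by nlinarith
      have h4 : 1 ≤ k * D' * ((2 * k * c) ^ N' * Λ₀ ^ (2 * k + 2 * k * N')) :=
        one_le_mul_of_one_le_of_one_le h3 (one_le_mul_of_one_le_of_one_le h1 h2)
      calc 2 * c = 2 * c * 1 := (mul_one _).symm
        _ ≤ 2 * c * (k * D' * ((2 * k * c) ^ N' * Λ₀ ^ (2 * k + 2 * k * N'))) := by gcongr
        _ = _ := by ring
    calc X 0 ≤ S := hX0
      _ ≤ 2 * c * X k + 2 * c * k * D' * Λ₀ ^ (2 * k) * Λ ^ N' * R 0 := hfin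
      _ = 2 * c * X k
          + 2 * c * k * D' * (2 * k * c) ^ N' * Λ₀ ^ (2 * k + 2 * k * N') * R 0 := by
        rw [hΛN, pow_add]; ring
      _ ≤ _ := by
        rw [mul_add]; gcongr

end Absorption

end

/-! ### The Caccioppoli inequality -/

section

open Matrix MeasureTheory Filter Topology

section CaccioppoliInequality

variable {n : ℕ}

/-- The Caccioppoli inequality for solutions of `σ_k(A) ≤ 1` in `closure Γ_k`. The dependence of the
constant on the exponent `m` and on the gradient of the cutoff function is polynomial, as Moser's
iteration requires. -/
theorem caccioppoli {k : ℕ} (hk : 1 ≤ k) (hkn : k ≤ n) :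
    ∃ C : ℝ, 1 ≤ C ∧ ∃ N : ℕ, ∀ (S : Set (EuclideanSpace ℝ (Fin n)))
      (w ζ : EuclideanSpace ℝ (Fin n) → ℝ) (L m Λ : ℝ), ContDiff ℝ 2 w →
      (HasCompactSupport fun x => w x - 1) → (∀ x, 0 < w x) → IsAdmissibleOn k S w →
      (∀ x ∈ S, matrixSigma (schouten w x) k ≤ 1) → (∀ x ∈ S, 1 / 2 ≤ w x) → IsCutoff S L ζ →
      1 ≤ L → L ≤ Λ → n ≤ m → m + 2 * k ≤ Λ →
      ∫ x, ζ x ^ (2 * k + 2) * w x ^ (-(m + 2 * k)) * gradSq w x ^ k ≤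
        C * Λ ^ N * ∫ x, ζ x ^ 2 * w x ^ (-m) := by
  set C : ℝ := 8 * k + 4 * (4 * (2 * k + 2 : ℕ)) ^ (2 * k)
    + 2 * ((n * (2 * k + 4) : ℕ) : ℝ) ^ 3 with hC
  have hk1 : (1 : ℝ) ≤ k := by exact_mod_cast hk
  have hc1 : (0 : ℝ) ≤ 4 * (4 * (2 * k + 2 : ℕ)) ^ (2 * k) := by positivity
  have hc2 : (0 : ℝ) ≤ 2 * ((n * (2 * k + 4) : ℕ) : ℝ) ^ 3 := by positivity
  have hC1 : 1 ≤ C := by linarith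
  obtain ⟨D, hD, N, hDN⟩ := exists_absorption_bound C hC1 k hk
  refine ⟨D * (4 ^ k + 1), ?_, N, ?_⟩
  · have : (1 : ℝ) ≤ 4 ^ k + 1 := by
      have : (0 : ℝ) ≤ 4 ^ k := by positivity
      linarith
    nlinarith
  intro S w ζ L m Λ hw hwc hpos hadm hσ hhalf hζ hL1 hLΛ hm hΛ
  have hn0 : (0 : ℝ) ≤ n := Nat.cast_nonneg n
  have hn1 : (1 : ℝ) ≤ n := by exact_mod_cast hk.trans hkn
  have hΛ1 : 1 ≤ Λ := hL1.trans hLΛ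
  set γ := m + 2 * k with hγ
  -- `X j` and `R j` all have the same homogeneity in `w`. They are set to zero for `j > k`, where
  -- the admissibility of `w` says nothing about `σ_j`.
  set X : ℕ → ℝ := fun j =>
    if j ≤ k then ∫ x, energyDensity w ζ (2 * k + 2) (-γ) (k - j) j x else 0 with hX
  set R : ℕ → ℝ := fun j =>
    if j ≤ k then ∫ x, energyDensity w ζ (2 * j + 2) (-γ + 2 * ((k : ℝ) - j)) 0 j x else 0 with hR
  have hX0 : ∀ j, 0 ≤ X j := by
    intro j
    simp only [hX]
    split_ifs with hj
    · exact integral_nonneg fun x => energyDensity_nonneg hadm hpos hζ (by omega) _ _ hj x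
    · exact le_rfl
  have hR0 : ∀ j, 0 ≤ R j := by
    intro j
    simp only [hR]
    split_ifs with hj
    · exact integral_nonneg fun x => energyDensity_nonneg hadm hpos hζ (by omega) _ _ hj x
    · exact le_rfl
  have hlow : ∀ Λ', Λ ≤ Λ' → ∀ j, j + 1 < k → R (j + 1) ≤ X j / Λ' + C * Λ' ^ 5 * R j := by
    intro Λ' hΛ' j hj
    obtain ⟨b, hb⟩ : ∃ b, k = j + 1 + b := ⟨k - (j + 1), by omega⟩
    have hb0 : b ≠ 0 := by omega
    have hbk : (k : ℝ) = j + 1 + b := by exact_mod_cast hb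
    have hb1 : (0 : ℝ) ≤ b := Nat.cast_nonneg b
    have hj1 : (0 : ℝ) ≤ j := Nat.cast_nonneg j
    have habs : |n + 1 + (-γ + 2 * (b : ℝ))| ≤ Λ' := by
      rw [abs_le]; constructor <;> linarith
    have key := energy_lower_order hb0 (j := j) (by omega) (hb ▸ hadm) hw hwc hpos hζ
      (by linarith) (hLΛ.trans hΛ') (hΛ1.trans hΛ') habs
    have e1 : R (j + 1) = ∫ x, energyDensity w ζ (2 * (j + 1) + 2) (-γ + 2 * b) 0 (j + 1) x := by
      simp only [hR]
      rw [if_pos hj.le, show (k : ℝ) - ((j + 1 : ℕ) : ℝ) = b by push_cast; linarith]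
    have e2 : X j = ∫ x, energyDensity w ζ (2 * (j + 1 + b) + 2) (-γ) (b + 1) j x := by
      simp only [hX]
      rw [if_pos (by omega), show k - j = b + 1 by omega, hb]
    have e3 : R j = ∫ x, energyDensity w ζ (2 * j + 2) (-γ + 2 * (b + 1)) 0 j x := by
      simp only [hR]
      rw [if_pos (by omega), show (k : ℝ) - (j : ℝ) = b + 1 by linarith]
    rw [← e1, ← e2, ← e3, ← hb] at key
    have hR := hR0 j
    have hΛ'0 : 0 ≤ Λ' := by linarith
    refine key.trans ?_
    gcongr
    linarith
  have hdesc : ∀ j < k, X j ≤ C * (X (j + 1) + Λ ^ (2 * k) * R j) := by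
    intro j hj
    obtain ⟨b, hb⟩ : ∃ b, k = j + 1 + b := ⟨k - (j + 1), by omega⟩
    have hbk : (k : ℝ) = j + 1 + b := by exact_mod_cast hb
    have hj1 : (0 : ℝ) ≤ j := Nat.cast_nonneg j
    have key := energy_descent (j := j) (b := b) hL1 (by omega) (hb ▸ hadm) hw hwc hpos hζ
      (γ := γ) (by linarith)
    have e1 : X (j + 1) = ∫ x, energyDensity w ζ (2 * (j + 1 + b) + 2) (-γ) b (j + 1) x := by
      simp only [hX]
      rw [if_pos (by omega), show k - (j + 1) = b by omega, hb]
    have e2 : X j = ∫ x, energyDensity w ζ (2 * (j + 1 + b) + 2) (-γ) (b + 1) j x := by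
      simp only [hX]
      rw [if_pos (by omega), show k - j = b + 1 by omega, hb]
    have e3 : R j = ∫ x, energyDensity w ζ (2 * j + 2) (-γ + 2 * (b + 1)) 0 j x := by
      simp only [hR]
      rw [if_pos (by omega), show (k : ℝ) - (j : ℝ) = b + 1 by linarith]
    rw [← e1, ← e2, ← e3, ← hb] at key
    have hXj := hX0 (j + 1)
    have hRj := hR0 j
    have a1 : 4 * (4 * (((2 * k + 2 : ℕ) : ℝ) * L)) ^ (2 * k) * R j ≤ C * (Λ ^ (2 * k) * R j) := by
      calc 4 * (4 * (((2 * k + 2 : ℕ) : ℝ) * L)) ^ (2 * k) * R j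
          = 4 * (4 * (2 * k + 2 : ℕ)) ^ (2 * k) * (L ^ (2 * k) * R j) := by
            rw [← mul_assoc (4 : ℝ), mul_pow _ L]; ring
        _ ≤ C * (Λ ^ (2 * k) * R j) := by
          gcongr
          linarith
    have a2 : 8 * (k : ℝ) * X (j + 1) ≤ C * X (j + 1) := by
      gcongr; linarith
    rw [mul_add]
    linarith
  have hmain := hDN X R Λ hΛ1 hR0 hX0 hlow hdesc
  have eX : X 0 = ∫ x, ζ x ^ (2 * k + 2) * w x ^ (-(m + 2 * k)) * gradSq w x ^ k := by
    simp only [hX, Nat.zero_le, if_true, Nat.sub_zero]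
    refine integral_congr_ae (.of_forall fun x => ?_)
    simp [energyDensity, hγ]
  have eR : R 0 = ∫ x, ζ x ^ 2 * w x ^ (-m) := by
    simp only [hR, Nat.zero_le, if_true]
    refine integral_congr_ae (.of_forall fun x => ?_)
    simp [energyDensity, hγ]
  -- Here `σ_k ≤ 1` and `w ≥ 1/2` enter.
  have hXk : X k ≤ 4 ^ k * R 0 := by
    have eXk : X k = ∫ x, energyDensity w ζ (2 * k + 2) (-γ) 0 k x := by
      simp only [hX, le_refl, if_true, Nat.sub_self]
    have eR0 : R 0 = ∫ x, energyDensity w ζ (2 * 0 + 2) (-γ + 2 * ((k : ℝ) - (0 : ℕ))) 0 0 x := by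
      simp only [hR, Nat.zero_le, if_true]
    rw [eXk, eR0, ← integral_const_mul]
    refine integral_mono
      (integrable_energyDensity hw hpos hζ.contDiff hζ.hasCompactSupport (by omega) _ _ _)
      ((integrable_energyDensity hw hpos hζ.contDiff hζ.hasCompactSupport
        (by omega) _ _ _).const_mul _) fun x => ?_
    by_cases hx : x ∈ S
    · have hwx := hpos x
      have hζ0 := hζ.nonneg x
      have hζ1 := hζ.le_one x
      have hσ0 := hadm.sigma_nonneg x hx k le_rfl
      have h1 : w x ^ (-γ + 2 * ((k : ℝ) - (0 : ℕ))) = w x ^ (-γ) * w x ^ (2 * k) := by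
        rw [← Real.rpow_add_natCast hwx.ne']; push_cast; ring_nf
      have h2 : 1 ≤ 4 ^ k * w x ^ (2 * k) := by
        rw [pow_mul, ← mul_pow]
        refine one_le_pow₀ ?_
        nlinarith [hhalf x hx]
      have h3 : ζ x ^ (2 * k + 2) ≤ ζ x ^ 2 := pow_le_pow_of_le_one hζ0 hζ1 (by omega)
      have h4 : 0 ≤ w x ^ (-γ) := (Real.rpow_pos_of_pos hwx _).le
      simp only [energyDensity, pow_zero, mul_one, matrixSigma_zero, mul_zero, zero_add]
      rw [h1]
      calc ζ x ^ (2 * k + 2) * w x ^ (-γ) * matrixSigma (schouten w x) k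
          ≤ ζ x ^ 2 * w x ^ (-γ) * 1 := by
            gcongr
            exact hσ x hx
        _ ≤ ζ x ^ 2 * w x ^ (-γ) * (4 ^ k * w x ^ (2 * k)) := by gcongr
        _ = _ := by ring
    · simp [energyDensity, hζ.eq_zero x hx]
  rw [← eX, ← eR]
  have hR00 := hR0 0
  calc X 0 ≤ D * Λ ^ N * (X k + R 0) := hmain
    _ ≤ D * Λ ^ N * (4 ^ k * R 0 + R 0) := by gcongr
    _ = D * (4 ^ k + 1) * Λ ^ N * R 0 := by ring

end CaccioppoliInequality

end

/-! ### Cutoff functions, the Sobolev inequality and Moser's step -/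

section

open Matrix MeasureTheory Filter Topology

section Cutoff

variable {n : ℕ}

theorem Real.smoothTransition.exists_abs_deriv_le :
    ∃ M : ℝ, 0 ≤ M ∧ (∀ t, |deriv Real.smoothTransition t| ≤ M) ∧
      ∀ t < 0, deriv Real.smoothTransition t = 0 := by
  have hc : Continuous (deriv Real.smoothTransition) :=
    (Real.smoothTransition.contDiff (n := 1)).continuous_deriv (by norm_num)
  obtain ⟨M, hM⟩ := (isCompact_Icc (a := (0 : ℝ)) (b := 1)).exists_bound_of_continuousOn
    hc.continuousOn
  have hneg : ∀ t < 0, deriv Real.smoothTransition t = 0 := by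
    intro t ht
    have : Real.smoothTransition =ᶠ[𝓝 t] fun _ => 0 := by
      filter_upwards [Iio_mem_nhds ht] with s hs
      exact Real.smoothTransition.zero_of_nonpos (le_of_lt hs)
    rw [this.deriv_eq, deriv_const]
  have hM0 : 0 ≤ M := (norm_nonneg _).trans (hM 0 ⟨le_rfl, zero_le_one⟩)
  refine ⟨M, hM0, fun t => ?_, hneg⟩
  rcases lt_or_ge t 0 with h | h
  · rw [hneg t h, abs_zero]; exact hM0
  rcases le_or_gt t 1 with h' | h'
  · exact hM t ⟨h, h'⟩
  · have : Real.smoothTransition =ᶠ[𝓝 t] fun _ => 1 := by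
      filter_upwards [Ioi_mem_nhds h'] with s hs
      exact Real.smoothTransition.one_of_one_le (le_of_lt hs)
    rw [this.deriv_eq, deriv_const, abs_zero]; exact hM0

/-- Cutoff functions between concentric balls, with gradient of the order of the inverse of the gap.
They are functions of `|x|²`, which keeps them smooth at the origin. -/
theorem exists_isCutoff : ∃ c : ℝ, 1 ≤ c ∧ ∀ r R : ℝ, 1 / 2 ≤ r → r < R → R ≤ 1 →
    ∃ ζ : EuclideanSpace ℝ (Fin n) → ℝ, IsCutoff (Metric.closedBall 0 R) (c / (R - r)) ζ ∧
      ∀ x ∈ Metric.closedBall 0 r, ζ x = 1 := by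
  obtain ⟨M, hM0, hM, hneg⟩ := Real.smoothTransition.exists_abs_deriv_le
  refine ⟨2 * M + 1, by linarith, fun r R hr hrR hR => ?_⟩
  have hd : 0 < R ^ 2 - r ^ 2 := by nlinarith
  have hd' : R - r ≤ R ^ 2 - r ^ 2 := by nlinarith
  have hsub : 0 < R - r := by linarith
  set f : EuclideanSpace ℝ (Fin n) → ℝ := fun x => (R ^ 2 - ‖x‖ ^ 2) / (R ^ 2 - r ^ 2) with hf
  have hfd : ContDiff ℝ 1 f := (contDiff_const.sub (contDiff_norm_sq ℝ)).div_const _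
  set ζ : EuclideanSpace ℝ (Fin n) → ℝ := fun x => Real.smoothTransition (f x) with hζ
  have hζd : ContDiff ℝ 1 ζ := (Real.smoothTransition.contDiff (n := 1)).comp hfd
  have hz : ∀ x ∉ Metric.closedBall (0 : EuclideanSpace ℝ (Fin n)) R, f x < 0 := by
    intro x hx
    rw [mem_closedBall_zero_iff, not_le] at hx
    apply div_neg_of_neg_of_pos _ hd
    nlinarith [norm_nonneg x]
  have hp : ∀ x i, partialD ζ x i =
      deriv Real.smoothTransition (f x) * (-2 * x i / (R ^ 2 - r ^ 2)) := by
    intro x i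
    have h1 : HasFDerivAt f ((R ^ 2 - r ^ 2)⁻¹ •
        -((2 : ℕ) • innerSL ℝ x : EuclideanSpace ℝ (Fin n) →L[ℝ] ℝ)) x := by
      have := ((hasStrictFDerivAt_norm_sq x).hasFDerivAt.const_sub (R ^ 2)).const_mul
        (R ^ 2 - r ^ 2)⁻¹
      refine this.congr_of_eventuallyEq (.of_forall fun y => ?_)
      simp only [hf]; ring
    have h2 : HasDerivAt Real.smoothTransition (deriv Real.smoothTransition (f x)) (f x) :=
      ((Real.smoothTransition.contDiff (n := 1)).differentiable (by norm_num) _).hasDerivAt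
    have h3 := h2.comp_hasFDerivAt x h1
    rw [partialD, show ζ = Real.smoothTransition ∘ f from rfl, h3.fderiv]
    simp [EuclideanSpace.inner_single_right]
    ring
  refine ⟨ζ, ⟨hζd, ?_, fun x => Real.smoothTransition.nonneg _,
    fun x => Real.smoothTransition.le_one _, fun x hx =>
      Real.smoothTransition.zero_of_nonpos (hz x hx).le, fun x => ?_⟩, fun x hx => ?_⟩
  · exact HasCompactSupport.intro (isCompact_closedBall 0 R) fun x hx =>
      Real.smoothTransition.zero_of_nonpos (hz x hx).le
  · by_cases hx : x ∈ Metric.closedBall (0 : EuclideanSpace ℝ (Fin n)) R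
    · have e : gradSq ζ x =
          (deriv Real.smoothTransition (f x)) ^ 2 * (2 / (R ^ 2 - r ^ 2)) ^ 2 * ‖x‖ ^ 2 := by
        rw [gradSq, EuclideanSpace.real_norm_sq_eq, Finset.mul_sum]
        simp only [dotProduct, gradVec, hp]
        exact Finset.sum_congr rfl fun i _ => by ring
      rw [mem_closedBall_zero_iff] at hx
      have h1 : (deriv Real.smoothTransition (f x)) ^ 2 ≤ M ^ 2 := sq_le_sq' (by
        linarith [(abs_le.1 (hM (f x))).1]) (abs_le.1 (hM (f x))).2
      have h2 : ‖x‖ ^ 2 ≤ 1 := pow_le_one₀ (norm_nonneg x) (hx.trans hR)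
      have h3 : 2 / (R ^ 2 - r ^ 2) ≤ 2 / (R - r) := by gcongr
      calc gradSq ζ x ≤ M ^ 2 * (2 / (R - r)) ^ 2 * 1 := by rw [e]; gcongr
        _ = (2 * M / (R - r)) ^ 2 := by ring
        _ ≤ ((2 * M + 1) / (R - r)) ^ 2 := by gcongr; linarith
    · have : gradVec ζ x = 0 := by
        ext i
        rw [gradVec, hp, hneg _ (hz x hx)]; simp
      rw [gradSq, this]
      simp; positivity
  · apply Real.smoothTransition.one_of_one_le
    rw [mem_closedBall_zero_iff] at hx
    rw [le_div_iff₀ hd, one_mul]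
    nlinarith [norm_nonneg x]

end Cutoff

section Moser

variable {n : ℕ}

theorem norm_fderiv_le_sqrt_gradSq (f : EuclideanSpace ℝ (Fin n) → ℝ)
    (x : EuclideanSpace ℝ (Fin n)) : ‖fderiv ℝ f x‖ ≤ √(gradSq f x) := by
  refine ContinuousLinearMap.opNorm_le_bound _ (Real.sqrt_nonneg _) fun v => ?_
  have hv : v = ∑ i, v i • EuclideanSpace.single i (1 : ℝ) := by
    ext j; simp [Finset.sum_apply, Pi.single_apply]
  have h1 : fderiv ℝ f x v = ∑ i, partialD f x i * v i := by
    conv_lhs => rw [hv]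
    rw [map_sum]
    refine Finset.sum_congr rfl fun i _ => ?_
    rw [map_smul, smul_eq_mul, mul_comm]; rfl
  rw [h1, EuclideanSpace.norm_eq, ← Real.sqrt_mul (gradSq_nonneg f x), Real.norm_eq_abs]
  refine Real.abs_le_sqrt ?_
  have := Finset.sum_mul_sq_le_sq_mul_sq Finset.univ (gradVec f x) v
  simpa [gradSq, dotProduct, gradVec, sq] using this

/-- The Gagliardo–Nirenberg–Sobolev inequality in terms of Bochner integrals. -/
theorem exists_sobolev (hn : 2 ≤ n) : ∃ C : ℝ, 1 ≤ C ∧ ∀ g : EuclideanSpace ℝ (Fin n) → ℝ,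
    ContDiff ℝ 1 g → HasCompactSupport g → (∀ x, 0 ≤ g x) →
    ∫ x, g x ^ Real.conjExponent n ≤ (C * ∫ x, ‖fderiv ℝ g x‖) ^ Real.conjExponent n := by
  have hn1 : (1 : ℝ) < n := by exact_mod_cast hn
  have hp : Real.HolderConjugate n (Real.conjExponent n) := Real.HolderConjugate.conjExponent hn1
  set p := Real.conjExponent n
  have hp1 : 1 < p := hp.symm.lt
  have hp0 : 0 < p := by linarith
  set c : ℝ := ((lintegralPowLePowLIntegralFDerivConst
    (volume : Measure (EuclideanSpace ℝ (Fin n))) p : NNReal) : ℝ) with hc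
  have hc0 : 0 ≤ c := NNReal.coe_nonneg _
  refine ⟨c ^ (1 / p) + 1, by have := Real.rpow_nonneg hc0 (1 / p); linarith,
    fun g hg hgc hg0 => ?_⟩
  have h := lintegral_pow_le_pow_lintegral_fderiv (volume : Measure (EuclideanSpace ℝ (Fin n)))
    hg hgc (p := p) (by simpa using hp)
  have hI : Integrable fun x => fderiv ℝ g x :=
    (hg.continuous_fderiv (by norm_num)).integrable_of_hasCompactSupport (hgc.fderiv (𝕜 := ℝ))
  have hI2 : Integrable fun x => g x ^ p := by
    refine (hg.continuous.rpow_const fun x => Or.inr hp0.le).integrable_of_hasCompactSupport ?_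
    refine hgc.mono fun x hx => ?_
    rw [Function.mem_support] at hx ⊢
    contrapose! hx
    rw [hx, Real.zero_rpow hp0.ne']
  have e1 : ∫⁻ x, ‖g x‖ₑ ^ p = ENNReal.ofReal (∫ x, g x ^ p) := by
    rw [ofReal_integral_eq_lintegral_ofReal hI2 (.of_forall fun x => Real.rpow_nonneg (hg0 x) _)]
    refine lintegral_congr fun x => ?_
    rw [Real.enorm_of_nonneg (hg0 x), ENNReal.ofReal_rpow_of_nonneg (hg0 x) hp0.le]
  have hJ0 : 0 ≤ ∫ x, ‖fderiv ℝ g x‖ := integral_nonneg fun x => norm_nonneg _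
  rw [e1, ← ofReal_integral_norm_eq_lintegral_enorm hI,
    ENNReal.ofReal_rpow_of_nonneg hJ0 hp0.le, ← ENNReal.ofReal_coe_nnreal,
    ← ENNReal.ofReal_mul (NNReal.coe_nonneg _), ENNReal.ofReal_le_ofReal_iff (by positivity)] at h
  refine h.trans ?_
  rw [← hc]
  have e2 : c = (c ^ (1 / p)) ^ p := by
    rw [← Real.rpow_mul hc0, one_div_mul_cancel hp0.ne', Real.rpow_one]
  have hcp := Real.rpow_nonneg hc0 (1 / p)
  calc c * (∫ x, ‖fderiv ℝ g x‖) ^ p = (c ^ (1 / p) * ∫ x, ‖fderiv ℝ g x‖) ^ p := by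
        rw [Real.mul_rpow hcp hJ0, ← e2]
    _ ≤ _ := by
      apply Real.rpow_le_rpow (by positivity) _ hp0.le
      gcongr
      linarith

theorem integrableOn_rpow_closedBall {w : EuclideanSpace ℝ (Fin n) → ℝ} (hw : Continuous w)
    (hpos : ∀ x, 0 < w x) (s r : ℝ) :
    IntegrableOn (fun x => w x ^ s) (Metric.closedBall 0 r) :=
  (hw.rpow_const fun x => Or.inl (hpos x).ne').continuousOn.integrableOn_compact
    (isCompact_closedBall 0 r)

/-- One step of Moser's iteration: the Sobolev inequality for `ζ ^ (2k + 2) w ^ (-m)`, whose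
gradient is controlled by the Caccioppoli inequality. -/
theorem moser_step {k : ℕ} (hn : 2 ≤ n) (hk : 1 ≤ k) (hkn : k ≤ n) :
    ∃ C : ℝ, 1 ≤ C ∧ ∃ N : ℕ, ∀ (w : EuclideanSpace ℝ (Fin n) → ℝ) (r R m : ℝ), ContDiff ℝ 2 w →
      (HasCompactSupport fun x => w x - 1) → (∀ x, 0 < w x) →
      IsAdmissibleOn k (Metric.closedBall 0 1) w →
      (∀ x ∈ Metric.closedBall 0 1, matrixSigma (schouten w x) k ≤ 1) →
      (∀ x ∈ Metric.closedBall 0 1, 1 / 2 ≤ w x) → 1 / 2 ≤ r → r < R → R ≤ 1 → n ≤ m →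
      ∫ x in Metric.closedBall 0 r, w x ^ (-(m * Real.conjExponent n)) ≤
        (C * (m / (R - r)) ^ N * ∫ x in Metric.closedBall 0 R, w x ^ (-m)) ^
          Real.conjExponent n := by
  obtain ⟨Cs, hCs, hsob⟩ := exists_sobolev hn
  obtain ⟨Cc, hCc, N, hcac⟩ := caccioppoli hk hkn
  obtain ⟨c0, hc0, hcut⟩ := exists_isCutoff (n := n)
  have hn1 : (1 : ℝ) < n := by exact_mod_cast hn
  have hp : Real.HolderConjugate n (Real.conjExponent n) := Real.HolderConjugate.conjExponent hn1
  set p := Real.conjExponent n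
  have hp1 : 1 < p := hp.symm.lt
  have hp0 : 0 < p := by linarith
  set c : ℝ := c0 + 2 * k + 1 with hc
  have hk0 : (0 : ℝ) ≤ k := Nat.cast_nonneg k
  have hc1 : 1 ≤ c := by linarith
  set C1 : ℝ := 2 * k + 4 + Cc with hC1
  refine ⟨Cs * (C1 * c ^ (N + 1)), ?_, N + 1, ?_⟩
  · have h1 : 1 ≤ c ^ (N + 1) := one_le_pow₀ hc1
    have h2 : 1 ≤ C1 := by linarith
    exact one_le_mul_of_one_le_of_one_le hCs (one_le_mul_of_one_le_of_one_le h2 h1)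
  intro w r R m hw hwc hpos hadm hσ hhalf hr hrR hR hm
  obtain ⟨ζ, hζ, hζ1⟩ := hcut r R hr hrR hR
  have hsub : Metric.closedBall (0 : EuclideanSpace ℝ (Fin n)) R ⊆ Metric.closedBall 0 1 :=
    Metric.closedBall_subset_closedBall hR
  set L := c0 / (R - r) with hL
  set μ := m / (R - r) with hμ
  set Λ := c * μ with hΛ
  have hRr : 0 < R - r := by linarith
  have hm1 : 1 ≤ m := by linarith
  have hinv : 1 ≤ 1 / (R - r) := by rw [le_div_iff₀ hRr]; linarith
  have hL1 : 1 ≤ L := by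
    rw [hL, div_eq_mul_one_div]; exact one_le_mul_of_one_le_of_one_le hc0 hinv
  have hμ1 : 1 ≤ μ := by
    rw [hμ, div_eq_mul_one_div]; exact one_le_mul_of_one_le_of_one_le hm1 hinv
  have hLμ : L ≤ c0 * μ := by
    rw [hL, hμ, mul_div_assoc']; gcongr; nlinarith
  have hmμ : m ≤ μ := by
    rw [hμ, div_eq_mul_one_div]; exact le_mul_of_one_le_right (by linarith) hinv
  have hLΛ : L ≤ Λ := hLμ.trans (by rw [hΛ]; gcongr; linarith)
  have hmΛ : m + 2 * k ≤ Λ := by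
    have : Λ = c0 * μ + 2 * k * μ + μ := by rw [hΛ, hc]; ring
    have h1 : 2 * (k : ℝ) ≤ 2 * k * μ := le_mul_of_one_le_right (by positivity) hμ1
    have h2 : 0 ≤ c0 * μ := by positivity
    linarith
  have hΛ1 : 1 ≤ Λ := hL1.trans hLΛ
  set B := Metric.closedBall (0 : EuclideanSpace ℝ (Fin n)) R with hB
  set I := ∫ x in B, w x ^ (-m) with hI
  have hI0 : 0 ≤ I := integral_nonneg fun x => Real.rpow_nonneg (hpos x).le _
  have hiB : Integrable (B.indicator fun x => w x ^ (-m)) :=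
    (integrable_indicator_iff Metric.isClosed_closedBall.measurableSet).2
      (integrableOn_rpow_closedBall hw.continuous hpos _ _)
  have hIe : ∫ x, B.indicator (fun x => w x ^ (-m)) x = I :=
    integral_indicator Metric.isClosed_closedBall.measurableSet
  have hC := hcac B w ζ L m Λ hw hwc hpos ⟨fun x hx => hadm.sigma_nonneg x (hsub hx),
    fun x hx => hadm.posSemidef x (hsub hx)⟩ (fun x hx => hσ x (hsub hx))
    (fun x hx => hhalf x (hsub hx)) hζ hL1 hLΛ hm hmΛ
  have hcR : ∫ x, ζ x ^ 2 * w x ^ (-m) ≤ I := by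
    rw [← hIe]
    refine integral_mono_of_nonneg (.of_forall fun x => ?_) hiB (.of_forall fun x => ?_)
    · exact mul_nonneg (sq_nonneg _) (Real.rpow_nonneg (hpos x).le _)
    · by_cases hx : x ∈ B
      · simp only [Set.indicator_of_mem hx]
        exact mul_le_of_le_one_left (Real.rpow_nonneg (hpos x).le _)
          (pow_le_one₀ (hζ.nonneg x) (hζ.le_one x))
      · simp [Set.indicator_of_notMem hx, hζ.eq_zero x hx]
  set g : EuclideanSpace ℝ (Fin n) → ℝ := fun x => ζ x ^ (2 * k + 2) * w x ^ (-m) with hg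
  have hgd : ContDiff ℝ 1 g := (hζ.contDiff.pow _).mul
    ((hw.of_le (by norm_num)).rpow_const_of_ne fun x => (hpos x).ne')
  have hgc : HasCompactSupport g := by
    refine hζ.hasCompactSupport.mono fun x hx => ?_
    rw [Function.mem_support] at hx ⊢
    contrapose! hx
    simp [hg, hx]
  have hg0 : ∀ x, 0 ≤ g x := fun x =>
    mul_nonneg (pow_nonneg (hζ.nonneg x) _) (Real.rpow_nonneg (hpos x).le _)
  set E : EuclideanSpace ℝ (Fin n) → ℝ :=
    fun x => ζ x ^ (2 * k + 2) * w x ^ (-(m + 2 * k)) * gradSq w x ^ k with hE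
  have hEi : Integrable E := by
    have := integrable_energyDensity hw hpos hζ.contDiff hζ.hasCompactSupport
      (by omega : 2 * k + 2 ≠ 0) (-(m + 2 * k)) k 0
    refine this.congr (.of_forall fun x => ?_)
    simp [energyDensity, hE]
  have hpt : ∀ x, ‖fderiv ℝ g x‖ ≤
      ((2 * k + 2) * L + m) * B.indicator (fun x => w x ^ (-m)) x + m * E x := by
    intro x
    have hwx := hpos x
    have hζ0 := hζ.nonneg x
    have hzd := (hζ.contDiff.differentiable (by norm_num) x).hasFDerivAt
    have hwd := (hw.differentiable (by norm_num) x).hasFDerivAt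
    have hd := (hzd.pow (2 * k + 2)).mul (hwd.rpow_const (p := -m) (Or.inl hwx.ne'))
    have hfd : fderiv ℝ g x = _ := hd.fderiv
    by_cases hx : x ∈ B
    · rw [Set.indicator_of_mem hx, hfd]
      have n1 : ‖fderiv ℝ ζ x‖ ≤ L :=
        (norm_fderiv_le_sqrt_gradSq ζ x).trans (hζ.sqrt_gradSq_le (by linarith) x)
      have n2 := norm_fderiv_le_sqrt_gradSq w x
      set q := √(gradSq w x) with hq
      have hqq : gradSq w x = q ^ 2 := (Real.sq_sqrt (gradSq_nonneg w x)).symm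
      have hq0 : 0 ≤ q := Real.sqrt_nonneg _
      have hz1 : ζ x ^ (2 * k + 1) ≤ 1 := pow_le_one₀ hζ0 (hζ.le_one x)
      have hz2 : ζ x ^ (2 * k + 2) ≤ 1 := pow_le_one₀ hζ0 (hζ.le_one x)
      have hwm : 0 ≤ w x ^ (-m) := Real.rpow_nonneg hwx.le _
      -- Young's inequality trades `|∇w|` for `|∇w| ^ (2k)`, which `caccioppoli` controls.
      have hy := pow_mul_pow_le (x := q) (y := w x) (ε := 1) hq0 hwx.le one_pos le_rfl 1
        (c := 2 * k - 1) (by omega)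
      have e1 : w x ^ (-m - 1) = w x ^ (-(m + 2 * k)) * w x ^ (2 * k - 1) := by
        rw [← Real.rpow_natCast (w x) (2 * k - 1), ← Real.rpow_add hwx, Nat.cast_sub (by omega)]
        push_cast; ring_nf
      have e2 : w x ^ (-m) = w x ^ (-(m + 2 * k)) * w x ^ (2 * k) := by
        rw [← Real.rpow_add_natCast hwx.ne']; push_cast; ring_nf
      have e3 : 1 + (2 * k - 1) = 2 * k := by omega
      simp only [pow_one, one_mul, div_one, e3] at hy
      have hwγ : 0 ≤ w x ^ (-(m + 2 * k)) := Real.rpow_nonneg hwx.le _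
      have hwm1 : w x ^ (-m - 1) * q ≤ w x ^ (-(m + 2 * k)) * gradSq w x ^ k + w x ^ (-m) := by
        rw [e1, e2, hqq, ← pow_mul, ← mul_add, mul_assoc, mul_comm (w x ^ (2 * k - 1))]
        gcongr
      have hwm10 : 0 ≤ w x ^ (-m - 1) := Real.rpow_nonneg hwx.le _
      have hb1 : ‖(ζ x ^ (2 * k + 2)) • ((-m * w x ^ (-m - 1)) • fderiv ℝ w x)‖ ≤
          m * (ζ x ^ (2 * k + 2) * (w x ^ (-m - 1) * q)) := by
        rw [norm_smul, norm_smul, Real.norm_of_nonneg (pow_nonneg hζ0 _), norm_mul, norm_neg,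
          Real.norm_of_nonneg (by linarith : 0 ≤ m), Real.norm_of_nonneg hwm10]
        calc _ ≤ ζ x ^ (2 * k + 2) * (m * w x ^ (-m - 1) * q) := by gcongr
          _ = _ := by ring
      have hb2 : ‖(w x ^ (-m)) • (((2 * k + 2 : ℕ) • ζ x ^ (2 * k + 2 - 1)) • fderiv ℝ ζ x)‖ ≤
          (2 * k + 2) * L * w x ^ (-m) := by
        rw [norm_smul, norm_smul, Real.norm_of_nonneg hwm, nsmul_eq_mul, norm_mul,
          Real.norm_of_nonneg (Nat.cast_nonneg _), Real.norm_of_nonneg (pow_nonneg hζ0 _)]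
        calc _ ≤ w x ^ (-m) * (((2 * k + 2 : ℕ) : ℝ) * 1 * L) := by
              gcongr
              exact hz1
          _ = _ := by push_cast; ring
      refine (norm_add_le _ _).trans ?_
      have hb3 : m * (ζ x ^ (2 * k + 2) * (w x ^ (-m - 1) * q)) ≤ m * E x + m * w x ^ (-m) := by
        have : ζ x ^ (2 * k + 2) * (w x ^ (-m - 1) * q) ≤ E x + w x ^ (-m) := by
          calc _ ≤ ζ x ^ (2 * k + 2) *
                (w x ^ (-(m + 2 * k)) * gradSq w x ^ k + w x ^ (-m)) := by gcongr
            _ = E x + ζ x ^ (2 * k + 2) * w x ^ (-m) := by rw [hE]; ring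
            _ ≤ _ := by
              gcongr
              exact mul_le_of_le_one_left hwm hz2
        rw [← mul_add]; gcongr
      linarith
    · rw [Set.indicator_of_notMem hx, hfd]
      have hz := hζ.eq_zero x hx
      simp [hz, hE]
  have hgrad : ∫ x, ‖fderiv ℝ g x‖ ≤ C1 * Λ ^ (N + 1) * I := by
    calc ∫ x, ‖fderiv ℝ g x‖
        ≤ ∫ x, (((2 * k + 2) * L + m) * B.indicator (fun x => w x ^ (-m)) x + m * E x) :=
          integral_mono ((hgd.continuous_fderiv (by norm_num)).integrable_of_hasCompactSupport
            (hgc.fderiv (𝕜 := ℝ))).norm ((hiB.const_mul _).add (hEi.const_mul _)) hpt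
      _ = ((2 * k + 2) * L + m) * I + m * ∫ x, E x := by
          rw [integral_add (hiB.const_mul _) (hEi.const_mul _), integral_const_mul,
            integral_const_mul, hIe]
      _ ≤ ((2 * k + 2) * Λ + Λ) * I + Λ * (Cc * Λ ^ N * I) := by
          have hmΛ' : m ≤ Λ := by linarith
          have : ∫ x, E x ≤ Cc * Λ ^ N * I := hC.trans (by gcongr)
          have hE0 : 0 ≤ ∫ x, E x := integral_nonneg fun x => mul_nonneg (mul_nonneg
            (pow_nonneg (hζ.nonneg x) _) (Real.rpow_nonneg (hpos x).le _))
            (pow_nonneg (gradSq_nonneg w x) _)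
          gcongr
      _ ≤ ((2 * k + 2) * Λ ^ (N + 1) + Λ ^ (N + 1)) * I + Cc * Λ ^ (N + 1) * I := by
          have h1 : Λ ≤ Λ ^ (N + 1) := le_self_pow₀ hΛ1 (by omega)
          have h2 : Λ * (Cc * Λ ^ N * I) = Cc * Λ ^ (N + 1) * I := by ring
          rw [h2]; gcongr
      _ ≤ C1 * Λ ^ (N + 1) * I := by
          have h1 : 0 ≤ Λ ^ (N + 1) * I := by positivity
          rw [hC1]; nlinarith
  have hleft : ∫ x in Metric.closedBall 0 r, w x ^ (-(m * p)) ≤ ∫ x, g x ^ p := by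
    rw [← integral_indicator Metric.isClosed_closedBall.measurableSet]
    refine integral_mono_of_nonneg (.of_forall fun x => ?_) ?_ (.of_forall fun x => ?_)
    · exact Set.indicator_nonneg (fun y _ => Real.rpow_nonneg (hpos y).le _) x
    · refine (hgd.continuous.rpow_const fun x => Or.inr hp0.le).integrable_of_hasCompactSupport ?_
      refine hgc.mono fun x hx => ?_
      rw [Function.mem_support] at hx ⊢
      contrapose! hx
      rw [hx, Real.zero_rpow hp0.ne']
    · by_cases hx : x ∈ Metric.closedBall (0 : EuclideanSpace ℝ (Fin n)) r
      · simp only [Set.indicator_of_mem hx, hg, hζ1 x hx, one_pow, one_mul]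
        rw [← Real.rpow_mul (hpos x).le, neg_mul]
      · simp only [Set.indicator_of_notMem hx]
        exact Real.rpow_nonneg (hg0 x) _
  calc ∫ x in Metric.closedBall 0 r, w x ^ (-(m * p)) ≤ ∫ x, g x ^ p := hleft
    _ ≤ (Cs * ∫ x, ‖fderiv ℝ g x‖) ^ p := hsob g hgd hgc hg0
    _ ≤ (Cs * (C1 * c ^ (N + 1)) * μ ^ (N + 1) * I) ^ p := by
      refine Real.rpow_le_rpow (mul_nonneg (by linarith) (integral_nonneg fun x => norm_nonneg _))
        ?_ hp0.le
      calc Cs * ∫ x, ‖fderiv ℝ g x‖ ≤ Cs * (C1 * Λ ^ (N + 1) * I) := by gcongr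
        _ = _ := by rw [hΛ, mul_pow]; ring

end Moser

end

/-! ### Moser's iteration -/

section

open Matrix MeasureTheory Filter Topology

section Iteration

variable {n : ℕ}

/-- The numerical lemma behind Moser's iteration: a sequence that grows at most like a power
`χ > 1`, up to geometric factors, decays doubly exponentially if its first term is small. -/
theorem exists_iteration_threshold {χ K B q : ℝ} (hχ : 1 < χ) (hK : 1 ≤ K) (hB : 1 ≤ B)
    (hq : 0 < q) : ∃ δ : ℝ, 0 < δ ∧ ∀ a : ℕ → ℝ, (∀ i, 0 ≤ a i) → a 0 ≤ δ →
      (∀ i, a (i + 1) ≤ (K * B ^ i * a i) ^ χ) → ∀ i, a i ≤ q ^ (χ ^ i) := by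
  have hχ1 : 0 < χ - 1 := by linarith
  have hχ0 : 0 < χ := by linarith
  -- `c` and `d` are chosen so that `b i = a i * c ^ i * d` satisfies `b (i + 1) ≤ b i ^ χ`.
  obtain ⟨c, hc1, hc⟩ : ∃ c : ℝ, 1 ≤ c ∧ c ^ χ = c * B ^ χ := by
    refine ⟨B ^ (χ / (χ - 1)), Real.one_le_rpow hB (by positivity), ?_⟩
    have hB0 : 0 < B := by linarith
    rw [← Real.rpow_mul hB0.le, ← Real.rpow_add hB0]
    congr 1; field_simp; ring
  obtain ⟨d, hd1, hd⟩ : ∃ d : ℝ, 1 ≤ d ∧ d ^ χ = d * (K ^ χ * c) := by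
    have h1 : 1 ≤ K ^ χ * c :=
      one_le_mul_of_one_le_of_one_le (Real.one_le_rpow hK hχ0.le) hc1
    have h0 : 0 < K ^ χ * c := by linarith
    refine ⟨(K ^ χ * c) ^ (1 / (χ - 1)), Real.one_le_rpow h1 (by positivity), ?_⟩
    nth_rewrite 3 [← Real.rpow_one (K ^ χ * c)]
    rw [← Real.rpow_mul h0.le, ← Real.rpow_add h0]
    congr 1; field_simp; ring
  refine ⟨q / d, by positivity, fun a ha h0 hs => ?_⟩
  have key : ∀ i, a i * c ^ i * d ≤ q ^ (χ ^ i) := by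
    intro i
    induction i with
    | zero =>
      rw [pow_zero, mul_one, pow_zero, Real.rpow_one]
      rwa [le_div_iff₀ (by linarith)] at h0
    | succ i ih =>
      have hai := ha i
      have e : (K * B ^ i * a i) ^ χ * c ^ (i + 1) * d = (a i * c ^ i * d) ^ χ := by
        have e1 : (c ^ i) ^ χ = c ^ i * (B ^ i) ^ χ := by
          rw [← Real.rpow_pow_comm (by linarith), hc, mul_pow, Real.rpow_pow_comm (by linarith)]
        rw [Real.mul_rpow (by positivity) hai, Real.mul_rpow (by linarith) (by positivity),
          Real.mul_rpow (by positivity) (by linarith), Real.mul_rpow hai (by positivity), hd, e1]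
        ring
      calc a (i + 1) * c ^ (i + 1) * d ≤ (K * B ^ i * a i) ^ χ * c ^ (i + 1) * d := by
            gcongr; exact hs i
        _ = (a i * c ^ i * d) ^ χ := e
        _ ≤ (q ^ (χ ^ i)) ^ χ := by gcongr
        _ = q ^ (χ ^ (i + 1)) := by rw [← Real.rpow_mul hq.le, pow_succ]
  intro i
  refine le_trans ?_ (key i)
  rw [mul_assoc]
  exact le_mul_of_one_le_right (ha i)
    (one_le_mul_of_one_le_of_one_le (one_le_pow₀ hc1) hd1)

/-- Small energy is impossible for a normalized solution on the unit ball: Moser's iteration bounds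
`w⁻¹` at the origin by a fixed fraction. -/
theorem exists_energy_threshold {k : ℕ} (hn : 2 ≤ n) (hk : 1 ≤ k) (hkn : k ≤ n) :
    ∃ δ : ℝ, 0 < δ ∧ ∀ w : EuclideanSpace ℝ (Fin n) → ℝ, ContDiff ℝ 2 w →
      (HasCompactSupport fun x => w x - 1) → (∀ x, 0 < w x) →
      IsAdmissibleOn k (Metric.closedBall 0 1) w →
      (∀ x ∈ Metric.closedBall 0 1, matrixSigma (schouten w x) k ≤ 1) →
      (∀ x ∈ Metric.closedBall 0 1, 1 / 2 ≤ w x) → w 0 = 1 →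
      δ < ∫ x in Metric.closedBall 0 1, w x ^ (-(n : ℝ)) := by
  obtain ⟨C, hC, N, hstep⟩ := moser_step hn hk hkn
  have hn1 : (1 : ℝ) < n := by exact_mod_cast hn
  have hp : Real.HolderConjugate n (Real.conjExponent n) := Real.HolderConjugate.conjExponent hn1
  set p := Real.conjExponent n
  have hp1 : 1 < p := hp.symm.lt
  have hp0 : 0 < p := by linarith
  -- `y` is the base for which `w ≤ 2` gives the lower bound `y ^ (p ^ i)` for the integrand.
  set y : ℝ := 2 ^ (-(n : ℝ)) with hy
  have hy0 : 0 < y := by positivity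
  have hy1 : y < 1 := Real.rpow_lt_one_of_one_lt_of_neg (by norm_num) (by linarith)
  obtain ⟨δ, hδ, hit⟩ := exists_iteration_threshold (χ := p) (K := C * (4 * n) ^ N)
    (B := (2 * p) ^ N) (q := y * y) hp1
    (one_le_mul_of_one_le_of_one_le hC (one_le_pow₀ (by linarith))) (one_le_pow₀ (by linarith))
    (by positivity)
  refine ⟨δ, hδ, fun w hw hwc hpos hadm hσ hhalf hw0 => ?_⟩
  by_contra! hle
  set r : ℕ → ℝ := fun i => 1 / 2 + 1 / 2 ^ (i + 1) with hr
  set a : ℕ → ℝ := fun i => ∫ x in Metric.closedBall 0 (r i), w x ^ (-(n * p ^ i)) with ha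
  have hr_half : ∀ i, 1 / 2 < r i := fun i => by
    simp only [hr]; linarith [show (0 : ℝ) < 1 / 2 ^ (i + 1) by positivity]
  have hr_one : ∀ i, r i ≤ 1 := fun i => by
    have : (1 : ℝ) / 2 ^ (i + 1) ≤ 1 / 2 := by
      rw [pow_succ]; gcongr; exact le_mul_of_one_le_left (by norm_num) (one_le_pow₀ (by norm_num))
    simp only [hr]; linarith
  have hr_sub : ∀ i, r i - r (i + 1) = 1 / (4 * 2 ^ i) := fun i => by
    simp only [hr, pow_succ]; field_simp; ring
  have hup : ∀ i, a i ≤ (y * y) ^ (p ^ i) := by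
    refine hit a (fun i => integral_nonneg fun x => Real.rpow_nonneg (hpos x).le _) ?_ fun i => ?_
    · have : r 0 = 1 := by simp only [hr]; norm_num
      simp only [ha, this, pow_zero, mul_one]
      exact hle
    · have hpi : 1 ≤ p ^ i := one_le_pow₀ hp1.le
      have h := hstep w (r (i + 1)) (r i) (n * p ^ i) hw hwc hpos hadm hσ hhalf (hr_half _).le
        (by have := hr_sub i; linarith [show (0 : ℝ) < 1 / (4 * 2 ^ i) by positivity]) (hr_one i)
        (le_mul_of_one_le_right (by linarith) hpi)
      have e : n * p ^ i / (r i - r (i + 1)) = 4 * n * (2 * p) ^ i := by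
        rw [hr_sub, mul_pow]; field_simp
      rw [e, mul_pow, ← pow_mul, mul_comm i N, pow_mul, ← mul_assoc, mul_assoc (n : ℝ),
        ← pow_succ] at h
      exact h
  -- By continuity `w ≤ 2` on a ball, whose volume bounds the integrals from below.
  obtain ⟨ρ, hρ, hρw⟩ : ∃ ρ > 0, ∀ x ∈ Metric.closedBall (0 : EuclideanSpace ℝ (Fin n)) ρ,
      w x ≤ 2 := by
    have : ∀ᶠ x in 𝓝 (0 : EuclideanSpace ℝ (Fin n)), w x ≤ 2 :=
      ((hw.continuous.tendsto 0).eventually_lt_const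
        (show w 0 < 2 by rw [hw0]; norm_num)).mono fun x hx => le_of_lt hx
    exact Metric.nhds_basis_closedBall.eventually_iff.1 this
  set D := Metric.closedBall (0 : EuclideanSpace ℝ (Fin n)) (min ρ (1 / 2)) with hD
  have hV : 0 < volume.real D :=
    ENNReal.toReal_pos (Metric.measure_closedBall_pos _ _ (by positivity)).ne'
      measure_closedBall_lt_top.ne
  have hlow : ∀ i, volume.real D * y ^ (p ^ i) ≤ a i := by
    intro i
    have hi : 0 ≤ n * p ^ i := by positivity
    calc volume.real D * y ^ (p ^ i) = ∫ x in D, y ^ (p ^ i) := by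
          rw [setIntegral_const, smul_eq_mul]
      _ ≤ ∫ x in D, w x ^ (-(n * p ^ i)) := by
          refine setIntegral_mono_on (integrableOn_const measure_closedBall_lt_top.ne)
            (integrableOn_rpow_closedBall hw.continuous hpos _ _)
            Metric.isClosed_closedBall.measurableSet fun x hx => ?_
          rw [hy, ← Real.rpow_mul (by norm_num), neg_mul]
          exact Real.rpow_le_rpow_of_nonpos (hpos x)
            (hρw x (Metric.closedBall_subset_closedBall (min_le_left _ _) hx)) (by linarith)
      _ ≤ a i := by
          refine setIntegral_mono_set (integrableOn_rpow_closedBall hw.continuous hpos _ _)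
            (.of_forall fun x => Real.rpow_nonneg (hpos x).le _) (LE.le.eventuallyLE ?_)
          exact Metric.closedBall_subset_closedBall ((min_le_right _ _).trans (hr_half i).le)
  have hVle : ∀ i, volume.real D ≤ y ^ (p ^ i) := by
    intro i
    have h := (hlow i).trans (hup i)
    rw [Real.mul_rpow hy0.le hy0.le] at h
    exact le_of_mul_le_mul_right h (Real.rpow_pos_of_pos hy0 _)
  have hlim : Tendsto (fun i : ℕ => y ^ (p ^ i)) atTop (𝓝 0) :=
    (tendsto_rpow_atTop_of_base_lt_one y (by linarith) hy1).comp
      (tendsto_pow_atTop_atTop_of_one_lt hp1)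
  exact absurd (ge_of_tendsto' hlim hVle) (not_le.2 hV)

end Iteration

end

/-! ### Change of unknown, point picking and the estimate on an open set -/

section

open Matrix MeasureTheory Filter Topology

section Conversion

variable {n : ℕ}

theorem schouten_congr {v w : EuclideanSpace ℝ (Fin n) → ℝ} {x : EuclideanSpace ℝ (Fin n)}
    (h : v =ᶠ[𝓝 x] w) : schouten v x = schouten w x := by
  have h1 : gradVec v x = gradVec w x := by
    ext i; simp only [gradVec, partialD, h.fderiv_eq]
  have h2 : hessMat v x = hessMat w x := by
    ext i j; simp only [hessMat, of_apply, hessD, h.fderiv.fderiv_eq]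
  rw [schouten, schouten, h.eq_of_nhds, h1, h2]

/-- The Schouten tensor is invariant under the scaling `w ↦ h⁻¹ w(x₀ + h ·)`. -/
theorem schouten_rescale (w : EuclideanSpace ℝ (Fin n) → ℝ) (x₀ x : EuclideanSpace ℝ (Fin n))
    {h : ℝ} (hh : h ≠ 0) :
    schouten (fun y => h⁻¹ * w (x₀ + h • y)) x = schouten w (x₀ + h • x) := by
  have comp : ∀ {F : Type} [NormedAddCommGroup F] [NormedSpace ℝ F]
      (f : EuclideanSpace ℝ (Fin n) → F) (y), fderiv ℝ (fun y => f (x₀ + h • y)) y =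
        h • fderiv ℝ f (x₀ + h • y) := by
    intro F _ _ f y
    rw [fderiv_comp_smul (f := fun z => f (x₀ + z)), fderiv_comp_add_left]
  have d1 : fderiv ℝ (fun y => h⁻¹ * w (x₀ + h • y)) = fun y => fderiv ℝ w (x₀ + h • y) := by
    ext1 y
    have e : fderiv ℝ (fun y => h⁻¹ * w (x₀ + h • y)) y =
        h⁻¹ • fderiv ℝ (fun y => w (x₀ + h • y)) y :=
      congrFun (fderiv_const_smul_field h⁻¹ (f := fun y => w (x₀ + h • y))) y
    rw [e, comp, smul_smul, inv_mul_cancel₀ hh, one_smul]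
  have h1 : gradVec (fun y => h⁻¹ * w (x₀ + h • y)) x = gradVec w (x₀ + h • x) := by
    ext i; simp only [gradVec, partialD, d1]
  have h2 : hessMat (fun y => h⁻¹ * w (x₀ + h • y)) x = h • hessMat w (x₀ + h • x) := by
    ext i j
    simp [hessMat, hessD, d1, comp]
  rw [schouten, schouten, h1, h2, conformalMat, conformalMat, smul_smul, mul_right_comm,
    inv_mul_cancel₀ hh, one_mul]

/-- The change of unknown `w = u ^ (-2 / (n - 2))` removes all powers from the Schouten tensor. -/
theorem schoutenMatrix_eq_schouten (hn : 3 ≤ n) {u : EuclideanSpace ℝ (Fin n) → ℝ}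
    {x : EuclideanSpace ℝ (Fin n)} (hu : ContDiffAt ℝ 2 u x) (hpos : 0 < u x) :
    schoutenMatrix u x = schouten (fun y => u y ^ (-(2 / ((n : ℝ) - 2)))) x := by
  have hn2 : (0 : ℝ) < n - 2 := by
    have : (3 : ℝ) ≤ n := by exact_mod_cast hn
    linarith
  set p : ℝ := -(2 / ((n : ℝ) - 2)) with hp
  have hev : ∀ᶠ y in 𝓝 x, DifferentiableAt ℝ u y ∧ 0 < u y :=
    ((hu.eventually (by simp)).mono fun y hy => hy.differentiableAt (by norm_num)).and
      (hu.continuousAt.eventually_const_lt hpos)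
  have d1 : fderiv ℝ (fun y => u y ^ p) =ᶠ[𝓝 x] fun y => (p * u y ^ (p - 1)) • fderiv ℝ u y :=
    hev.mono fun y hy => (hy.1.hasFDerivAt.rpow_const (Or.inl hy.2.ne')).fderiv
  have hd := (hu.differentiableAt (by norm_num)).hasFDerivAt
  have hdd : HasFDerivAt (fderiv ℝ u) (fderiv ℝ (fderiv ℝ u) x) x :=
    ((hu.fderiv_right (m := 1) (by norm_num)).differentiableAt (by norm_num)).hasFDerivAt
  have d2 := (((hd.rpow_const (p := p - 1) (Or.inl hpos.ne')).const_mul p).fun_smul hdd).fderiv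
  have h1 : ∀ i, partialD (fun y => u y ^ p) x i = p * u x ^ (p - 1) * partialD u x i := by
    intro i
    rw [partialD, d1.eq_of_nhds]; simp [partialD]
  have h2 : ∀ i j, hessD (fun y => u y ^ p) x i j = p * u x ^ (p - 1) * hessD u x i j
      + p * (p - 1) * u x ^ (p - 2) * (partialD u x i * partialD u x j) := by
    intro i j
    rw [hessD, d1.fderiv_eq, d2]
    simp only [partialD, hessD, _root_.add_apply, _root_.smul_apply,
      ContinuousLinearMap.smulRight_apply, smul_eq_mul]
    rw [show p - 1 - 1 = p - 2 by ring]
    ring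
  have e1 : u x ^ (-(((n : ℝ) + 2) / ((n : ℝ) - 2))) = u x ^ p * u x ^ (p - 1) := by
    rw [← Real.rpow_add hpos, hp]; congr 1; field_simp; ring
  have e2 : u x ^ (-(2 * (n : ℝ) / ((n : ℝ) - 2))) = u x ^ p * u x ^ (p - 2) := by
    rw [← Real.rpow_add hpos, hp]; congr 1; field_simp; ring
  have e3 : u x ^ p * u x ^ (p - 2) = (u x ^ (p - 1)) ^ 2 := by
    rw [← Real.rpow_add hpos, sq, ← Real.rpow_add hpos]; congr 1; ring
  have e4 : 2 * (n : ℝ) / ((n : ℝ) - 2) ^ 2 = p * (p - 1) := by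
    rw [hp]; field_simp; ring
  have e5 : 2 / ((n : ℝ) - 2) ^ 2 = 1 / 2 * p ^ 2 := by
    rw [hp]; field_simp
  have e6 : gradVec (fun y => u y ^ p) x ⬝ᵥ gradVec (fun y => u y ^ p) x =
      p ^ 2 * (u x ^ (p - 1)) ^ 2 * ∑ l, partialD u x l ^ 2 := by
    simp only [dotProduct, gradVec, h1, Finset.mul_sum]
    exact Finset.sum_congr rfl fun l _ => by ring
  ext i j
  simp only [schoutenMatrix, schouten, conformalMat, of_apply, Matrix.sub_apply, Matrix.smul_apply,
    smul_eq_mul, hessMat, h2, e6, one_apply]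
  rw [e1, e2, e4, e5, ← hp, ← e3]
  ring

end Conversion

section PointPicking

variable {n : ℕ}

/-- Point picking: if `w x₀` is small compared to `d`, the maximum of `(d - |x - x₀|) / w x` is
attained at a point around which `w` is at least half its value, on a ball of comparable radius. -/
theorem exists_half_le_of_lt {w : EuclideanSpace ℝ (Fin n) → ℝ} {x₀ : EuclideanSpace ℝ (Fin n)}
    {d : ℝ} (hw : ContinuousOn w (Metric.closedBall x₀ d))
    (hpos : ∀ x ∈ Metric.closedBall x₀ d, 0 < w x) (hd : 0 ≤ d) (h : 4 * w x₀ < d) :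
    ∃ x₁ ∈ Metric.closedBall x₀ d,
      Metric.closedBall x₁ (2 * w x₁) ⊆ Metric.closedBall x₀ d ∧
      ∀ x ∈ Metric.closedBall x₁ (2 * w x₁), w x₁ / 2 ≤ w x := by
  have h0 : x₀ ∈ Metric.closedBall x₀ d := Metric.mem_closedBall_self hd
  obtain ⟨x₁, hx₁, hmax⟩ := (isCompact_closedBall x₀ d).exists_isMaxOn ⟨x₀, h0⟩
    (f := fun x => (d - dist x x₀) / w x)
    ((continuousOn_const.sub (continuous_id.dist continuous_const).continuousOn).div hw
      fun x hx => (hpos x hx).ne')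
  have hw1 := hpos x₁ hx₁
  have hs : 4 * w x₁ < d - dist x₁ x₀ := by
    have h1 : d / w x₀ ≤ (d - dist x₁ x₀) / w x₁ := by simpa using hmax h0
    have h2 : 4 < d / w x₀ := by rwa [lt_div_iff₀ (hpos x₀ h0)]
    rw [← lt_div_iff₀ hw1]; linarith
  have hsub : Metric.closedBall x₁ (2 * w x₁) ⊆ Metric.closedBall x₀ d :=
    Metric.closedBall_subset_closedBall' (by linarith)
  refine ⟨x₁, hx₁, hsub, fun x hx => ?_⟩
  have hwx := hpos x (hsub hx)
  have h1 : (d - dist x x₀) / w x ≤ (d - dist x₁ x₀) / w x₁ := hmax (hsub hx)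
  rw [div_le_div_iff₀ hwx hw1] at h1
  have h2 : dist x x₀ ≤ dist x x₁ + dist x₁ x₀ := dist_triangle _ _ _
  rw [Metric.mem_closedBall] at hx
  have hs0 : 0 < d - dist x₁ x₀ := by linarith
  have h3 : (d - dist x₁ x₀) / 2 ≤ d - dist x x₀ := by linarith
  have h4 : (d - dist x₁ x₀) / 2 * w x₁ ≤ (d - dist x₁ x₀) * w x := by
    nlinarith
  have h5 : (d - dist x₁ x₀) * (w x₁ / 2) ≤ (d - dist x₁ x₀) * w x := by linarith
  exact le_of_mul_le_mul_left h5 hs0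

/-- A positive function of class `C²` near the closed ball of radius `2` agrees near the unit ball
with a positive `C²` function on the whole space that equals `1` off a compact set. -/
theorem exists_contDiff_extension {W : EuclideanSpace ℝ (Fin n) → ℝ}
    (hW : ∀ y ∈ Metric.closedBall 0 2, ContDiffAt ℝ 2 W y)
    (hpos : ∀ y ∈ Metric.closedBall 0 2, 0 < W y) :
    ∃ v : EuclideanSpace ℝ (Fin n) → ℝ, ContDiff ℝ 2 v ∧ (HasCompactSupport fun y => v y - 1) ∧
      (∀ y, 0 < v y) ∧ ∀ y ∈ Metric.closedBall 0 1, v =ᶠ[𝓝 y] W := by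
  let χ : ContDiffBump (0 : EuclideanSpace ℝ (Fin n)) := ⟨3 / 2, 2, by norm_num, by norm_num⟩
  have hts : tsupport χ = Metric.closedBall 0 2 := χ.tsupport_eq
  have hout : ∀ y ∉ Metric.closedBall (0 : EuclideanSpace ℝ (Fin n)) 2, χ y = 0 := fun y hy =>
    image_eq_zero_of_notMem_tsupport (by rwa [hts])
  refine ⟨fun y => 1 + χ y * (W y - 1), ?_, ?_, fun y => ?_, fun y hy => ?_⟩
  · rw [contDiff_iff_contDiffAt]
    intro y
    by_cases hy : y ∈ Metric.closedBall (0 : EuclideanSpace ℝ (Fin n)) 2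
    · exact contDiffAt_const.add (χ.contDiffAt.mul ((hW y hy).sub contDiffAt_const))
    · refine (contDiffAt_const (c := (1 : ℝ))).congr_of_eventuallyEq ?_
      filter_upwards [Metric.isClosed_closedBall.isOpen_compl.mem_nhds hy] with z hz
      rw [hout z hz, zero_mul, add_zero]
  · refine HasCompactSupport.intro (isCompact_closedBall 0 2) fun y hy => ?_
    simp only [hout y hy]; ring
  · beta_reduce
    by_cases hy : y ∈ Metric.closedBall (0 : EuclideanSpace ℝ (Fin n)) 2
    · have h1 := hpos y hy
      have h2 : 0 ≤ χ y := χ.nonneg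
      have h3 : χ y ≤ 1 := χ.le_one
      rcases h2.eq_or_lt with h | h
      · rw [← h]; norm_num
      · nlinarith [mul_pos h h1]
    · rw [hout y hy]; norm_num
  · have hy' : y ∈ Metric.ball (0 : EuclideanSpace ℝ (Fin n)) (3 / 2) :=
      Metric.closedBall_subset_ball (by norm_num) hy
    filter_upwards [Metric.isOpen_ball.mem_nhds hy'] with z hz
    rw [χ.one_of_mem_closedBall (Metric.ball_subset_closedBall hz)]; ring

theorem setIntegral_rescale (w : EuclideanSpace ℝ (Fin n) → ℝ) (x₀ : EuclideanSpace ℝ (Fin n))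
    {h : ℝ} (hh : 0 < h) (hw : ∀ x ∈ Metric.closedBall x₀ h, 0 ≤ w x) :
    ∫ y in Metric.closedBall 0 1, (h⁻¹ * w (x₀ + h • y)) ^ (-(n : ℝ)) =
      ∫ x in Metric.closedBall x₀ h, w x ^ (-(n : ℝ)) := by
  set F := (Metric.closedBall x₀ h).indicator fun x => w x ^ (-(n : ℝ)) with hF
  have e1 : ∫ y, F (x₀ + h • y) = (h ^ n)⁻¹ * ∫ x, F x := by
    have := Measure.integral_comp_smul volume (fun z => F (x₀ + z)) h
    rw [this, integral_add_left_eq_self, finrank_euclideanSpace_fin, smul_eq_mul,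
      abs_of_pos (by positivity)]
  have e2 : ∀ y, (Metric.closedBall (0 : EuclideanSpace ℝ (Fin n)) 1).indicator
      (fun y => (h⁻¹ * w (x₀ + h • y)) ^ (-(n : ℝ))) y = h ^ n * F (x₀ + h • y) := by
    intro y
    have hm : x₀ + h • y ∈ Metric.closedBall x₀ h ↔
        y ∈ Metric.closedBall (0 : EuclideanSpace ℝ (Fin n)) 1 := by
      rw [Metric.mem_closedBall, dist_self_add_left, norm_smul, Real.norm_of_nonneg hh.le,
        mem_closedBall_zero_iff]
      exact mul_le_iff_le_one_right hh
    by_cases hy : y ∈ Metric.closedBall (0 : EuclideanSpace ℝ (Fin n)) 1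
    · rw [Set.indicator_of_mem hy, hF, Set.indicator_of_mem (hm.2 hy),
        Real.mul_rpow (by positivity) (hw _ (hm.2 hy)), Real.inv_rpow hh.le, Real.rpow_neg hh.le,
        inv_inv, Real.rpow_natCast]
    · rw [Set.indicator_of_notMem hy, hF, Set.indicator_of_notMem (fun h => hy (hm.1 h)), mul_zero]
  rw [← integral_indicator Metric.isClosed_closedBall.measurableSet,
    ← integral_indicator Metric.isClosed_closedBall.measurableSet]
  simp only [e2]
  rw [integral_const_mul, e1, mul_inv_cancel_left₀ (by positivity)]

/-- The small-energy estimate on an open set, in terms of `w`. -/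
theorem exists_energy_threshold_of_isOpen {k : ℕ} (hn : 2 ≤ n) (hk : 1 ≤ k) (hkn : k ≤ n) :
    ∃ δ : ℝ, 0 < δ ∧ ∀ (Ω : Set (EuclideanSpace ℝ (Fin n))) (w : EuclideanSpace ℝ (Fin n) → ℝ),
      (∀ x ∈ Ω, ContDiffAt ℝ 2 w x) → (∀ x ∈ Ω, 0 < w x) → IsAdmissibleOn k Ω w →
      (∀ x ∈ Ω, matrixSigma (schouten w x) k ≤ 1) →
      (∀ x r, Metric.closedBall x r ⊆ Ω →
        ∫ y in Metric.closedBall x r, w y ^ (-(n : ℝ)) ≤ δ) →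
      ∀ x d, 0 ≤ d → Metric.closedBall x d ⊆ Ω → d ≤ 4 * w x := by
  obtain ⟨δ, hδ, hmain⟩ := exists_energy_threshold hn hk hkn
  refine ⟨δ, hδ, fun Ω w hw hpos hadm hσ hint x₀ d hd hball => ?_⟩
  by_contra! hlt
  obtain ⟨x₁, hx₁, hsub, hhalf⟩ := exists_half_le_of_lt
    (fun x hx => (hw x (hball hx)).continuousAt.continuousWithinAt)
    (fun x hx => hpos x (hball hx)) hd hlt
  set h := w x₁ with hh
  have hh0 : 0 < h := hpos x₁ (hball hx₁)
  have hmem : ∀ r, ∀ y ∈ Metric.closedBall (0 : EuclideanSpace ℝ (Fin n)) r,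
      x₁ + h • y ∈ Metric.closedBall x₁ (r * h) := by
    intro r y hy
    rw [mem_closedBall_zero_iff] at hy
    rw [Metric.mem_closedBall, dist_self_add_left, norm_smul, Real.norm_of_nonneg hh0.le, mul_comm]
    gcongr
  have hmemΩ : ∀ y ∈ Metric.closedBall (0 : EuclideanSpace ℝ (Fin n)) 2, x₁ + h • y ∈ Ω :=
    fun y hy => hball (hsub (hmem 2 y hy))
  have h12 : Metric.closedBall (0 : EuclideanSpace ℝ (Fin n)) 1 ⊆ Metric.closedBall 0 2 :=
    Metric.closedBall_subset_closedBall (by norm_num)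
  obtain ⟨v, hv, hvc, hvpos, hveq⟩ := exists_contDiff_extension
    (W := fun y => h⁻¹ * w (x₁ + h • y))
    (fun y hy => contDiffAt_const.mul ((hw _ (hmemΩ y hy)).comp y (by fun_prop)))
    (fun y hy => mul_pos (inv_pos.2 hh0) (hpos _ (hmemΩ y hy)))
  have hsch : ∀ y ∈ Metric.closedBall 0 1, schouten v y = schouten w (x₁ + h • y) := fun y hy =>
    (schouten_congr (hveq y hy)).trans (schouten_rescale w x₁ y hh0.ne')
  have hcon := hmain v hv hvc hvpos
    ⟨fun y hy => by rw [hsch y hy]; exact hadm.sigma_nonneg _ (hmemΩ y (h12 hy)),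
      fun y hy => by rw [hsch y hy]; exact hadm.posSemidef _ (hmemΩ y (h12 hy))⟩
    (fun y hy => by rw [hsch y hy]; exact hσ _ (hmemΩ y (h12 hy)))
    (fun y hy => by
      rw [(hveq y hy).eq_of_nhds, inv_mul_eq_div, le_div_iff₀ hh0]
      have := hhalf _ (hmem 2 y (h12 hy))
      linarith)
    (by
      rw [(hveq 0 (Metric.mem_closedBall_self zero_le_one)).eq_of_nhds, smul_zero, add_zero, ← hh,
        inv_mul_cancel₀ hh0.ne'])
  have hb : Metric.closedBall x₁ h ⊆ Ω :=
    (Metric.closedBall_subset_closedBall (by linarith)).trans (hsub.trans hball)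
  rw [setIntegral_congr_fun Metric.isClosed_closedBall.measurableSet
    (fun y hy => by
      rw [(hveq y hy).eq_of_nhds]),
    setIntegral_rescale w x₁ hh0 fun x hx => (hpos x (hb hx)).le] at hcon
  exact absurd (hint x₁ h hb) (not_le.2 hcon)

end PointPicking

section Conclusion

variable {n : ℕ}

theorem isAdmissibleOn_of_mem_closure_GammaCone {k : ℕ} (hkn : k ≤ n)
    {S : Set (EuclideanSpace ℝ (Fin n))} {w : EuclideanSpace ℝ (Fin n) → ℝ}
    (hherm : ∀ x ∈ S, (schouten w x).IsHermitian)
    (h : ∀ x ∈ S, eigenvalueVector (schouten w x) ∈ closure (GammaCone n k)) :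
    IsAdmissibleOn k S w := by
  refine ⟨fun x hx j hj => ?_, fun x hx j hj => ?_⟩
  · rw [(matrixSigma_eq_esymmOn_eigenvalues (hherm x hx) j).1]
    exact (esymmOn_nonneg_of_mem_closure_GammaCone hkn (h x hx)).1 j hj
  · exact (matrixSigma_eq_esymmOn_eigenvalues (hherm x hx) j).2
      ((esymmOn_nonneg_of_mem_closure_GammaCone hkn (h x hx)).2 j hj)

theorem closedBall_subset_of_lt_infEDist_frontier {Ω : Set (EuclideanSpace ℝ (Fin n))}
    (hΩ : IsOpen Ω) {x : EuclideanSpace ℝ (Fin n)} (hx : x ∈ Ω) {r : NNReal}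
    (hr : (r : ENNReal) < Metric.infEDist x (frontier Ω)) :
    Metric.closedBall x r ⊆ Ω := by
  by_contra hsub
  obtain ⟨y, hy, hyΩ⟩ := Set.not_subset.1 hsub
  have hpc : IsPreconnected (Metric.closedBall x (r : ℝ)) :=
    (convex_closedBall x (r : ℝ)).isPreconnected
  have hfr : ∀ z ∈ Metric.closedBall x (r : ℝ), z ∉ frontier Ω := by
    intro z hz hzf
    have h1 := Metric.infEDist_le_edist_of_mem (x := x) hzf
    have h2 : edist x z ≤ r := by
      rw [edist_nndist, ENNReal.coe_le_coe, ← NNReal.coe_le_coe, coe_nndist, dist_comm]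
      exact hz
    exact absurd (hr.trans_le (h1.trans h2)) (lt_irrefl _)
  have hor : ∀ z ∈ Metric.closedBall x (r : ℝ), z ∈ Ω ∨ z ∈ (closure Ω)ᶜ := by
    intro z hz
    have := hfr z hz
    rw [hΩ.frontier_eq] at this
    by_cases h : z ∈ Ω
    · exact .inl h
    · exact .inr fun hc => this ⟨hc, h⟩
  obtain ⟨z, -, hz1, hz2⟩ := hpc Ω (closure Ω)ᶜ hΩ isClosed_closure.isOpen_compl hor
    ⟨x, Metric.mem_closedBall_self r.coe_nonneg, hx⟩ ⟨y, hy, (hor y hy).resolve_left hyΩ⟩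
  exact hz2 (subset_closure hz1)

/-- One constant works for all `k ≤ n`. -/
theorem exists_uniform_energy_threshold (hn : 2 ≤ n) :
    ∃ δ : ℝ, 0 < δ ∧ ∀ k, 1 ≤ k → k ≤ n →
      ∀ (Ω : Set (EuclideanSpace ℝ (Fin n))) (w : EuclideanSpace ℝ (Fin n) → ℝ),
      (∀ x ∈ Ω, ContDiffAt ℝ 2 w x) → (∀ x ∈ Ω, 0 < w x) → IsAdmissibleOn k Ω w →
      (∀ x ∈ Ω, matrixSigma (schouten w x) k ≤ 1) →
      (∀ x r, Metric.closedBall x r ⊆ Ω →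
        ∫ y in Metric.closedBall x r, w y ^ (-(n : ℝ)) ≤ δ) →
      ∀ x d, 0 ≤ d → Metric.closedBall x d ⊆ Ω → d ≤ 4 * w x := by
  have h : ∀ k ∈ Finset.Icc 1 n, ∀ᶠ δ : ℝ in 𝓝[>] 0,
      ∀ (Ω : Set (EuclideanSpace ℝ (Fin n))) (w : EuclideanSpace ℝ (Fin n) → ℝ),
      (∀ x ∈ Ω, ContDiffAt ℝ 2 w x) → (∀ x ∈ Ω, 0 < w x) → IsAdmissibleOn k Ω w →
      (∀ x ∈ Ω, matrixSigma (schouten w x) k ≤ 1) →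
      (∀ x r, Metric.closedBall x r ⊆ Ω →
        ∫ y in Metric.closedBall x r, w y ^ (-(n : ℝ)) ≤ δ) →
      ∀ x d, 0 ≤ d → Metric.closedBall x d ⊆ Ω → d ≤ 4 * w x := by
    intro k hk
    rw [Finset.mem_Icc] at hk
    obtain ⟨δ, hδ, hmain⟩ := exists_energy_threshold_of_isOpen hn hk.1 hk.2
    filter_upwards [Ioc_mem_nhdsGT hδ] with ε hε Ω w h1 h2 h3 h4 h5
    exact hmain Ω w h1 h2 h3 h4 fun x r hr => (h5 x r hr).trans hε.2
  obtain ⟨δ, h1, h2⟩ := (((Filter.eventually_all_finset _).2 h).and self_mem_nhdsWithin).exists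
  exact ⟨δ, h2, fun k hk hkn => h1 k (Finset.mem_Icc.2 ⟨hk, hkn⟩)⟩

end Conclusion

end

theorem theorem1p4 (n : ℕ) (hn : 3 ≤ n) :
    ∃ δ : ℝ, 0 < δ ∧
      ∀ (k : ℕ), 1 ≤ k → 2 * k ≤ n →
      ∀ (Ω : Set (EuclideanSpace ℝ (Fin n))), IsOpen Ω → Ω.Nonempty →
      ∀ (u : EuclideanSpace ℝ (Fin n) → ℝ), ContDiffOn ℝ 2 u Ω →
        (∀ x ∈ Ω, 0 < u x) →
        (∀ x ∈ Ω, sigmaK k (eigenvalueVector (schoutenMatrix u x)) ≤ 1) →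
        (∀ x ∈ Ω, eigenvalueVector (schoutenMatrix u x) ∈ closure (GammaCone n k)) →
        (∫⁻ x in Ω, ENNReal.ofReal (u x ^ (2 * (n : ℝ) / ((n : ℝ) - 2)))) < ENNReal.ofReal δ →
        ∀ x ∈ Ω,
          Metric.infEDist x (frontier Ω) ^ (((n : ℝ) - 2) / 2) * ENNReal.ofReal (u x)
            ≤ (4 : ℝ≥0∞) ^ (((n : ℝ) - 2) / 2) := by
  obtain ⟨δ, hδ, hmain⟩ := exists_uniform_energy_threshold (n := n) (by omega)
  refine ⟨δ, hδ, fun k hk hkn Ω hΩ _ u hu hpos hσ hΓ hint x hx => ?_⟩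
  have hn2 : (0 : ℝ) < n - 2 := by
    have : (3 : ℝ) ≤ n := by exact_mod_cast hn
    linarith
  have huA : ∀ y ∈ Ω, ContDiffAt ℝ 2 u y := fun y hy => hu.contDiffAt (hΩ.mem_nhds hy)
  set w : EuclideanSpace ℝ (Fin n) → ℝ := fun y => u y ^ (-(2 / ((n : ℝ) - 2))) with hw
  have hsch : ∀ y ∈ Ω, schoutenMatrix u y = schouten w y := fun y hy =>
    schoutenMatrix_eq_schouten hn (huA y hy) (hpos y hy)
  have hherm : ∀ y ∈ Ω, (schouten w y).IsHermitian := fun y hy =>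
    hsch y hy ▸ schoutenMatrix_isHermitian hΩ hu hy
  have hwpos : ∀ y ∈ Ω, 0 < w y := fun y hy => Real.rpow_pos_of_pos (hpos y hy) _
  have hwd : ∀ y ∈ Ω, ContDiffAt ℝ 2 w y := fun y hy =>
    (huA y hy).rpow_const_of_ne (hpos y hy).ne'
  have henergy : ∀ y r, Metric.closedBall y r ⊆ Ω →
      ∫ z in Metric.closedBall y r, w z ^ (-(n : ℝ)) ≤ δ := by
    intro y r hsub
    rw [MeasureTheory.integral_eq_lintegral_of_nonneg_ae]
    · refine (ENNReal.toReal_lt_of_lt_ofReal (lt_of_le_of_lt ?_ hint)).le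
      refine le_trans (le_of_eq ?_) (MeasureTheory.lintegral_mono_set hsub)
      refine MeasureTheory.setLIntegral_congr_fun Metric.isClosed_closedBall.measurableSet
        fun z hz => ?_
      simp only [hw]
      rw [← Real.rpow_mul (hpos z (hsub hz)).le]
      congr 2; field_simp
    · exact (MeasureTheory.ae_restrict_mem Metric.isClosed_closedBall.measurableSet).mono
        fun z hz => Real.rpow_nonneg (hwpos z (hsub hz)).le _
    · refine ContinuousOn.aestronglyMeasurable (fun z hz => ?_)
        Metric.isClosed_closedBall.measurableSet
      exact ((hwd z (hsub hz)).continuousAt.rpow_const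
        (Or.inl (hwpos z (hsub hz)).ne')).continuousWithinAt
  have hdist : Metric.infEDist x (frontier Ω) ≤ ENNReal.ofReal (4 * w x) := by
    refine ENNReal.le_of_forall_nnreal_lt fun r hr => ?_
    have := hmain k hk (by omega) Ω w hwd hwpos
      (isAdmissibleOn_of_mem_closure_GammaCone (by omega) hherm
        fun y hy => hsch y hy ▸ hΓ y hy)
      (fun y hy => by
        rw [(matrixSigma_eq_esymmOn_eigenvalues (hherm y hy) k).1, ← sigmaK_eq_esymmOn, ← hsch y hy]
        exact hσ y hy)
      henergy x r r.coe_nonneg (closedBall_subset_of_lt_infEDist_frontier hΩ hx hr)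
    rw [← ENNReal.ofReal_coe_nnreal]
    exact ENNReal.ofReal_le_ofReal this
  have ha : 0 ≤ ((n : ℝ) - 2) / 2 := by positivity
  have hwx := hwpos x hx
  have hwu : w x ^ (((n : ℝ) - 2) / 2) * u x = 1 := by
    simp only [hw]
    rw [← Real.rpow_mul (hpos x hx).le,
      show -(2 / ((n : ℝ) - 2)) * (((n : ℝ) - 2) / 2) = -1 by field_simp, Real.rpow_neg_one,
      inv_mul_cancel₀ (hpos x hx).ne']
  calc Metric.infEDist x (frontier Ω) ^ (((n : ℝ) - 2) / 2) * ENNReal.ofReal (u x)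
      ≤ ENNReal.ofReal (4 * w x) ^ (((n : ℝ) - 2) / 2) * ENNReal.ofReal (u x) := by gcongr
    _ = ENNReal.ofReal (4 ^ (((n : ℝ) - 2) / 2)) := by
        rw [ENNReal.ofReal_rpow_of_nonneg (by positivity) ha,
          ← ENNReal.ofReal_mul (by positivity), Real.mul_rpow (by norm_num) hwx.le, mul_assoc, hwu,
          mul_one]
    _ = (4 : ℝ≥0∞) ^ (((n : ℝ) - 2) / 2) := by
        rw [← ENNReal.ofReal_rpow_of_nonneg (by norm_num) ha, ENNReal.ofReal_ofNat]
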